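/- **Setting.** Let $u\ge 1$, $\ell=\lceil\lg u\rceil$ ($\lg=\log_2$). For $S\subseteq[0..u)$ let $\mathrm{bintrie}(S)$ be the binary trie of the $\ell$-bit binary codes of the elements of $S$. The subtree of a node at depth $d$ is *full* if all its $2^{\ell-d}$ possible leaves belong to $S$. The *pruned trie* of $S$ is obtained from $\mathrm{bintrie}(S)$ by cutting every maximal full subtree down to its root, and $\mathrm{rTrie}(S)$ is its number of edges. The *code* of the pruned trie lists its nodes at depths $0,\dots,\ell-1$, level by level and from left to right, with two bits per node: $00$ for the root of a removed full subtree, and otherwise one bit for the presence of the left child and one for the presence of the right child. Let $\mathcal S=\{S_1,\dots,S_N\}$ be a family of subsets of $[0..u)$, let $\mathcal Q\subseteq[1..N]$ be a query with $|\mathcal Q|=k\ge1$, and let $\mathcal I(\mathcal Q)=\bigcap_{q\in\mathcal Q}S_q$. A *run-partition certificate* of $\mathcal Q$ is a partition of $[0..u)$ into intervals such that every $x\in\mathcal I(\mathcal Q)$ lies in an interval contained in $\mathcal I(\mathcal Q)$, and every $x\notin\mathcal I(\mathcal Q)$ lies in an interval $I$ with $S_q\cap I=\emptyset$ for some $q\in\mathcal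 Q$. Let $\xi$ be the smallest size of such a certificate. The alternation measure $\delta$ is the smallest size of a *partition certificate*, in which moreover every $x\in\mathcal I(\mathcal Q)$ forms the interval $[x..x]$. **Theorem.** There is a data structure that represents each set $S\subseteq[0..u)$ by a bit string that contains the code of its pruned trie and has at most $2\,\mathrm{rTrie}(S)+o(\mathrm{rTrie}(S))$ bits in total (the $o(\cdot)$ term is a function of $\mathrm{rTrie}(S)$ alone, as $\mathrm{rTrie}(S)\to\infty$, and is $O(1)$ where $\mathrm{rTrie}(S)$ is bounded), and there is a single word-RAM program such that, for every family $\mathcal S$ and every query $\mathcal Q$ as above, $\xi\le\delta$ and the program, given the addresses of the representations of the $k$ sets $S_q$, $q\in\mathcal Q$, computes $\mathcal I(\mathcal Q)$, delivered as the code of its pruned trie (together with a bit telling whether it is empty), in $$O\bigl(k\,\xi\,(1+\lg(u/\xi))\bigr)$$ time, leaving the representations unchanged. The word size $w$ is any number of bits with which the memory cells that hold the representations and $O(ku)$ further cells can be addressed. The implied constants are absolute. -/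

import Mathlib

namespace RunTrie

/-! ## Binary tries, the measure `rTrie`, and the level-wise code -/

/-- Height `ℓ = ⌈lg u⌉` of the binary trie of a subset of `[0..u)`. -/
def height (u : ℕ) : ℕ := Nat.clog 2 u

/-- The `2 ^ (ℓ - d)` integers whose `ℓ`-bit binary code starts with the `d`-bit code of `v`:
the leaves below the position `v` (from left to right) at depth `d` of the complete binary
trie of height `ℓ`. -/
def block (ℓ d v : ℕ) : Finset ℕ :=
  Finset.Ico (v * 2 ^ (ℓ - d)) ((v + 1) * 2 ^ (ℓ - d))

/-- The binary trie of `S` has a node at depth `d`, position `v`. -/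
abbrev IsNode (u : ℕ) (S : Finset ℕ) (d v : ℕ) : Prop :=
  (block (height u) d v ∩ S).Nonempty

/-- The subtree below depth `d`, position `v` is full: all its leaves belong to `S`. -/
abbrev IsFull (u : ℕ) (S : Finset ℕ) (d v : ℕ) : Prop :=
  block (height u) d v ⊆ S

/-- The node at depth `d`, position `v` survives when every maximal full subtree is cut down to
its root: it is a node of the binary trie, and it is the root or its parent's subtree is not
full. -/
abbrev IsKept (u : ℕ) (S : Finset ℕ) (d v : ℕ) : Prop :=
  IsNode u S d v ∧ (d = 0 ∨ ¬ IsFull u S (d - 1) (v / 2))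

/-- `rTrie(S)`: the number of edges of the binary trie of `S` after removing the maximal full
subtrees (their roots are kept).  An edge is counted at its lower endpoint. -/
def rTrie (u : ℕ) (S : Finset ℕ) : ℕ :=
  ∑ d ∈ Finset.Icc 1 (height u), ((Finset.range (2 ^ d)).filter (IsKept u S d)).card

/-- The two-bit code of a node: `00` for the root of a removed full subtree, otherwise the
presence of the left child followed by the presence of the right child. -/
def nodeCode (u : ℕ) (S : Finset ℕ) (d v : ℕ) : List Bool :=
  if IsFull u S d v then [false, false]
  else [decide (IsNode u S (d + 1) (2 * v)), decide (IsNode u S (d + 1) (2 * v + 1))]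

/-- The bit vector of the nodes at depth `d` of the pruned trie, from left to right. -/
def levelCode (u : ℕ) (S : Finset ℕ) (d : ℕ) : List Bool :=
  ((List.range (2 ^ d)).filter (fun v => decide (IsKept u S d v))).flatMap (nodeCode u S d)

/-- The level-wise code of the pruned trie: the bit vectors of the depths `0, …, ℓ - 1`
(the leaves at depth `ℓ` are not encoded). -/
def trieCode (u : ℕ) (S : Finset ℕ) : List Bool :=
  (List.range (height u)).flatMap (levelCode u S)

/-! ## Queries and partition certificates -/

/-- The intersection of the sets `S q`, `q ∈ Q`, inside the universe `[0..u)`. -/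
def inter (u : ℕ) {N : ℕ} (S : Fin N → Finset ℕ) (Q : Finset (Fin N)) : Finset ℕ :=
  (Finset.range u).filter (fun x => ∀ q ∈ Q, x ∈ S q)

/-- All parts of a partition of `[0..u)` are intervals. -/
def IntervalParts {u : ℕ} (P : Finpartition (Finset.range u)) : Prop :=
  ∀ I ∈ P.parts, ∃ a b : ℕ, I = Finset.Icc a b

/-- Every element outside the intersection lies in a part that misses one of the sets. -/
def CoversComplement {u N : ℕ} (S : Fin N → Finset ℕ) (Q : Finset (Fin N))
    (P : Finpartition (Finset.range u)) : Prop :=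
  ∀ x ∈ Finset.range u, x ∉ inter u S Q → ∃ I ∈ P.parts, x ∈ I ∧ ∃ q ∈ Q, S q ∩ I = ∅

/-- Partition certificate: the elements of the intersection are singleton parts. -/
def IsCertificate {u N : ℕ} (S : Fin N → Finset ℕ) (Q : Finset (Fin N))
    (P : Finpartition (Finset.range u)) : Prop :=
  IntervalParts P ∧ (∀ x ∈ inter u S Q, {x} ∈ P.parts) ∧ CoversComplement S Q P

/-- Run-partition certificate: each element of the intersection lies in a part that is
contained in the intersection. -/
def IsRunCertificate {u N : ℕ} (S : Fin N → Finset ℕ) (Q : Finset (Fin N))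
    (P : Finpartition (Finset.range u)) : Prop :=
  IntervalParts P ∧ (∀ x ∈ inter u S Q, ∃ I ∈ P.parts, x ∈ I ∧ inter u S Q ∩ I = I) ∧
    CoversComplement S Q P

/-- The alternation measure `δ`: the size of a smallest partition certificate. -/
noncomputable def alternation (u : ℕ) {N : ℕ} (S : Fin N → Finset ℕ) (Q : Finset (Fin N)) : ℕ :=
  sInf {p | ∃ P : Finpartition (Finset.range u), IsCertificate S Q P ∧ P.parts.card = p}

/-- The run alternation measure `ξ`: the size of a smallest run-partition certificate. -/
noncomputable def runAlternation (u : ℕ) {N : ℕ} (S : Fin N → Finset ℕ)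
    (Q : Finset (Fin N)) : ℕ :=
  sInf {p | ∃ P : Finpartition (Finset.range u), IsRunCertificate S Q P ∧ P.parts.card = p}

/-! ## The word RAM

A machine with `w`-bit words: registers, and a memory addressed by words.  Programs are
structured (sequence, conditional, loop), finite, and independent of `w`.  Every operation on
words, every memory access and every test takes one step. -/

/-- The binary operations on words. -/
inductive BinOp
  | add | sub | mul | div | mod | and | or | xor | shl | shr | eq | lt

/-- Operations on `w`-bit words: unsigned arithmetic modulo `2 ^ w`, bitwise operations, shifts,
and comparisons with result `0` or `1`. -/
def BinOp.eval {w : ℕ} : BinOp → BitVec w → BitVec w → BitVec w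
  | .add, x, y => x + y
  | .sub, x, y => x - y
  | .mul, x, y => x * y
  | .div, x, y => x / y
  | .mod, x, y => x % y
  | .and, x, y => x &&& y
  | .or, x, y => x ||| y
  | .xor, x, y => x ^^^ y
  | .shl, x, y => x <<< y.toNat
  | .shr, x, y => x >>> y.toNat
  | .eq, x, y => if x = y then 1#w else 0#w
  | .lt, x, y => if x.toNat < y.toNat then 1#w else 0#w

/-- Programs; `r`, `a`, `b` are register names. -/
inductive Prog
  /-- `r := n` (a literal of the program text, taken modulo `2 ^ w`) -/
  | const (r n : ℕ)
  /-- `r := a` -/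
  | mov (r a : ℕ)
  /-- `r := a op b` -/
  | op (o : BinOp) (r a b : ℕ)
  /-- `r := mem[a]` -/
  | load (r a : ℕ)
  /-- `mem[a] := r` -/
  | store (a r : ℕ)
  /-- `p; q` -/
  | seq (p q : Prog)
  /-- `if r ≠ 0 then p else q` -/
  | cond (r : ℕ) (p q : Prog)
  /-- `while r ≠ 0 do p` -/
  | loop (r : ℕ) (p : Prog)

/-- Machine states: the contents of the registers and of the memory. Only the memory cells with
address below `2 ^ w` can be accessed by a program. -/
@[ext]
structure State (w : ℕ) where
  reg : ℕ → BitVec w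
  mem : ℕ → BitVec w

/-- Write `x` into register `r`. -/
def State.setReg {w : ℕ} (s : State w) (r : ℕ) (x : BitVec w) : State w :=
  { s with reg := Function.update s.reg r x }

/-- Write `x` into the memory cell with address `a`. -/
def State.setMem {w : ℕ} (s : State w) (a : ℕ) (x : BitVec w) : State w :=
  { s with mem := Function.update s.mem a x }

/-- `Exec p s t s'`: started in state `s`, the program `p` halts in state `s'` after exactly
`t` steps. -/
inductive Exec {w : ℕ} : Prog → State w → ℕ → State w → Prop
  | const (r n : ℕ) (s : State w) :
      Exec (.const r n) s 1 (s.setReg r (BitVec.ofNat w n))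
  | mov (r a : ℕ) (s : State w) :
      Exec (.mov r a) s 1 (s.setReg r (s.reg a))
  | op (o : BinOp) (r a b : ℕ) (s : State w) :
      Exec (.op o r a b) s 1 (s.setReg r (o.eval (s.reg a) (s.reg b)))
  | load (r a : ℕ) (s : State w) :
      Exec (.load r a) s 1 (s.setReg r (s.mem (s.reg a).toNat))
  | store (a r : ℕ) (s : State w) :
      Exec (.store a r) s 1 (s.setMem (s.reg a).toNat (s.reg r))
  | seq {p q : Prog} {s s' s'' : State w} {t t' : ℕ} :
      Exec p s t s' → Exec q s' t' s'' → Exec (.seq p q) s (t + t') s''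
  | cond_true {r : ℕ} {p q : Prog} {s s' : State w} {t : ℕ} :
      s.reg r ≠ 0#w → Exec p s t s' → Exec (.cond r p q) s (t + 1) s'
  | cond_false {r : ℕ} {p q : Prog} {s s' : State w} {t : ℕ} :
      s.reg r = 0#w → Exec q s t s' → Exec (.cond r p q) s (t + 1) s'
  | loop_true {r : ℕ} {p : Prog} {s s' s'' : State w} {t t' : ℕ} :
      s.reg r ≠ 0#w → Exec p s t s' → Exec (.loop r p) s' t' s'' →
      Exec (.loop r p) s (t + t' + 1) s''
  | loop_false {r : ℕ} {p : Prog} {s : State w} :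
      s.reg r = 0#w → Exec (.loop r p) s 1 s

/-- The bit string `b` is stored, `w` bits per word, in the memory cells from address `lo` on,
all of them below address `hi`. -/
def Stores {w : ℕ} (mem : ℕ → BitVec w) (lo hi : ℕ) (b : List Bool) : Prop :=
  ∀ (j : ℕ) (hj : j < b.length), lo + j / w < hi ∧ (mem (lo + j / w)).getLsbD (j % w) = b[j]

/-- `s` is an initial state for the query `Q` on the family `S`, when `rep u T` is the bit string
that represents a set `T`.  The representations of the sets of the family lie, at arbitrary
addresses `addr i`, in the memory cells `[0..D)`.  The `k = |Q|` cells from address `D` on hold the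
addresses of the representations of the queried sets, in any order `e`.  The registers `0, 1, 2, 3`
hold `u`, `w`, `k` and `D`.  All other cells and registers have arbitrary contents. -/
def IsInput {w N : ℕ} (rep : ℕ → Finset ℕ → List Bool) (u : ℕ) (S : Fin N → Finset ℕ)
    (Q : Finset (Fin N)) (D : ℕ) (s : State w) : Prop :=
  ∃ (addr : Fin N → ℕ) (e : Fin Q.card ≃ Q),
    (∀ i, Stores s.mem (addr i) D (rep u (S i))) ∧
    (∀ j : Fin Q.card, s.mem (D + j) = BitVec.ofNat w (addr (e j))) ∧
    s.reg 0 = BitVec.ofNat w u ∧ s.reg 1 = BitVec.ofNat w w ∧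
    s.reg 2 = BitVec.ofNat w Q.card ∧ s.reg 3 = BitVec.ofNat w D

/-- The final state `s` delivers the set `I ⊆ [0..u)`: register `0` tells whether `I` is nonempty,
and the level-wise code of the pruned trie of `I` is stored at the address in register `1`, with its
number of bits in register `2`. -/
def IsOutput {w : ℕ} (u : ℕ) (I : Finset ℕ) (s : State w) : Prop :=
  s.reg 0 = (if I.Nonempty then 1#w else 0#w) ∧
    Stores s.mem (s.reg 1).toNat (2 ^ w) (trieCode u I) ∧
    (s.reg 2).toNat = (trieCode u I).length

end RunTrie

/-!
The tries of the queried sets are traversed simultaneously in level order.  A node is *visited* if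
it is a node of all the tries and not all the subtrees of its parent are full; the traversal goes
on below a visited node unless its subtrees are full in all the tries.

The running time rests on `card_expanded_le`: at each depth there are at most `ξ` nodes where the
traversal goes on, because the first leaves of two such blocks never lie in the same part of a
run-partition certificate.  (A part with both of them contains the first block; but no part inside
the intersection can do so, as some subtree there is not full, and no part that misses a set can,
as all sets have elements in the block.)  Since there are also at most `2 ^ d` nodes at depth `d`,
the numbers sum up to `O(ξ (1 + ℓ - lg ξ))` (`sum_min_le`), and `ℓ` differs from `lg u` by at most
one.  Each visited node costs `O(k)` steps.

The nodes are named by heap numbers, for which the level order is the numeric order and the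
children of `h` are `2 * h` and `2 * h + 1`.  In the code of a pruned trie the child of a node is
found by a rank: the ones in the bits of the preceding nodes count the non-root nodes that precede
the children (`count_codeUpto`, `Pointer.child`).  Inside a removed full subtree the pointer stays
at the root of this subtree, whose bits `00` are recognized as such; the leaves at depth `ℓ`, which
have no bits in the code, are recognized by their indices, and are full as well.  Ranks take
constant time with a two-level directory and a table of the numbers of ones in all short words; the
blocks have at most about `lg n / 2` bits, and at least half as many, where `n` is the length of the
code, so that the directory has `o(n)` bits (`posCode_isLittleO`).  The block size is a power
of two whose logarithm is stored in unary, and the whole layout is computed from it and `n`.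

The records of the visited nodes form a queue, which is then processed backwards: a visited node
belongs to the trie of the intersection if it is full in all the tries, or if one of its children
belongs to it.  The nodes that do are those of the pruned trie of the intersection
(`hKept_inter_iff`), and they stand in the queue in the order of the code to be written.

The program is written in a small imperative language with expressions over natural numbers,
together with rules for total correctness and time (`WP`).  A clock in the program state is charged
a fixed number of steps for each assignment, each write and each test; the rules show that it bounds
the number of steps of the word RAM, and that no operation overflows where a program is used.
-/

namespace RunTrie

/-! ### A small imperative language on top of the word RAM -/

/-- A view of a machine state in natural numbers: the variables `v`, the memory `m`, and a clock
`clk`.  Only the registers below `64` are program variables; the others are scratch registers for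
the evaluation of expressions. -/
structure Store where
  v : ℕ → ℕ
  m : ℕ → ℕ
  clk : ℕ

namespace Store

/-- Assign the value `x` to the variable `r`; an assignment is charged `100` steps. -/
def asg (σ : Store) (r x : ℕ) : Store := ⟨Function.update σ.v r x, σ.m, σ.clk + 100⟩

/-- Write `x` into the memory cell `a`; the write is charged `100` steps. -/
def sto (σ : Store) (a x : ℕ) : Store := ⟨σ.v, Function.update σ.m a x, σ.clk + 100⟩

/-- Charge `100` steps, for the evaluation of a test. -/
def tick (σ : Store) : Store := ⟨σ.v, σ.m, σ.clk + 100⟩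

@[simp] lemma asg_v (σ : Store) (r x r' : ℕ) :
    (σ.asg r x).v r' = if r' = r then x else σ.v r' := by
  simp [asg, Function.update_apply]
@[simp] lemma asg_m (σ : Store) (r x : ℕ) : (σ.asg r x).m = σ.m := rfl
@[simp] lemma asg_clk (σ : Store) (r x : ℕ) : (σ.asg r x).clk = σ.clk + 100 := rfl
@[simp] lemma sto_v (σ : Store) (a x : ℕ) : (σ.sto a x).v = σ.v := rfl
@[simp] lemma sto_m (σ : Store) (a x a' : ℕ) :
    (σ.sto a x).m a' = if a' = a then x else σ.m a' := by
  simp [sto, Function.update_apply]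
@[simp] lemma sto_clk (σ : Store) (a x : ℕ) : (σ.sto a x).clk = σ.clk + 100 := rfl
@[simp] lemma tick_v (σ : Store) : σ.tick.v = σ.v := rfl
@[simp] lemma tick_m (σ : Store) : σ.tick.m = σ.m := rfl
@[simp] lemma tick_clk (σ : Store) : σ.tick.clk = σ.clk + 100 := rfl

/-- All variables and memory cells hold `w`-bit words. -/
def Bounded (w : ℕ) (σ : Store) : Prop := (∀ r < 64, σ.v r < 2 ^ w) ∧ ∀ a, σ.m a < 2 ^ w

end Store

/-- The store `σ` describes the machine state `s`. -/
def Rel {w : ℕ} (s : State w) (σ : Store) : Prop :=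
  (∀ r < 64, (s.reg r).toNat = σ.v r) ∧ ∀ a, (s.mem a).toNat = σ.m a

lemma Rel.bounded {w : ℕ} {s : State w} {σ : Store} (h : Rel s σ) : σ.Bounded w :=
  ⟨fun r hr => by rw [← h.1 r hr]; exact (s.reg r).isLt,
    fun a => by rw [← h.2 a]; exact (s.mem a).isLt⟩

/-- Expressions: literals, variables, operations on words, and memory cells. -/
inductive Expr
  | lit (n : ℕ)
  | var (r : ℕ)
  | bin (o : BinOp) (a b : Expr)
  | cell (a : Expr)

namespace Expr

instance : Add Expr := ⟨bin .add⟩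
instance : Sub Expr := ⟨bin .sub⟩
instance : Mul Expr := ⟨bin .mul⟩
instance : Div Expr := ⟨bin .div⟩
instance : Mod Expr := ⟨bin .mod⟩
instance : ShiftLeft Expr := ⟨bin .shl⟩
instance : ShiftRight Expr := ⟨bin .shr⟩
instance : OrOp Expr := ⟨bin .or⟩
instance (n : ℕ) : OfNat Expr n := ⟨lit n⟩

/-- The truth value of `a < b`. -/
def lt (a b : Expr) : Expr := bin .lt a b

/-- The operations on natural numbers that the word operations realize when nothing overflows;
a left shift drops the bits that leave the word. -/
def opVal (w : ℕ) : BinOp → ℕ → ℕ → ℕ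
  | .add, x, y => x + y
  | .sub, x, y => x - y
  | .mul, x, y => x * y
  | .div, x, y => x / y
  | .mod, x, y => x % y
  | .and, x, y => x &&& y
  | .or, x, y => x ||| y
  | .xor, x, y => x ^^^ y
  | .shl, x, y => (x <<< y) % 2 ^ w
  | .shr, x, y => x >>> y
  | .eq, x, y => if x = y then 1 else 0
  | .lt, x, y => if x < y then 1 else 0

/-- The conditions under which a word operation does not overflow. -/
def opOk (w : ℕ) : BinOp → ℕ → ℕ → Prop
  | .add, x, y => x + y < 2 ^ w
  | .sub, x, y => y ≤ x
  | .mul, x, y => x * y < 2 ^ w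
  | _, _, _ => True

/-- The value of an expression. -/
def val (w : ℕ) (σ : Store) : Expr → ℕ
  | lit n => n
  | var r => σ.v r
  | bin o a b => opVal w o (a.val w σ) (b.val w σ)
  | cell a => σ.m (a.val w σ)

/-- No overflow occurs in the evaluation of an expression. -/
def ok (w : ℕ) (σ : Store) : Expr → Prop
  | lit n => n < 2 ^ w
  | var _ => True
  | bin o a b => a.ok w σ ∧ b.ok w σ ∧ opOk w o (a.val w σ) (b.val w σ)
  | cell a => a.ok w σ

/-- The number of steps of the evaluation of an expression. -/
def cost : Expr → ℕ
  | lit _ => 1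
  | var _ => 1
  | bin _ a b => a.cost + (b.cost + 1)
  | cell a => a.cost + 1

/-- Only program variables occur. -/
def vars : Expr → Bool
  | lit _ => true
  | var r => decide (r < 64)
  | bin _ a b => a.vars && b.vars
  | cell a => a.vars

/-- An expression over program variables whose evaluation takes less than `99` steps, so that the
charge of `100` steps also covers the instruction that uses its value. -/
def small (e : Expr) : Bool := e.vars && decide (e.cost < 99)

/-- The program that evaluates an expression into the register `t`, with the registers from `t`
on as a stack. -/
def compile : Expr → ℕ → Prog
  | lit n, t => .const t n
  | var r, t => .mov t r
  | bin o a b, t => .seq (a.compile t) (.seq (b.compile (t + 1)) (.op o t t (t + 1)))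
  | cell a, t => .seq (a.compile t) (.load t t)

section simps
variable (w : ℕ) (σ : Store) (a b : Expr)

@[simp] lemma val_lit (n : ℕ) : (lit n).val w σ = n := rfl
@[simp] lemma val_ofNat (n : ℕ) : Expr.val w σ (no_index (OfNat.ofNat n)) = n := rfl
@[simp] lemma val_zero : Expr.val w σ 0 = 0 := rfl
@[simp] lemma val_one : Expr.val w σ 1 = 1 := rfl
@[simp] lemma val_var (r : ℕ) : (var r).val w σ = σ.v r := rfl
@[simp] lemma val_cell : (cell a).val w σ = σ.m (a.val w σ) := rfl
@[simp] lemma val_add : (a + b).val w σ = a.val w σ + b.val w σ := rfl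
@[simp] lemma val_sub : (a - b).val w σ = a.val w σ - b.val w σ := rfl
@[simp] lemma val_mul : (a * b).val w σ = a.val w σ * b.val w σ := rfl
@[simp] lemma val_div : (a / b).val w σ = a.val w σ / b.val w σ := rfl
@[simp] lemma val_mod : (a % b).val w σ = a.val w σ % b.val w σ := rfl
@[simp] lemma val_shl : (a <<< b).val w σ = (a.val w σ <<< b.val w σ) % 2 ^ w := rfl
@[simp] lemma val_shr : (a >>> b).val w σ = a.val w σ >>> b.val w σ := rfl
@[simp] lemma val_or : (a ||| b).val w σ = a.val w σ ||| b.val w σ := rfl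
@[simp] lemma val_lt : (lt a b).val w σ = if a.val w σ < b.val w σ then 1 else 0 := rfl
@[simp] lemma ok_lit (n : ℕ) : (lit n).ok w σ ↔ n < 2 ^ w := Iff.rfl
@[simp] lemma ok_ofNat (n : ℕ) : Expr.ok w σ (no_index (OfNat.ofNat n)) ↔ n < 2 ^ w := Iff.rfl
@[simp] lemma ok_zero : Expr.ok w σ 0 := (Nat.two_pow_pos w : 0 < 2 ^ w)
@[simp] lemma ok_one : Expr.ok w σ 1 ↔ 1 < 2 ^ w := Iff.rfl
@[simp] lemma ok_var (r : ℕ) : (var r).ok w σ := trivial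
@[simp] lemma ok_cell : (cell a).ok w σ ↔ a.ok w σ := Iff.rfl
@[simp] lemma ok_add :
    (a + b).ok w σ ↔ a.ok w σ ∧ b.ok w σ ∧ a.val w σ + b.val w σ < 2 ^ w := Iff.rfl
@[simp] lemma ok_sub :
    (a - b).ok w σ ↔ a.ok w σ ∧ b.ok w σ ∧ b.val w σ ≤ a.val w σ := Iff.rfl
@[simp] lemma ok_mul :
    (a * b).ok w σ ↔ a.ok w σ ∧ b.ok w σ ∧ a.val w σ * b.val w σ < 2 ^ w := Iff.rfl
@[simp] lemma ok_div : (a / b).ok w σ ↔ a.ok w σ ∧ b.ok w σ :=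
  ⟨fun h => ⟨h.1, h.2.1⟩, fun h => ⟨h.1, h.2, trivial⟩⟩
@[simp] lemma ok_mod : (a % b).ok w σ ↔ a.ok w σ ∧ b.ok w σ :=
  ⟨fun h => ⟨h.1, h.2.1⟩, fun h => ⟨h.1, h.2, trivial⟩⟩
@[simp] lemma ok_shl : (a <<< b).ok w σ ↔ a.ok w σ ∧ b.ok w σ :=
  ⟨fun h => ⟨h.1, h.2.1⟩, fun h => ⟨h.1, h.2, trivial⟩⟩
@[simp] lemma ok_shr : (a >>> b).ok w σ ↔ a.ok w σ ∧ b.ok w σ :=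
  ⟨fun h => ⟨h.1, h.2.1⟩, fun h => ⟨h.1, h.2, trivial⟩⟩
@[simp] lemma ok_or : (a ||| b).ok w σ ↔ a.ok w σ ∧ b.ok w σ :=
  ⟨fun h => ⟨h.1, h.2.1⟩, fun h => ⟨h.1, h.2, trivial⟩⟩
@[simp] lemma ok_lt : (lt a b).ok w σ ↔ a.ok w σ ∧ b.ok w σ :=
  ⟨fun h => ⟨h.1, h.2.1⟩, fun h => ⟨h.1, h.2, trivial⟩⟩

lemma val_lt_eq_zero : (lt a b).val w σ = 0 ↔ b.val w σ ≤ a.val w σ := by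
  rw [val_lt]
  split_ifs with h
  · simpa using h
  · simpa using h

end simps

end Expr

lemma toNat_eval {w : ℕ} (hw : 1 ≤ w) (o : BinOp) (x y : BitVec w)
    (h : Expr.opOk w o x.toNat y.toNat) :
    (o.eval x y).toNat = Expr.opVal w o x.toNat y.toNat := by
  have h1 : (1#w).toNat = 1 := by
    rw [BitVec.toNat_ofNat]; exact Nat.mod_eq_of_lt (Nat.one_lt_two_pow (by omega))
  cases o with
  | add => simpa [BinOp.eval, Expr.opVal] using Nat.mod_eq_of_lt h
  | sub =>
    simp only [BinOp.eval, Expr.opVal]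
    exact BitVec.toNat_sub_of_le h
  | mul => simpa [BinOp.eval, Expr.opVal] using Nat.mod_eq_of_lt h
  | div => simp [BinOp.eval, Expr.opVal]
  | mod => simp [BinOp.eval, Expr.opVal]
  | and => simp [BinOp.eval, Expr.opVal]
  | or => simp [BinOp.eval, Expr.opVal]
  | xor => simp [BinOp.eval, Expr.opVal]
  | shl => simp [BinOp.eval, Expr.opVal]
  | shr => simp [BinOp.eval, Expr.opVal]
  | eq =>
    simp only [BinOp.eval, Expr.opVal, BitVec.toNat_eq]
    split_ifs <;> simp [h1]
  | lt =>
    simp only [BinOp.eval, Expr.opVal]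
    split_ifs <;> simp [h1]

/-- The compiled expression leaves its value in the register `t`, and changes no register below
`t`. -/
lemma Expr.exec_compile {w : ℕ} (hw : 1 ≤ w) (e : Expr) : ∀ (t : ℕ) (s : State w) (σ : Store),
    64 ≤ t → Rel s σ → e.vars → e.ok w σ →
    ∃ s', Exec (e.compile t) s e.cost s' ∧ (s'.reg t).toNat = e.val w σ ∧
      (∀ r < t, s'.reg r = s.reg r) ∧ s'.mem = s.mem := by
  have setReg_ne : ∀ (s : State w) (t : ℕ) (x : BitVec w) (r : ℕ), r < t →
      (s.setReg t x).reg r = s.reg r := fun s t x r hr => by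
    simp [State.setReg, hr.ne]
  induction e with
  | lit n =>
    intro t s σ ht hs hv hok
    refine ⟨_, .const t n s, ?_, setReg_ne s t _, rfl⟩
    simpa [State.setReg] using Nat.mod_eq_of_lt hok
  | var r =>
    intro t s σ ht hs hv hok
    refine ⟨_, .mov t r s, ?_, setReg_ne s t _, rfl⟩
    simpa [State.setReg] using hs.1 r (by simpa [vars] using hv)
  | bin o a b iha ihb =>
    intro t s σ ht hs hv hok
    simp only [vars, Bool.and_eq_true] at hv
    obtain ⟨s1, e1, v1, f1, m1⟩ := iha t s σ ht hs hv.1 hok.1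
    have hs1 : Rel s1 σ := ⟨fun r hr => by rw [f1 r (by omega)]; exact hs.1 r hr,
      fun a => by rw [m1]; exact hs.2 a⟩
    obtain ⟨s2, e2, v2, f2, m2⟩ := ihb (t + 1) s1 σ (by omega) hs1 hv.2 hok.2.1
    refine ⟨_, .seq e1 (.seq e2 (.op o t t (t + 1) s2)), ?_, fun r hr => ?_, ?_⟩
    · have v1' : (s2.reg t).toNat = a.val w σ := by rw [f2 t (by omega), v1]
      have := toNat_eval hw o (s2.reg t) (s2.reg (t + 1)) (by rw [v1', v2]; exact hok.2.2)
      simp only [State.setReg, Function.update_self, this, v1', v2]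
      rfl
    · rw [setReg_ne _ _ _ _ hr, f2 r (by omega), f1 r hr]
    · simp [State.setReg, m1, m2]
  | cell a iha =>
    intro t s σ ht hs hv hok
    obtain ⟨s1, e1, v1, f1, m1⟩ := iha t s σ ht hs hv hok
    refine ⟨_, .seq e1 (.load t t s1), ?_, fun r hr => ?_, ?_⟩
    · simp only [State.setReg, Function.update_self, m1, v1]
      exact hs.2 _
    · rw [setReg_ne _ _ _ _ hr, f1 r hr]
    · simp [State.setReg, m1]

/-- Assignment of the value of an expression to a variable. -/
def assign (r : ℕ) (e : Expr) : Prog := .seq (e.compile 64) (.mov r 64)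

/-- Store the value of `e` in the memory cell with address `a`. -/
def write (a e : Expr) : Prog :=
  .seq (a.compile 64) (.seq (e.compile 65) (.store 64 65))

/-- Conditional on an expression. -/
def branch (e : Expr) (p q : Prog) : Prog := .seq (e.compile 64) (.cond 64 p q)

/-- Loop while the value of an expression is not `0`. -/
def loopWhile (e : Expr) (p : Prog) : Prog :=
  .seq (e.compile 64) (.loop 64 (.seq p (e.compile 64)))

/-- The program that changes no variable. -/
def skip : Prog := .const 64 0

infixr:30 " ;; " => Prog.seq
infix:35 " ::= " => assign

/-- Total correctness with time: started in a machine state described by `σ`, the program `p`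
halts in a state described by a store in `Q`, whose clock has advanced by at least the number of
steps. -/
def WP (w : ℕ) (p : Prog) (Q : Store → Prop) (σ : Store) : Prop :=
  ∀ s : State w, Rel s σ → ∃ t s' σ', Exec p s t s' ∧ σ.clk + t ≤ σ'.clk ∧ Rel s' σ' ∧ Q σ'

section rules
variable {w : ℕ} {σ : Store} {Q R : Store → Prop} {p q : Prog} {e : Expr}

lemma WP.mono (h : WP w p Q σ) (hQ : ∀ σ', Q σ' → R σ') : WP w p R σ := by
  intro s hs
  obtain ⟨t, s', σ', h1, h2, h3, h4⟩ := h s hs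
  exact ⟨t, s', σ', h1, h2, h3, hQ _ h4⟩

/-- In a proof about a program all variables and memory cells may be assumed to hold words. -/
lemma WP.of_bounded (h : σ.Bounded w → WP w p Q σ) : WP w p Q σ :=
  fun s hs => h hs.bounded s hs

lemma WP.seq (h : WP w p (fun σ' => WP w q Q σ') σ) : WP w (p ;; q) Q σ := by
  intro s hs
  obtain ⟨t, s', σ', h1, h2, h3, h4⟩ := h s hs
  obtain ⟨t', s'', σ'', h1', h2', h3', h4'⟩ := h4 s' h3
  exact ⟨_, s'', σ'', .seq h1 h1', by omega, h3', h4'⟩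

lemma Expr.vars_of_small (e : Expr) (h : e.small) : e.vars = true ∧ e.cost < 99 := by
  simpa [Expr.small] using h

lemma WP.assign (hw : 1 ≤ w) (r : ℕ) (he : e.small) (x : ℕ) (hok : e.ok w σ)
    (hx : e.val w σ = x) (h : Q (σ.asg r x)) : WP w (r ::= e) Q σ := by
  intro s hs
  obtain ⟨s1, e1, v1, f1, m1⟩ := e.exec_compile hw 64 s σ le_rfl hs (e.vars_of_small he).1 hok
  refine ⟨_, _, _, .seq e1 (.mov r 64 s1), ?_, ⟨fun r' hr' => ?_, fun a => ?_⟩, h⟩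
  · have := (e.vars_of_small he).2
    simp only [Store.asg_clk]; omega
  · simp only [State.setReg, Function.update_apply, Store.asg_v]
    split_ifs
    · rw [v1, hx]
    · rw [f1 _ (by omega)]; exact hs.1 _ hr'
  · simpa [State.setReg, m1] using hs.2 a

lemma WP.write (hw : 1 ≤ w) {a : Expr} (hs' : a.cost + e.cost < 99) (ha : a.vars) (he : e.vars)
    (y x : ℕ) (hoka : a.ok w σ) (hok : e.ok w σ) (hy : a.val w σ = y)
    (hx : e.val w σ = x) (h : Q (σ.sto y x)) : WP w (write a e) Q σ := by
  intro s hs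
  obtain ⟨s1, e1, v1, f1, m1⟩ := a.exec_compile hw 64 s σ le_rfl hs ha hoka
  have hs1 : Rel s1 σ := ⟨fun r hr => by rw [f1 r (by omega)]; exact hs.1 r hr,
      fun a => by rw [m1]; exact hs.2 a⟩
  obtain ⟨s2, e2, v2, f2, m2⟩ := e.exec_compile hw 65 s1 σ (by omega) hs1 he hok
  refine ⟨_, _, _, .seq e1 (.seq e2 (.store 64 65 s2)), ?_, ⟨fun r' hr' => ?_, fun a => ?_⟩, h⟩
  · simp only [Store.sto_clk]; omega
  · simp only [State.setMem, Store.sto_v]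
    rw [f2 _ (by omega)]; exact hs1.1 _ hr'
  · have : (s2.reg 64).toNat = y := by rw [f2 64 (by omega), v1, hy]
    simp only [State.setMem, Store.sto_m, this, Function.update_apply]
    split_ifs
    · rw [v2, hx]
    · rw [m2]; exact hs1.2 a

lemma WP.skip (h : Q σ.tick) : WP w skip Q σ := by
  intro s hs
  refine ⟨_, _, σ.tick, .const 64 0 s, ?_, ⟨fun r' hr' => ?_, fun a => hs.2 a⟩, h⟩
  · simp
  · simpa [State.setReg, Function.update_apply, hr'.ne] using hs.1 _ hr'

lemma exec_test (hw : 1 ≤ w) (he : e.small) (hok : e.ok w σ) (s : State w) (hs : Rel s σ) :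
    ∃ s', Exec (e.compile 64) s e.cost s' ∧ Rel s' σ.tick ∧
      (s'.reg 64 = 0#w ↔ e.val w σ = 0) := by
  obtain ⟨s1, e1, v1, f1, m1⟩ := e.exec_compile hw 64 s σ le_rfl hs (e.vars_of_small he).1 hok
  refine ⟨s1, e1, ⟨fun r hr => ?_, fun a => ?_⟩, ?_⟩
  · rw [f1 r hr]; exact hs.1 r hr
  · rw [m1]; exact hs.2 a
  · rw [← v1, BitVec.toNat_eq]; simp

lemma WP.branch (hw : 1 ≤ w) (he : e.small) (hok : e.ok w σ)
    (ht : e.val w σ ≠ 0 → WP w p Q σ.tick) (hf : e.val w σ = 0 → WP w q Q σ.tick) :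
    WP w (branch e p q) Q σ := by
  intro s hs
  obtain ⟨s1, e1, r1, z1⟩ := exec_test hw he hok s hs
  have := (e.vars_of_small he).2
  by_cases h0 : e.val w σ = 0
  · obtain ⟨t, s', σ', h1, h2, h3, h4⟩ := hf h0 s1 r1
    refine ⟨_, s', σ', .seq e1 (.cond_false (z1.2 h0) h1), ?_, h3, h4⟩
    simp only [Store.tick_clk] at h2; omega
  · obtain ⟨t, s', σ', h1, h2, h3, h4⟩ := ht h0 s1 r1
    refine ⟨_, s', σ', .seq e1 (.cond_true (fun h => h0 (z1.1 h)) h1), ?_, h3, h4⟩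
    simp only [Store.tick_clk] at h2; omega

/-- The rule for loops: `I n` is an invariant that holds when `n` bounds the number of rounds that
are still to come. -/
lemma WP.loopWhile (hw : 1 ≤ w) (he : e.small) (I : ℕ → Store → Prop) (n : ℕ) (hI : I n σ)
    (hok : ∀ n σ, I n σ → e.ok w σ)
    (hstep : ∀ n σ, I n σ → e.val w σ ≠ 0 →
      ∃ n' < n, WP w p (fun σ' => I n' σ') σ.tick)
    (hexit : ∀ n σ, I n σ → e.val w σ = 0 → Q σ.tick) :
    WP w (loopWhile e p) Q σ := by
  induction n using Nat.strong_induction_on generalizing σ with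
  | _ n ih =>
  intro s hs
  obtain ⟨s1, e1, r1, z1⟩ := exec_test hw he (hok _ _ hI) s hs
  have := (e.vars_of_small he).2
  by_cases h0 : e.val w σ = 0
  · refine ⟨_, s1, σ.tick, .seq e1 (.loop_false (z1.2 h0)), ?_, r1, hexit _ _ hI h0⟩
    simp only [Store.tick_clk]; omega
  · obtain ⟨n', hn', hwp⟩ := hstep n σ hI h0
    obtain ⟨t, s2, σ2, h1, h2, h3, h4⟩ := hwp s1 r1
    obtain ⟨t', s3, σ3, h1', h2', h3', h4'⟩ := ih n' hn' h4 s2 h3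
    -- The evaluation of the next test belongs to the body of the machine's loop.
    cases h1' with
    | seq hc hl =>
      refine ⟨_, s3, σ3, .seq e1 (.loop_true (fun h => h0 (z1.1 h)) (.seq h1 hc) hl), ?_, h3', h4'⟩
      simp only [Store.tick_clk] at h2; omega

end rules

/-! ### Heap numbers of the trie nodes -/

/-- The trie has a node with heap number `h`; the heap number of the node at depth `d`,
position `v` is `2 ^ d + v`, so that `2 * h` and `2 * h + 1` are the children of `h` and the
numeric order is the level order. -/
abbrev HNode (u : ℕ) (S : Finset ℕ) (h : ℕ) : Prop :=
  IsNode u S (Nat.log 2 h) (h - 2 ^ Nat.log 2 h)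

/-- The subtree below the heap number `h` is full. -/
abbrev HFull (u : ℕ) (S : Finset ℕ) (h : ℕ) : Prop :=
  IsFull u S (Nat.log 2 h) (h - 2 ^ Nat.log 2 h)

/-- The node with heap number `h` belongs to the pruned trie. -/
abbrev HKept (u : ℕ) (S : Finset ℕ) (h : ℕ) : Prop :=
  1 ≤ h ∧ h < 2 ^ (height u + 1) ∧ HNode u S h ∧ (h = 1 ∨ ¬ HFull u S (h / 2))

/-- The two-bit code of the node with heap number `h`. -/
def hCode (u : ℕ) (S : Finset ℕ) (h : ℕ) : List Bool :=
  if HFull u S h then [false, false]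
  else [decide (HNode u S (2 * h)), decide (HNode u S (2 * h + 1))]

/-- The code of the nodes of the pruned trie with heap numbers less than `h`. -/
def codeUpto (u : ℕ) (S : Finset ℕ) : ℕ → List Bool
  | 0 => []
  | h + 1 => codeUpto u S h ++ if HKept u S h then hCode u S h else []

lemma log_child {h i : ℕ} (hh : 1 ≤ h) (hi : i < 2) : Nat.log 2 (2 * h + i) = Nat.log 2 h + 1 := by
  rw [Nat.log_of_one_lt_of_le one_lt_two (by omega)]
  congr 2; omega

lemma pos_child {h i : ℕ} (hh : 1 ≤ h) (hi : i < 2) :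
    2 * h + i - 2 ^ Nat.log 2 (2 * h + i) = 2 * (h - 2 ^ Nat.log 2 h) + i := by
  rw [log_child hh hi, pow_succ]
  have := Nat.pow_log_le_self 2 (x := h) (by omega)
  omega

lemma log_lt_height {u h : ℕ} (hh : 1 ≤ h) (hu : h < 2 ^ height u) : Nat.log 2 h < height u :=
  Nat.log_lt_of_lt_pow (by omega) hu

lemma block_split {l d : ℕ} (v : ℕ) (hd : d < l) :
    block l d v = block l (d + 1) (2 * v) ∪ block l (d + 1) (2 * v + 1) := by
  obtain ⟨k, rfl⟩ : ∃ k, l = d + 1 + k := ⟨l - d - 1, by omega⟩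
  unfold block
  rw [show d + 1 + k - d = k + 1 by omega, show d + 1 + k - (d + 1) = k by omega, pow_succ]
  rw [Finset.Ico_union_Ico_eq_Ico]
  · congr 1 <;> ring
  · gcongr; omega
  · gcongr; omega

lemma block_nonempty (l d v : ℕ) : (block l d v).Nonempty := by
  unfold block
  rw [Finset.nonempty_Ico]
  have := Nat.two_pow_pos (l - d)
  nlinarith

section
variable {u : ℕ} {S : Finset ℕ} {h : ℕ}

lemma HFull.node (hf : HFull u S h) : HNode u S h := by
  unfold HNode IsNode
  rw [Finset.inter_eq_left.2 hf]
  exact block_nonempty _ _ _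

lemma HNode.mono {T : Finset ℕ} (hST : S ⊆ T) (hf : HNode u S h) : HNode u T h :=
  Finset.Nonempty.mono (Finset.inter_subset_inter_left hST) hf

lemma hNode_iff (hh : 1 ≤ h) (hu : h < 2 ^ height u) :
    HNode u S h ↔ HNode u S (2 * h) ∨ HNode u S (2 * h + 1) := by
  have p0 := pos_child (i := 0) hh (by omega)
  have l0 := log_child (i := 0) hh (by omega)
  rw [add_zero] at p0 l0
  unfold HNode IsNode
  rw [p0, l0, pos_child hh (by omega), log_child hh (by omega), add_zero,
    block_split _ (log_lt_height hh hu), Finset.union_inter_distrib_right, Finset.union_nonempty]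

lemma hFull_iff (hh : 1 ≤ h) (hu : h < 2 ^ height u) :
    HFull u S h ↔ HFull u S (2 * h) ∧ HFull u S (2 * h + 1) := by
  have p0 := pos_child (i := 0) hh (by omega)
  have l0 := log_child (i := 0) hh (by omega)
  rw [add_zero] at p0 l0
  unfold HFull IsFull
  rw [p0, l0, pos_child hh (by omega), log_child hh (by omega), add_zero,
    block_split _ (log_lt_height hh hu), Finset.union_subset_iff]

lemma hFull_child (hh : 1 ≤ h) (hu : h < 2 ^ height u) (hf : HFull u S h) {i : ℕ} (hi : i < 2) :
    HFull u S (2 * h + i) := by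
  have := (hFull_iff hh hu).1 hf
  interval_cases i
  exacts [this.1, this.2]

lemma hNode_of_child (hh : 1 ≤ h) (hu : h < 2 ^ height u) {i : ℕ} (hi : i < 2)
    (hf : HNode u S (2 * h + i)) : HNode u S h := by
  rw [hNode_iff hh hu]
  interval_cases i
  exacts [.inl hf, .inr hf]

/-- At depth `ℓ` the nodes are leaves, hence full. -/
lemma HNode.full (hu : 2 ^ height u ≤ h) (hu' : h < 2 ^ (height u + 1)) (hn : HNode u S h) :
    HFull u S h := by
  have hl : Nat.log 2 h = height u := (Nat.log_eq_iff
    (.inr ⟨one_lt_two, by have := Nat.two_pow_pos (height u); omega⟩)).2 ⟨hu, hu'⟩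
  have hb : ∀ v, block (height u) (height u) v = {v} := fun v => by simp [block]
  unfold HNode IsNode at hn
  unfold HFull IsFull
  rw [hl, hb] at hn ⊢
  obtain ⟨x, hx⟩ := hn
  simp only [Finset.mem_inter, Finset.mem_singleton] at hx
  rw [Finset.singleton_subset_iff, ← hx.1]
  exact hx.2

lemma not_hKept_zero : ¬ HKept u S 0 := fun h => by simpa using h.1

lemma pow_height_lt (hu : 1 ≤ u) : 2 ^ height u < 2 * u := by
  unfold height
  rcases hu.eq_or_lt with rfl | h1
  · simp
  · have := Nat.pow_pred_clog_lt_self one_lt_two h1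
    have h2 : 0 < Nat.clog 2 u := Nat.clog_pos one_lt_two h1
    obtain ⟨k, hk⟩ : ∃ k, Nat.clog 2 u = k + 1 := ⟨Nat.clog 2 u - 1, by omega⟩
    rw [hk] at this ⊢
    rw [pow_succ]
    simp at this
    omega

lemma le_pow_height (u : ℕ) : u ≤ 2 ^ height u := Nat.le_pow_clog one_lt_two u

lemma hNode_one (hS : S ⊆ Finset.range u) : HNode u S 1 ↔ S.Nonempty := by
  have : block (height u) 0 0 ∩ S = S := by
    refine Finset.inter_eq_right.2 fun x hx => ?_
    have := Finset.mem_range.1 (hS hx)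
    have := le_pow_height u
    simp only [block, Finset.mem_Ico]; simp; omega
  simp [HNode, IsNode, this]

lemma hKept_one (hS : S ⊆ Finset.range u) : HKept u S 1 ↔ S.Nonempty := by
  have : 1 < 2 ^ (height u + 1) := Nat.one_lt_two_pow (by omega)
  rw [← hNode_one hS]
  exact ⟨fun h => h.2.2.1, fun h => ⟨le_rfl, this, h, .inl rfl⟩⟩

lemma hKept_child (hh : 1 ≤ h) (hu : h < 2 ^ height u) {i : ℕ} (hi : i < 2) :
    HKept u S (2 * h + i) ↔ HNode u S (2 * h + i) ∧ ¬ HFull u S h := by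
  have h1 : (2 * h + i) / 2 = h := by omega
  have h2 : 2 * h + i < 2 ^ (height u + 1) := by rw [pow_succ]; omega
  unfold HKept
  rw [h1]
  constructor
  · rintro ⟨-, -, h3, h4⟩
    exact ⟨h3, h4.resolve_left (by omega)⟩
  · rintro ⟨h3, h4⟩
    exact ⟨by omega, h2, h3, .inr h4⟩

/-- A subtree that is not full is not part of a full one. -/
lemma HKept.of_not_full (hh : 1 ≤ h) (hu : h < 2 ^ (height u + 1)) (hn : HNode u S h)
    (hf : ¬ HFull u S h) : HKept u S h := by
  refine ⟨hh, hu, hn, ?_⟩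
  by_contra hc
  push Not at hc
  have hp : h / 2 < 2 ^ height u := by rw [pow_succ] at hu; omega
  have := hFull_child (by omega) hp hc.2 (i := h % 2) (by omega)
  rw [Nat.div_add_mod] at this
  exact hf this

lemma levelCode_take {d : ℕ} (hd : d < height u) (m : ℕ) (hm : m ≤ 2 ^ d) :
    codeUpto u S (2 ^ d + m) = codeUpto u S (2 ^ d) ++
      ((List.range m).filter (fun v => decide (IsKept u S d v))).flatMap (nodeCode u S d) := by
  induction m with
  | zero => simp
  | succ m ih =>
    have hl : Nat.log 2 (2 ^ d + m) = d := by
      rw [Nat.log_eq_iff (by simp)]; constructor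
      · omega
      · rw [pow_succ]; omega
    have hk : HKept u S (2 ^ d + m) ↔ IsKept u S d m := by
      have h1 : 2 ^ d + m < 2 ^ (height u + 1) :=
        lt_of_lt_of_le (by rw [pow_succ]; omega) (Nat.pow_le_pow_right (by omega) (by omega) :
          2 ^ (d + 1) ≤ 2 ^ (height u + 1))
      have h2 := Nat.two_pow_pos d
      unfold HKept IsKept HNode HFull
      rw [hl, Nat.add_sub_cancel_left]
      rcases d with _ | d
      · have : m = 0 := by simpa using hm
        subst this
        simp
      · have h3 : (2 ^ (d + 1) + m) / 2 = 2 ^ d + m / 2 := by rw [pow_succ]; omega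
        have h4 : Nat.log 2 (2 ^ d + m / 2) = d := by
          rw [Nat.log_eq_iff (by simp)]
          rw [pow_succ] at hm ⊢; constructor <;> omega
        have h5 : 2 ^ (d + 1) + m ≠ 1 := by rw [pow_succ]; have := Nat.two_pow_pos d; omega
        rw [h3, h4, Nat.add_sub_cancel_left]
        simp only [h5, false_or, h1, true_and, Nat.add_sub_cancel, Nat.add_eq_zero_iff,
          one_ne_zero, and_false]
        exact ⟨fun h => h.2, fun h => ⟨by omega, h⟩⟩
    have hc : hCode u S (2 ^ d + m) = nodeCode u S d m := by
      have h2 := Nat.two_pow_pos d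
      have p0 := pos_child (h := 2 ^ d + m) (i := 0) (by omega) (by omega)
      have l0 := log_child (h := 2 ^ d + m) (i := 0) (by omega) (by omega)
      have p1 := pos_child (h := 2 ^ d + m) (i := 1) (by omega) (by omega)
      have l1 := log_child (h := 2 ^ d + m) (i := 1) (by omega) (by omega)
      rw [hl, Nat.add_sub_cancel_left] at p0 p1
      rw [hl] at l0 l1
      rw [add_zero] at p0 l0
      unfold hCode nodeCode HFull HNode
      rw [p0, p1, l0, l1, hl, Nat.add_sub_cancel_left, add_zero]
    rw [← add_assoc, codeUpto, ih (by omega), List.range_succ, List.filter_append,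
      List.flatMap_append, hc, List.append_assoc]
    congr 2
    by_cases hK : IsKept u S d m
    · rw [if_pos (hk.2 hK)]; simp [hK]
    · rw [if_neg (fun h => hK (hk.1 h))]; simp [hK]

/-- The code lists the nodes in the order of their heap numbers. -/
lemma trieCode_eq_codeUpto (u : ℕ) (S : Finset ℕ) :
    trieCode u S = codeUpto u S (2 ^ height u) := by
  suffices ∀ d ≤ height u, (List.range d).flatMap (levelCode u S) = codeUpto u S (2 ^ d) from
    this _ le_rfl
  intro d hd
  induction d with
  | zero => simp [codeUpto, not_hKept_zero]
  | succ d ih =>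
    rw [List.range_succ, List.flatMap_append, ih (by omega), pow_succ, mul_two,
      levelCode_take (by omega) _ le_rfl]
    simp [levelCode]

lemma length_hCode : (hCode u S h).length = 2 := by
  unfold hCode; split_ifs <;> rfl

lemma length_codeUpto (u : ℕ) (S : Finset ℕ) (h : ℕ) :
    (codeUpto u S h).length = 2 * Nat.count (HKept u S) h := by
  induction h with
  | zero => simp [codeUpto]
  | succ h ih =>
    rw [codeUpto, List.length_append, ih, Nat.count_succ]
    split_ifs <;> simp [length_hCode]; ring

lemma codeUpto_prefix {h h' : ℕ} (hh : h ≤ h') : codeUpto u S h <+: codeUpto u S h' := by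
  induction h', hh using Nat.le_induction with
  | base => exact List.prefix_refl _
  | succ h' _ ih => exact ih.trans (List.prefix_append _ _)

/-- The number of ones in the code of the nodes before `h` is the number of non-root nodes before
the children of `h`. -/
lemma count_codeUpto (hS : S ⊆ Finset.range u) (hne : S.Nonempty) (hh : 1 ≤ h)
    (hu : h ≤ 2 ^ height u) :
    Nat.count (HKept u S) (2 * h) = 1 + (codeUpto u S h).count true := by
  induction h, hh using Nat.le_induction with
  | base =>
    simp only [codeUpto, if_neg not_hKept_zero, Nat.count_succ, Nat.count_zero,
      if_pos ((hKept_one hS).2 hne)]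
    simp
  | succ h hh ih =>
    have e : 2 * (h + 1) = 2 * h + 1 + 1 := by ring
    have hu' : h < 2 ^ height u := by omega
    have k0 := hKept_child (S := S) hh hu' (i := 0) (by omega)
    rw [add_zero] at k0
    have k1 := hKept_child (S := S) hh hu' (i := 1) (by omega)
    have hn := hNode_iff (S := S) hh hu'
    rw [e, Nat.count_succ, Nat.count_succ, ih (by omega), codeUpto, List.count_append, add_assoc,
      add_assoc]
    congr 2
    by_cases hf : HFull u S h
    · rw [if_neg (fun h => (k0.1 h).2 hf), if_neg (fun h => (k1.1 h).2 hf)]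
      split_ifs <;> simp [hCode, hf]
    · by_cases hK : HKept u S h
      · simp only [hCode, hf, if_false, if_pos hK, k0, k1, not_false_eq_true, and_true]
        simp only [List.count_cons, List.count_nil]
        simp [add_comm]
      · have hK' := fun h => hK (.of_not_full hh (by rw [pow_succ]; omega) (hn.2 h) hf)
        rw [if_neg (fun h => hK' (.inl (k0.1 h).1)), if_neg (fun h => hK' (.inr (k1.1 h).1))]
        simp [hK]

/-- All the nodes with bits in the code, except the root, are lower endpoints of edges. -/
lemma length_trieCode_le (u : ℕ) (S : Finset ℕ) : (trieCode u S).length ≤ 2 * rTrie u S + 2 := by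
  have h1 : ∀ d, (levelCode u S d).length
      = 2 * ((Finset.range (2 ^ d)).filter (IsKept u S d)).card := by
    intro d
    have : ∀ v, (nodeCode u S d v).length = 2 := fun v => by
      unfold nodeCode; split_ifs <;> rfl
    unfold levelCode
    simp only [List.length_flatMap, this, List.map_const', List.sum_replicate, smul_eq_mul]
    rw [mul_comm]
    rfl
  have h2 : (trieCode u S).length = ∑ d ∈ Finset.range (height u),
      2 * ((Finset.range (2 ^ d)).filter (IsKept u S d)).card := by
    unfold trieCode
    rw [List.length_flatMap, Finset.sum_range, ← List.sum_ofFn]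
    congr 1
    simp only [h1]
    refine List.ext_getElem (by simp) fun i _ _ => by simp
  have key : ∀ (g : ℕ → ℕ) (l : ℕ), g 0 ≤ 1 →
      ∑ d ∈ Finset.range l, g d ≤ ∑ d ∈ Finset.Icc 1 l, g d + 1 := by
    intro g l hg
    rcases l with _ | l
    · simp
    · rw [Finset.sum_range_succ']
      have h3 : ∑ d ∈ Finset.range l, g (d + 1) ≤ ∑ d ∈ Finset.Icc 1 (l + 1), g d := by
        rw [← Finset.sum_image (f := g) (g := fun d => d + 1) (by simp)]
        refine Finset.sum_le_sum_of_subset fun x hx => ?_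
        simp only [Finset.mem_image, Finset.mem_range, Finset.mem_Icc] at hx ⊢
        omega
      omega
  have := key (fun d => ((Finset.range (2 ^ d)).filter (IsKept u S d)).card) (height u)
    ((Finset.card_filter_le _ _).trans (by simp))
  rw [h2, ← Finset.mul_sum]
  unfold rTrie
  omega

lemma length_trieCode (u : ℕ) (S : Finset ℕ) :
    (trieCode u S).length = 2 * Nat.count (HKept u S) (2 ^ height u) := by
  rw [trieCode_eq_codeUpto, length_codeUpto]

lemma length_trieCode_le_universe (hu : 1 ≤ u) (S : Finset ℕ) :
    (trieCode u S).length ≤ 4 * u := by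
  have := pow_height_lt hu
  have : Nat.count (HKept u S) (2 ^ height u) ≤ 2 ^ height u := Nat.count_le _
  rw [length_trieCode]
  omega

end

/-! ### Navigation in the code of the pruned trie -/

/-- The number of ones among the first `p` bits. -/
def rank (c : List Bool) (p : ℕ) : ℕ := (c.take p).count true

/-- The two bits of the node with index `p`, as a number; it is `0` for the root of a removed full
subtree and, since there are no such bits, for the leaves at depth `ℓ`. -/
def look (c : List Bool) (p : ℕ) : ℕ :=
  (c.getD (2 * p) false).toNat + 2 * (c.getD (2 * p + 1) false).toNat

/-- The number `p` serves as a pointer to the node with heap number `h`: for a node whose subtree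
is not full it is the index of the node in the code, otherwise it is any index that is recognized
as the root of a full subtree. -/
def Pointer (u : ℕ) (S : Finset ℕ) (p h : ℕ) : Prop :=
  HNode u S h ∧
    if HFull u S h then look (trieCode u S) p = 0 else p = Nat.count (HKept u S) h

section
variable {u : ℕ} {S : Finset ℕ} {h p : ℕ}

lemma rank_le_length (c : List Bool) (p : ℕ) : rank c p ≤ c.length :=
  List.count_le_length.trans (List.length_take_le' _ _)

lemma trieCode_split (hK : HKept u S h) (hu : h < 2 ^ height u) :
    ∃ r, trieCode u S = codeUpto u S h ++ (hCode u S h ++ r) := by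
  obtain ⟨r, hr⟩ := codeUpto_prefix (u := u) (S := S) (show h + 1 ≤ 2 ^ height u from hu)
  refine ⟨r, ?_⟩
  rw [trieCode_eq_codeUpto, ← hr, codeUpto, if_pos hK, List.append_assoc]

lemma look_append {a b : List Bool} (ha : a.length = 2 * p) :
    look (a ++ b) p = look b 0 := by
  unfold look
  simp only [List.getD_eq_getElem?_getD]
  rw [List.getElem?_append_right (by omega), List.getElem?_append_right (by omega), ha]
  simp

lemma look_of_kept (hK : HKept u S h) (hu : h < 2 ^ height u) :
    look (trieCode u S) (Nat.count (HKept u S) h) =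
      if HFull u S h then 0
      else (decide (HNode u S (2 * h))).toNat + 2 * (decide (HNode u S (2 * h + 1))).toNat := by
  obtain ⟨r, hr⟩ := trieCode_split hK hu
  rw [hr, look_append (length_codeUpto u S h)]
  unfold look hCode
  split_ifs <;> simp

lemma look_of_length_le {c : List Bool} (hp : c.length ≤ 2 * p) : look c p = 0 := by
  unfold look
  rw [List.getD_eq_default _ _ hp, List.getD_eq_default _ _ (by omega)]
  rfl

lemma look_full_of_kept (hK : HKept u S h) (hf : HFull u S h) :
    look (trieCode u S) (Nat.count (HKept u S) h) = 0 := by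
  by_cases hu : h < 2 ^ height u
  · rw [look_of_kept hK hu, if_pos hf]
  · apply look_of_length_le
    rw [length_trieCode]
    have := Nat.count_monotone (HKept u S) (not_lt.1 hu)
    omega

lemma Pointer.of_kept (hK : HKept u S h) : Pointer u S (Nat.count (HKept u S) h) h := by
  refine ⟨hK.2.2.1, ?_⟩
  split_ifs with hf
  exacts [look_full_of_kept hK hf, rfl]

lemma Pointer.root (hS : S ⊆ Finset.range u) (hne : S.Nonempty) : Pointer u S 0 1 := by
  have := Pointer.of_kept ((hKept_one hS).2 hne)
  rwa [Nat.count_succ, Nat.count_zero, if_neg not_hKept_zero] at this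

/-- Inside a removed full subtree a pointer need not be changed. -/
lemma Pointer.child_of_full (hp : Pointer u S p h) (hh : 1 ≤ h) (hu : h < 2 ^ height u)
    (hf : HFull u S h) {i : ℕ} (hi : i < 2) : Pointer u S p (2 * h + i) := by
  have hc := hFull_child hh hu hf hi
  have h2 := hp.2
  rw [if_pos hf] at h2
  exact ⟨hc.node, by rwa [if_pos hc]⟩

lemma lt_of_not_full (hu : h < 2 ^ (height u + 1)) (hn : HNode u S h) (hf : ¬ HFull u S h) :
    h < 2 ^ height u := by
  by_contra hc
  exact hf (hn.full (not_lt.1 hc) hu)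

lemma Pointer.look_eq (hp : Pointer u S p h) (hh : 1 ≤ h) (hu : h < 2 ^ (height u + 1)) :
    look (trieCode u S) p =
      if HFull u S h then 0
      else (decide (HNode u S (2 * h))).toNat + 2 * (decide (HNode u S (2 * h + 1))).toNat := by
  have h2 := hp.2
  split_ifs at h2 ⊢ with hf
  · exact h2
  · rw [h2, look_of_kept (.of_not_full hh hu hp.1 hf) (lt_of_not_full hu hp.1 hf), if_neg hf]

lemma Pointer.look_eq_zero (hp : Pointer u S p h) (hh : 1 ≤ h) (hu : h < 2 ^ (height u + 1)) :
    look (trieCode u S) p = 0 ↔ HFull u S h := by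
  rw [hp.look_eq hh hu]
  split_ifs with hf
  · simp [hf]
  · have := (hNode_iff hh (lt_of_not_full hu hp.1 hf)).1 hp.1
    rcases this with h1 | h1 <;> simp [hf, h1]

/-- The index of a child: the first child of a node comes after the root and the nodes that the ones
in the bits of the preceding nodes stand for, and the second one comes after the first one, if there
is a first one. -/
lemma Pointer.child (hS : S ⊆ Finset.range u) (hp : Pointer u S p h) (hh : 1 ≤ h)
    (hu : h < 2 ^ (height u + 1)) (hf : ¬ HFull u S h) {i : ℕ} (hi : i < 2)
    (hn : HNode u S (2 * h + i)) :
    Pointer u S (1 + rank (trieCode u S) (2 * p) + i * (look (trieCode u S) p % 2))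
      (2 * h + i) := by
  have hK := HKept.of_not_full hh hu hp.1 hf
  have hu' := lt_of_not_full hu hp.1 hf
  have hne : S.Nonempty := by
    obtain ⟨x, hx⟩ := hp.1
    exact ⟨x, (Finset.mem_inter.1 hx).2⟩
  have h2 := hp.2
  rw [if_neg hf] at h2
  have hr : 1 + rank (trieCode u S) (2 * p) = Nat.count (HKept u S) (2 * h) := by
    obtain ⟨r, hr⟩ := trieCode_split hK hu'
    rw [count_codeUpto hS hne hh hu'.le, rank, hr, List.take_append_of_le_length,
      List.take_of_length_le]
    all_goals rw [length_codeUpto, h2]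
  have hc : 1 + rank (trieCode u S) (2 * p) + i * (look (trieCode u S) p % 2)
      = Nat.count (HKept u S) (2 * h + i) := by
    rw [hr]
    interval_cases i
    · simp
    · have k0 := hKept_child (S := S) hh hu' (i := 0) (by omega)
      rw [add_zero] at k0
      rw [Nat.count_succ, hp.look_eq hh hu, if_neg hf]
      simp only [k0, hf, not_false_eq_true, and_true]
      split_ifs with h3 <;> simp [h3]
  rw [hc]
  exact .of_kept ((hKept_child hh hu' hi).2 ⟨hn, hf⟩)

end

/-! ### A rank directory of sublinear size -/

/-- The `wd` least significant bits of `x`. -/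
def fieldBits (wd x : ℕ) : List Bool := (List.range wd).map x.testBit

/-- The number of ones among the `b` least significant bits of `x`. -/
def popcount (b x : ℕ) : ℕ := (fieldBits b x).count true

/-- The logarithm of the block size of the rank directory for `n` bits. -/
def lvl (n : ℕ) : ℕ := Nat.log 2 (Nat.log 2 n / 2 + 1)

/-- The block size: a power of two, at most about `lg n / 2`; superblocks consist of `bsz n`
blocks. -/
def bsz (n : ℕ) : ℕ := 2 ^ lvl n

/-- The width of the fields that hold ranks inside a superblock. -/
def narrow (n : ℕ) : ℕ := 2 * lvl n + 1

/-- The width of the fields that hold ranks in the whole bit string.  It may exceed the word size,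
but the numbers in the fields do not. -/
def wide (n : ℕ) : ℕ := 4 * bsz n

/-- The position of the table of the numbers of ones in the words of `bsz n` bits. -/
def posTable (n : ℕ) : ℕ := lvl n + 2 + wide n

/-- The position of the ranks of the superblocks. -/
def posSuper (n : ℕ) : ℕ := posTable n + 2 ^ bsz n * narrow n

/-- The position of the ranks of the blocks, relative to their superblocks. -/
def posBlock (n : ℕ) : ℕ := posSuper n + (n / (bsz n * bsz n) + 1) * wide n

/-- The position of the bit string itself. -/
def posCode (n : ℕ) : ℕ := posBlock n + (n / bsz n + 1) * narrow n

/-- The consecutive fields of width `wd` with the contents `g 0, …, g (m - 1)`. -/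
def fields (wd m : ℕ) (g : ℕ → ℕ) : List Bool := (List.range m).flatMap fun i => fieldBits wd (g i)

/-- The rank directory of the bit string `c`, preceded by a flag, the logarithm of the block size
in unary, and the length of `c`. -/
def directory (flag : Bool) (c : List Bool) : List Bool :=
  let n := c.length
  let b := bsz n
  flag :: (List.replicate (lvl n) true ++ (false :: (fieldBits (wide n) n ++
    (fields (narrow n) (2 ^ b) (popcount b) ++
    (fields (wide n) (n / (b * b) + 1) (fun i => rank c (i * (b * b))) ++
    fields (narrow n) (n / b + 1) (fun i => rank c (i * b) - rank c (i / b * (b * b))))))))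

/-- The bit string `bs` holds the number `x` in the `wd` bits from position `p` on. -/
def HasField (bs : List Bool) (p wd x : ℕ) : Prop :=
  x < 2 ^ wd ∧ ∀ i < wd, bs[p + i]? = some (x.testBit i)

lemma length_fieldBits (wd x : ℕ) : (fieldBits wd x).length = wd := by simp [fieldBits]

lemma length_fields (wd m : ℕ) (g : ℕ → ℕ) : (fields wd m g).length = m * wd := by
  simp [fields, List.length_flatMap, length_fieldBits]

lemma HasField.append_right {bs : List Bool} {p wd x : ℕ} (h : HasField bs p wd x)
    (r : List Bool) : HasField (bs ++ r) p wd x := by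
  refine ⟨h.1, fun i hi => ?_⟩
  rw [List.getElem?_append_left, h.2 i hi]
  by_contra hc
  have := h.2 i hi
  rw [List.getElem?_eq_none (by omega)] at this
  cases this

lemma HasField.append_left {bs : List Bool} {p wd x : ℕ} (h : HasField bs p wd x)
    (r : List Bool) : HasField (r ++ bs) (r.length + p) wd x := by
  refine ⟨h.1, fun i hi => ?_⟩
  rw [add_assoc, List.getElem?_append_right (by omega), Nat.add_sub_cancel_left, h.2 i hi]

lemma HasField.cons {bs : List Bool} {p wd x : ℕ} (h : HasField bs p wd x)
    (a : Bool) : HasField (a :: bs) (p + 1) wd x := by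
  have := h.append_left [a]
  rwa [List.singleton_append, List.length_singleton, add_comm] at this

lemma hasField_fieldBits {wd x : ℕ} (hx : x < 2 ^ wd) : HasField (fieldBits wd x) 0 wd x :=
  ⟨hx, fun i hi => by simp [fieldBits, hi]⟩

lemma hasField_fields {wd m : ℕ} {g : ℕ → ℕ} {i : ℕ} (hi : i < m) (hx : g i < 2 ^ wd) :
    HasField (fields wd m g) (i * wd) wd (g i) := by
  induction m with
  | zero => omega
  | succ m ih =>
    have e : fields wd (m + 1) g = fields wd m g ++ fieldBits wd (g m) := by
      simp [fields, List.range_succ]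
    rw [e]
    rcases Nat.lt_succ_iff_lt_or_eq.1 hi with h | rfl
    · exact (ih h).append_right _
    · have := (hasField_fieldBits hx).append_left (fields wd i g)
      rwa [length_fields, add_zero] at this

lemma hasField_bit {bs : List Bool} {p : ℕ} {a : Bool} (h : bs[p]? = some a) :
    HasField bs p 1 a.toNat := by
  refine ⟨by cases a <;> simp, fun i hi => ?_⟩
  obtain rfl : i = 0 := by omega
  cases a <;> simpa using h

/-- The number with given binary digits. -/
lemma exists_hasField (bs : List Bool) (p wd : ℕ) (h : p + wd ≤ bs.length) :
    ∃ x, HasField bs p wd x ∧ fieldBits wd x = (bs.drop p).take wd := by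
  have hb : ∀ i (hi : i < wd), (Nat.ofBits fun j : Fin wd => bs[p + j]).testBit i = bs[p + i] := by
    intro i hi
    rw [Nat.testBit_ofBits_lt _ _ hi]
  refine ⟨Nat.ofBits fun i : Fin wd => bs[p + i], ⟨Nat.ofBits_lt_two_pow _, fun i hi => ?_⟩, ?_⟩
  · rw [List.getElem?_eq_getElem (by omega), hb i hi]
  · refine List.ext_getElem (by simp [length_fieldBits]; omega) fun i h1 h2 => ?_
    rw [length_fieldBits] at h1
    simp only [fieldBits, List.getElem_map, List.getElem_range, List.getElem_take,
      List.getElem_drop]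
    exact hb i h1

lemma popcount_of_lt {r b x : ℕ} (hr : r ≤ b) (hx : x < 2 ^ r) : popcount b x = popcount r x := by
  obtain ⟨k, rfl⟩ := Nat.exists_eq_add_of_le hr
  unfold popcount fieldBits
  rw [List.range_add, List.map_append, List.count_append]
  have : ((List.map (fun i => r + i) (List.range k)).map x.testBit).count true = 0 := by
    refine List.count_eq_zero.2 fun h => ?_
    simp only [List.map_map, List.mem_map, List.mem_range, Function.comp_apply] at h
    obtain ⟨i, -, hi⟩ := h
    rw [Nat.testBit_lt_two_pow (hx.trans_le (Nat.pow_le_pow_right (by omega) (by omega)))] at hi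
    cases hi
  rw [this, add_zero]

lemma rank_add (c : List Bool) (p q : ℕ) :
    rank c (p + q) = rank c p + ((c.drop p).take q).count true := by
  unfold rank
  rw [List.take_add, List.count_append]

lemma rank_mono (c : List Bool) {p q : ℕ} (h : p ≤ q) : rank c p ≤ rank c q := by
  obtain ⟨k, rfl⟩ := Nat.exists_eq_add_of_le h
  rw [rank_add]; omega

lemma bsz_pos (n : ℕ) : 0 < bsz n := Nat.two_pow_pos _

lemma bsz_le (n : ℕ) : bsz n ≤ Nat.log 2 n / 2 + 1 := Nat.pow_log_le_self 2 (by omega)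

lemma lt_two_mul_bsz (n : ℕ) : Nat.log 2 n / 2 + 1 < 2 * bsz n := by
  have := Nat.lt_pow_succ_log_self one_lt_two (Nat.log 2 n / 2 + 1)
  rwa [Nat.succ_eq_add_one, pow_succ, mul_comm] at this

lemma lt_two_pow_wide (n : ℕ) : n < 2 ^ wide n := by
  refine (Nat.lt_pow_succ_log_self one_lt_two n).trans_le (Nat.pow_le_pow_right (by omega) ?_)
  have := lt_two_mul_bsz n
  unfold wide
  omega

lemma sq_bsz_lt (n : ℕ) : bsz n * bsz n < 2 ^ narrow n := by
  unfold bsz narrow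
  rw [← pow_add]
  exact Nat.pow_lt_pow_right (by omega) (by omega)

lemma bsz_lt (n : ℕ) : bsz n < 2 ^ narrow n :=
  (Nat.le_mul_self _).trans_lt (sq_bsz_lt n)

lemma popcount_le (b x : ℕ) : popcount b x ≤ b :=
  List.count_le_length.trans (length_fieldBits b x).le

lemma length_directory (flag : Bool) (c : List Bool) :
    (directory flag c).length = posCode c.length := by
  simp only [directory, List.length_cons, List.length_append, List.length_replicate,
    length_fieldBits, length_fields, posCode, posBlock, posSuper, posTable]
  ring

section
variable (flag : Bool) (c : List Bool)

lemma directory_flag (r : List Bool) : HasField (directory flag c ++ r) 0 1 flag.toNat :=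
  hasField_bit (by simp [directory])

lemma directory_unary (r : List Bool) {i : ℕ} (hi : i < lvl c.length) :
    HasField (directory flag c ++ r) (i + 1) 1 1 :=
  hasField_bit (a := true) (by
    simp only [directory, List.cons_append, List.getElem?_cons_succ, List.append_assoc]
    rw [List.getElem?_append_left (by simpa using hi)]
    simp [hi])

lemma directory_unary_end (r : List Bool) :
    HasField (directory flag c ++ r) (lvl c.length + 1) 1 0 :=
  hasField_bit (a := false) (by
    simp only [directory, List.cons_append, List.getElem?_cons_succ, List.append_assoc]
    rw [List.getElem?_append_right (by simp)]
    simp)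

lemma HasField.cons_replicate {bs : List Bool} {p wd x : ℕ} (h : HasField bs p wd x) (t : ℕ) :
    HasField (flag :: (List.replicate t true ++ (false :: bs))) (t + 2 + p) wd x := by
  have := ((h.cons false).append_left (List.replicate t true)).cons flag
  rw [List.length_replicate] at this
  convert this using 1
  ring

lemma directory_length (r : List Bool) :
    HasField (directory flag c ++ r) (lvl c.length + 2) (wide c.length) c.length :=
  HasField.append_right (HasField.cons_replicate flag
    ((hasField_fieldBits (lt_two_pow_wide _)).append_right _) _) _

lemma directory_table (r : List Bool) {x : ℕ} (hx : x < 2 ^ bsz c.length) :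
    HasField (directory flag c ++ r) (posTable c.length + x * narrow c.length) (narrow c.length)
      (popcount (bsz c.length) x) := by
  refine .append_right ?_ _
  have h1 := hasField_fields (wd := narrow c.length) (g := popcount (bsz c.length)) hx
    ((popcount_le _ _).trans_lt (bsz_lt _))
  have : HasField (directory flag c) (lvl c.length + 2 +
      ((fieldBits (wide c.length) c.length).length + x * narrow c.length)) _ _ :=
    HasField.cons_replicate flag ((h1.append_right _).append_left _) _
  rw [length_fieldBits, ← add_assoc] at this
  exact this

lemma directory_super (r : List Bool) {i : ℕ}
    (hi : i < c.length / (bsz c.length * bsz c.length) + 1) :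
    HasField (directory flag c ++ r) (posSuper c.length + i * wide c.length) (wide c.length)
      (rank c (i * (bsz c.length * bsz c.length))) := by
  refine .append_right ?_ _
  have h1 := hasField_fields (wd := wide c.length)
    (g := fun i => rank c (i * (bsz c.length * bsz c.length))) hi
    ((rank_le_length _ _).trans_lt (lt_two_pow_wide _))
  have : HasField (directory flag c) (lvl c.length + 2 +
      ((fieldBits (wide c.length) c.length).length +
      ((fields (narrow c.length) (2 ^ bsz c.length) (popcount (bsz c.length))).length +
        i * wide c.length))) _ _ :=
    HasField.cons_replicate flag (((h1.append_right _).append_left _).append_left _) _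
  rw [length_fieldBits, length_fields, ← add_assoc, ← add_assoc] at this
  exact this

lemma directory_block (r : List Bool) {i : ℕ} (hi : i < c.length / bsz c.length + 1) :
    HasField (directory flag c ++ r) (posBlock c.length + i * narrow c.length) (narrow c.length)
      (rank c (i * bsz c.length)
        - rank c (i / bsz c.length * (bsz c.length * bsz c.length))) := by
  refine .append_right ?_ _
  have hb := bsz_pos c.length
  have h0 : rank c (i * bsz c.length) - rank c (i / bsz c.length * (bsz c.length * bsz c.length))
      < 2 ^ narrow c.length := by
    refine lt_of_le_of_lt ?_ (sq_bsz_lt c.length)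
    have e : i * bsz c.length = i / bsz c.length * (bsz c.length * bsz c.length) +
        i % bsz c.length * bsz c.length := by
      conv_lhs => rw [← Nat.div_add_mod i (bsz c.length)]
      ring
    rw [e, rank_add, Nat.add_sub_cancel_left]
    refine List.count_le_length.trans ((List.length_take_le _ _).trans ?_)
    exact Nat.mul_le_mul_right _ (Nat.mod_lt _ hb).le
  have h1 := hasField_fields (wd := narrow c.length)
    (g := fun i => rank c (i * bsz c.length)
        - rank c (i / bsz c.length * (bsz c.length * bsz c.length))) hi h0
  have : HasField (directory flag c) (lvl c.length + 2 +
      ((fieldBits (wide c.length) c.length).length +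
      ((fields (narrow c.length) (2 ^ bsz c.length) (popcount (bsz c.length))).length +
      ((fields (wide c.length) (c.length / (bsz c.length * bsz c.length) + 1)
        (fun i => rank c (i * (bsz c.length * bsz c.length)))).length +
        i * narrow c.length)))) _ _ :=
    HasField.cons_replicate flag (((h1.append_left _).append_left _).append_left _) _
  rw [length_fieldBits, length_fields, length_fields, ← add_assoc, ← add_assoc, ← add_assoc] at this
  exact this

lemma directory_code {p wd x : ℕ} (h : HasField c p wd x) :
    HasField (directory flag c ++ c) (posCode c.length + p) wd x := by
  have := h.append_left (directory flag c)
  rwa [length_directory] at this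

end

lemma hasField_look {bs : List Bool} {p : ℕ} (hp : 2 * p + 1 < bs.length) :
    HasField bs (2 * p) 2 (look bs p) := by
  have e0 : bs.getD (2 * p) false = bs[2 * p] := List.getD_eq_getElem _ _ (by omega)
  have e1 : bs.getD (2 * p + 1) false = bs[2 * p + 1] :=
    List.getD_eq_getElem _ _ hp
  refine ⟨?_, fun i hi => ?_⟩
  · unfold look
    cases bs.getD (2 * p) false <;> cases bs.getD (2 * p + 1) false <;> simp
  · rw [List.getElem?_eq_getElem (by omega)]
    unfold look
    interval_cases i
    · rw [e0, e1]; simp only [add_zero]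
      cases bs[2 * p] <;> cases bs[2 * p + 1] <;> decide
    · rw [e0, e1]
      cases bs[2 * p] <;> cases bs[2 * p + 1] <;> decide

/-- A rank is the sum of the rank of the superblock, the relative rank of the block, and the number
of ones in a piece of a block. -/
lemma rank_eq (c : List Bool) {b p x : ℕ} (hb : 0 < b)
    (hx : fieldBits (p % b) x = (c.drop (p / b * b)).take (p % b)) (hlt : x < 2 ^ (p % b)) :
    rank c p = rank c (p / (b * b) * (b * b)) +
      (rank c (p / b * b) - rank c (p / b / b * (b * b))) + popcount b x := by
  have e : p / b / b = p / (b * b) := Nat.div_div_eq_div_mul _ _ _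
  have h1 : p / (b * b) * (b * b) ≤ p / b * b := by
    rw [← e, ← mul_assoc]
    exact Nat.mul_le_mul_right _ (Nat.div_mul_le_self _ _)
  rw [e, Nat.add_sub_cancel' (rank_mono c h1), popcount_of_lt (Nat.mod_lt _ hb).le hlt, popcount, hx,
    ← rank_add]
  rw [Nat.div_add_mod']

/-! ### The size of the representation -/

/-- The table of all words of `bsz n` bits has only about `√n` entries. -/
lemma four_pow_bsz_le {n : ℕ} (hn : 1 ≤ n) : 4 ^ bsz n ≤ 4 * n := by
  have h1 := bsz_le n
  have h2 : (4 : ℕ) ^ bsz n = 2 ^ (2 * bsz n) := by rw [pow_mul]; norm_num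
  calc 4 ^ bsz n = 2 ^ (2 * bsz n) := h2
    _ ≤ 2 ^ (Nat.log 2 n + 2) := Nat.pow_le_pow_right (by omega) (by omega)
    _ = 4 * 2 ^ Nat.log 2 n := by rw [pow_add]; ring
    _ ≤ 4 * n := by have := Nat.pow_log_le_self 2 (x := n) (by omega); omega

/-- The directory has `O(n * lvl n / bsz n)` bits. -/
lemma posCode_mul_le {n : ℕ} (hn : 1 ≤ n) :
    posCode n * 2 ^ lvl n ≤ 65 * n * (2 * lvl n + 1) := by
  have ht : lvl n < 2 ^ lvl n := Nat.lt_two_pow_self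
  have hb := bsz_pos n
  have h4 := four_pow_bsz_le hn
  have h4' : (4 : ℕ) ^ bsz n = 2 ^ bsz n * 2 ^ bsz n := by
    rw [← mul_pow]; norm_num
  have hb1 : bsz n < 2 ^ bsz n := Nat.lt_two_pow_self
  have h2b : 2 ≤ 2 ^ bsz n := by omega
  have hd1 : n / (bsz n * bsz n) * (bsz n * bsz n) ≤ n := Nat.div_mul_le_self _ _
  have hd2 : n / bsz n * bsz n ≤ n := Nat.div_mul_le_self _ _
  have hsq : bsz n * bsz n ≤ 4 * n := by
    rw [h4'] at h4
    exact (Nat.mul_le_mul hb1.le hb1.le).trans h4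
  have htb : 2 ^ bsz n * bsz n ≤ 4 * n := by
    rw [h4'] at h4
    exact (Nat.mul_le_mul le_rfl hb1.le).trans h4
  have hsum : posCode n * bsz n = (2 + lvl n + 8 * bsz n + (2 * lvl n + 1)) * bsz n
      + 2 ^ bsz n * bsz n * (2 * lvl n + 1)
      + 4 * (n / (bsz n * bsz n) * (bsz n * bsz n))
      + n / bsz n * bsz n * (2 * lvl n + 1) := by
    unfold posCode posBlock posSuper posTable wide narrow
    ring
  change posCode n * bsz n ≤ _
  rw [hsum]
  change lvl n < bsz n at ht
  have i1 : (2 + lvl n + 8 * bsz n + (2 * lvl n + 1)) * bsz n ≤ 56 * n := by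
    have : (2 + lvl n + 8 * bsz n + (2 * lvl n + 1)) * bsz n ≤ (14 * bsz n) * bsz n :=
      Nat.mul_le_mul_right _ (by omega)
    nlinarith
  have i2 := Nat.mul_le_mul_right (2 * lvl n + 1) htb
  have i3 := Nat.mul_le_mul_right (2 * lvl n + 1) hd2
  nlinarith

lemma posCode_le (n : ℕ) : posCode n ≤ 130 * n + 13 := by
  rcases Nat.eq_zero_or_pos n with rfl | hn
  · decide
  · have h1 := posCode_mul_le hn
    have ht : lvl n < 2 ^ lvl n := Nat.lt_two_pow_self
    have : posCode n * 2 ^ lvl n ≤ (130 * n) * 2 ^ lvl n := by nlinarith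
    exact (Nat.le_of_mul_le_mul_right this (by positivity)).trans (by omega)

open Filter in
lemma tendsto_lvl : Tendsto lvl atTop atTop := by
  have h1 : Tendsto (fun n : ℕ => Nat.log 2 n) atTop atTop :=
    tendsto_atTop_atTop.2 fun k => ⟨2 ^ k, fun n hn => Nat.le_log_of_pow_le one_lt_two hn⟩
  have h2 : Tendsto (fun n : ℕ => n / 2 + 1) atTop atTop :=
    tendsto_atTop_mono (fun n => Nat.le_succ _) (Nat.tendsto_div_const_atTop (by omega))
  exact h1.comp (h2.comp h1)

open Filter in
lemma posCode_isLittleO : ∀ ε : ℝ, 0 < ε → ∀ᶠ n : ℕ in atTop, (posCode n : ℝ) ≤ ε * n := by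
  intro ε hε
  have h0 : Tendsto (fun t : ℕ => (2 * t + 1 : ℝ) / 2 ^ t) atTop (nhds 0) := by
    have h1 := tendsto_pow_const_div_const_pow_of_one_lt 1 (one_lt_two (α := ℝ))
    have h2 := tendsto_pow_const_div_const_pow_of_one_lt 0 (one_lt_two (α := ℝ))
    have := (h1.const_mul 2).add h2
    simp only [mul_zero, add_zero] at this
    refine this.congr fun t => ?_
    rw [pow_one, pow_zero, add_div]; ring
  have h1 := (h0.comp tendsto_lvl).eventually_le_const (show (0 : ℝ) < ε / 65 by positivity)
  filter_upwards [h1, eventually_ge_atTop 1] with n hn hn1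
  have h2 : (posCode n : ℝ) * 2 ^ lvl n ≤ 65 * n * (2 * lvl n + 1) := by
    exact_mod_cast posCode_mul_le hn1
  simp only [Function.comp_apply] at hn
  rw [div_le_iff₀ (by positivity)] at hn
  have hp : (0 : ℝ) < 2 ^ lvl n := by positivity
  refine le_of_mul_le_mul_right (h2.trans ?_) hp
  have : (0 : ℝ) ≤ n := Nat.cast_nonneg _
  nlinarith

/-- A bound for the number of additional bits in terms of the number of edges. -/
def redundancy (m : ℕ) : ℕ := 2 + (Finset.range (2 * m + 3)).sup posCode

open Filter in
lemma redundancy_isLittleO :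
    (fun n : ℕ => (redundancy n : ℝ)) =o[atTop] (fun n : ℕ => (n : ℝ)) := by
  rw [Asymptotics.isLittleO_iff]
  intro ε hε
  obtain ⟨N, hN⟩ := eventually_atTop.1 (posCode_isLittleO (ε / 4) (by positivity))
  obtain ⟨M, hM⟩ := exists_nat_gt ((4 + 2 * (((Finset.range N).sup posCode : ℕ) : ℝ) + 2 * ε) / ε)
  filter_upwards [eventually_ge_atTop M] with m hm
  have h1 : (((Finset.range (2 * m + 3)).sup posCode : ℕ) : ℝ) ≤
      ((Finset.range N).sup posCode : ℕ) + ε / 4 * (2 * m + 2) := by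
    obtain ⟨n, hn, he⟩ := Finset.exists_mem_eq_sup (Finset.range (2 * m + 3)) (by simp) posCode
    rw [he]
    by_cases h : n < N
    · have : (posCode n : ℝ) ≤ ((Finset.range N).sup posCode : ℕ) := by
        exact_mod_cast Finset.le_sup (f := posCode) (Finset.mem_range.2 h)
      have : 0 ≤ ε / 4 * (2 * m + 2) := by positivity
      linarith
    · have h2 := hN n (not_lt.1 h)
      have h3 : (n : ℝ) ≤ 2 * m + 2 := by
        have := Finset.mem_range.1 hn
        exact_mod_cast (by omega : n ≤ 2 * m + 2)
      have : (0 : ℝ) ≤ ((Finset.range N).sup posCode : ℕ) := Nat.cast_nonneg _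
      have : ε / 4 * n ≤ ε / 4 * (2 * m + 2) := by gcongr
      linarith
  rw [div_lt_iff₀ hε] at hM
  have hm' : (M : ℝ) ≤ m := by exact_mod_cast hm
  rw [Real.norm_of_nonneg (Nat.cast_nonneg _), Real.norm_of_nonneg (Nat.cast_nonneg _)]
  unfold redundancy
  push_cast at h1 hM ⊢
  nlinarith

/-- What the representation of `S` holds besides the code of its pruned trie: whether `S` is
nonempty, and the rank directory of the code. -/
abbrev prefixBits (u : ℕ) (S : Finset ℕ) : List Bool :=
  directory (decide S.Nonempty) (trieCode u S)

lemma length_representation_le (u : ℕ) (S : Finset ℕ) :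
    (prefixBits u S ++ trieCode u S ++ []).length ≤ 2 * rTrie u S + redundancy (rTrie u S) := by
  have h1 := length_trieCode_le u S
  have h2 := Finset.le_sup (f := posCode) (s := Finset.range (2 * rTrie u S + 3))
    (Finset.mem_range.2 (by omega : (trieCode u S).length < 2 * rTrie u S + 3))
  simp only [List.append_nil, List.length_append, prefixBits, length_directory, redundancy]
  omega

/-! ### Certificates and the number of visited nodes -/

section certificates
variable {u N : ℕ} {S : Fin N → Finset ℕ} {Q : Finset (Fin N)}

lemma exists_isCertificate (S : Fin N → Finset ℕ) (Q : Finset (Fin N)) :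
    ∃ P : Finpartition (Finset.range u), IsCertificate S Q P := by
  refine ⟨⊥, ?_, ?_, ?_⟩
  · intro I hI
    obtain ⟨x, -, rfl⟩ := Finpartition.mem_bot_iff.1 hI
    exact ⟨x, x, by simp⟩
  · intro x hx
    exact Finpartition.mem_bot_iff.2 ⟨x, (Finset.mem_filter.1 hx).1, rfl⟩
  · intro x hx hxi
    refine ⟨{x}, Finpartition.mem_bot_iff.2 ⟨x, hx, rfl⟩, by simp, ?_⟩
    by_contra hc
    push Not at hc
    refine hxi (Finset.mem_filter.2 ⟨hx, fun q hq => ?_⟩)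
    obtain ⟨y, hy⟩ := hc q hq
    rw [Finset.mem_inter, Finset.mem_singleton] at hy
    exact hy.2 ▸ hy.1

lemma IsCertificate.isRunCertificate {P : Finpartition (Finset.range u)}
    (h : IsCertificate S Q P) : IsRunCertificate S Q P :=
  ⟨h.1, fun x hx => ⟨{x}, h.2.1 x hx, by simp, by simpa using hx⟩, h.2.2⟩

lemma runAlternation_le_alternation (u : ℕ) (S : Fin N → Finset ℕ) (Q : Finset (Fin N)) :
    runAlternation u S Q ≤ alternation u S Q := by
  obtain ⟨P₀, hP₀⟩ := exists_isCertificate (u := u) S Q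
  obtain ⟨P, hP, hc⟩ := Nat.sInf_mem
    (s := {p | ∃ P : Finpartition (Finset.range u), IsCertificate S Q P ∧ P.parts.card = p})
    ⟨_, P₀, hP₀, rfl⟩
  exact Nat.sInf_le ⟨P, hP.isRunCertificate, hc⟩

lemma exists_runAlternation (u : ℕ) (S : Fin N → Finset ℕ) (Q : Finset (Fin N)) :
    ∃ P : Finpartition (Finset.range u),
      IsRunCertificate S Q P ∧ P.parts.card = runAlternation u S Q := by
  obtain ⟨P₀, hP₀⟩ := exists_isCertificate (u := u) S Q
  exact Nat.sInf_mem
    (s := {p | ∃ P : Finpartition (Finset.range u), IsRunCertificate S Q P ∧ P.parts.card = p})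
    ⟨_, P₀, hP₀.isRunCertificate, rfl⟩

lemma one_le_runAlternation (hu : 1 ≤ u) : 1 ≤ runAlternation u S Q := by
  obtain ⟨P, -, hc⟩ := exists_runAlternation u S Q
  rw [← hc, Nat.one_le_iff_ne_zero, Finset.card_ne_zero]
  exact P.parts_nonempty (Finset.nonempty_range_iff.2 (by omega)).ne_empty

lemma runAlternation_le (u : ℕ) (S : Fin N → Finset ℕ) (Q : Finset (Fin N)) :
    runAlternation u S Q ≤ u := by
  obtain ⟨P, -, hc⟩ := exists_runAlternation u S Q
  rw [← hc]
  simpa using P.card_parts_le_card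

/-- At a fixed depth there are at most `ξ` positions where all the queried tries have a node but
not all subtrees are full: the first leaves of such blocks lie in different parts of a
certificate, since a part with the first leaves of two blocks contains all of the first block. -/
lemma card_expanded_le (hS : ∀ i, S i ⊆ Finset.range u) (hQ : Q.Nonempty) (d m : ℕ) :
    ((Finset.range m).filter fun v => (∀ q ∈ Q, IsNode u (S q) d v) ∧
      ∃ q ∈ Q, ¬ IsFull u (S q) d v).card ≤ runAlternation u S Q := by
  obtain ⟨P, ⟨hI, hin, hout⟩, hc⟩ := exists_runAlternation u S Q
  rw [← hc]
  set B := 2 ^ (height u - d) with hB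
  have hBpos : 0 < B := Nat.two_pow_pos _
  have hfirst : ∀ v, (∀ q ∈ Q, IsNode u (S q) d v) → v * B ∈ Finset.range u := by
    intro v hv
    obtain ⟨q, hq⟩ := hQ
    obtain ⟨x, hx⟩ := hv q hq
    rw [Finset.mem_inter, block, Finset.mem_Ico] at hx
    have := Finset.mem_range.1 (hS q hx.2)
    exact Finset.mem_range.2 (hx.1.1.trans_lt this)
  have hno : ∀ v v', v < v' → (∀ q ∈ Q, IsNode u (S q) d v) →
      (∃ q ∈ Q, ¬ IsFull u (S q) d v) → ∀ J ∈ P.parts, v * B ∈ J → v' * B ∈ J → False := by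
    intro v v' hvv hn hf J hJ h1 h2
    obtain ⟨a, b, hab⟩ := hI J hJ
    have hsub : block (height u) d v ⊆ J := by
      intro x hx
      rw [block, Finset.mem_Ico] at hx
      rw [hab, Finset.mem_Icc] at h1 h2 ⊢
      have : (v + 1) * B ≤ v' * B := Nat.mul_le_mul_right _ hvv
      exact ⟨h1.1.trans hx.1, (hx.2.le.trans this).trans h2.2⟩
    have huniq : ∀ I ∈ P.parts, v * B ∈ I → I = J := fun I hI' hx =>
      P.disjoint.elim_finset hI' hJ _ hx h1
    by_cases hx : v * B ∈ inter u S Q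
    · obtain ⟨I, hIp, hxI, hI2⟩ := hin _ hx
      rw [huniq I hIp hxI] at hI2
      obtain ⟨q, hq, hnf⟩ := hf
      refine hnf fun y hy => ?_
      have := hsub hy
      rw [← hI2, Finset.mem_inter] at this
      exact (Finset.mem_filter.1 this.1).2 q hq
    · obtain ⟨I, hIp, hxI, q, hq, hI2⟩ := hout _ (hfirst v hn) hx
      rw [huniq I hIp hxI] at hI2
      obtain ⟨y, hy⟩ := hn q hq
      rw [Finset.mem_inter] at hy
      have : y ∈ S q ∩ J := Finset.mem_inter.2 ⟨hy.2, hsub hy.1⟩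
      rw [hI2] at this
      simp at this
  refine Finset.card_le_card_of_injOn (fun v => P.part (v * B)) ?_ ?_
  · intro v hv
    rw [Finset.mem_coe, Finset.mem_filter] at hv
    exact P.part_mem.2 (hfirst v hv.2.1)
  · intro v hv v' hv' he
    rw [Finset.mem_coe, Finset.mem_filter] at hv hv'
    have m1 := P.mem_part (hfirst v hv.2.1)
    have m2 := P.mem_part (hfirst v' hv'.2.1)
    dsimp only at he
    have p1 := P.part_mem.2 (hfirst v hv.2.1)
    rcases lt_trichotomy v v' with h | h | h
    · rw [← he] at m2
      exact (hno v v' h hv.2.1 hv.2.2 _ p1 m1 m2).elim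
    · exact h
    · rw [← he] at m2
      exact (hno v' v h hv'.2.1 hv'.2.2 _ p1 m2 m1).elim

end certificates

section visited
variable {u k : ℕ} {T : ℕ → Finset ℕ} {h : ℕ}

/-- The simultaneous traversal of the pruned tries of `T 0, …, T (k - 1)` visits the node with heap
number `h`: all the tries have this node, and not all the subtrees of its parent are full. -/
abbrev Visited (u k : ℕ) (T : ℕ → Finset ℕ) (h : ℕ) : Prop :=
  1 ≤ h ∧ h < 2 ^ (height u + 1) ∧ (∀ j < k, HNode u (T j) h) ∧
    (h = 1 ∨ ∃ j < k, ¬ HFull u (T j) (h / 2))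

/-- The traversal visits a node and goes on to its children. -/
abbrev Expanded (u k : ℕ) (T : ℕ → Finset ℕ) (h : ℕ) : Prop :=
  1 ≤ h ∧ (∀ j < k, HNode u (T j) h) ∧ ∃ j < k, ¬ HFull u (T j) h

lemma not_visited_zero : ¬ Visited u k T 0 := fun h => by simpa using h.1

lemma visited_child (hh : 1 ≤ h) (hu : h < 2 ^ height u) {i : ℕ} (hi : i < 2) :
    Visited u k T (2 * h + i) ↔
      (∀ j < k, HNode u (T j) (2 * h + i)) ∧ ∃ j < k, ¬ HFull u (T j) h := by
  have h1 : (2 * h + i) / 2 = h := by omega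
  have h2 : 2 * h + i < 2 ^ (height u + 1) := by rw [pow_succ]; omega
  unfold Visited
  rw [h1]
  constructor
  · rintro ⟨-, -, h3, h4⟩
    exact ⟨h3, h4.resolve_left (by omega)⟩
  · rintro ⟨h3, h4⟩
    exact ⟨by omega, h2, h3, .inr h4⟩

lemma Visited.expanded (hh : 1 ≤ h) {i : ℕ} (hi : i < 2) (hv : Visited u k T (2 * h + i)) :
    Expanded u k T h := by
  have hu : h < 2 ^ height u := by have := hv.2.1; rw [pow_succ] at this; omega
  obtain ⟨h1, h2⟩ := (visited_child hh hu hi).1 hv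
  exact ⟨hh, fun j hj => hNode_of_child hh hu hi (h1 j hj), h2⟩

lemma Visited.parent (hh : 1 ≤ h) {i : ℕ} (hi : i < 2) (hv : Visited u k T (2 * h + i)) :
    Visited u k T h := by
  have hu : h < 2 ^ height u := by have := hv.2.1; rw [pow_succ] at this; omega
  obtain ⟨-, h1, j, hj, h2⟩ := hv.expanded hh hi
  refine ⟨hh, by rw [pow_succ]; omega, h1, ?_⟩
  by_contra hc
  push Not at hc
  have := hFull_child (by omega) (by omega) (hc.2 j hj) (i := h % 2) (by omega)
  rw [Nat.div_add_mod] at this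
  exact h2 this

/-- All visited nodes but the root are children of expanded nodes. -/
lemma count_visited_two_mul_le (hh : 1 ≤ h) :
    Nat.count (Visited u k T) (2 * h) ≤ 1 + 2 * Nat.count (Expanded u k T) h := by
  induction h, hh using Nat.le_induction with
  | base =>
    simp only [Nat.count_succ, Nat.count_zero, if_neg not_visited_zero]
    split_ifs <;> omega
  | succ h hh ih =>
    have e : 2 * (h + 1) = 2 * h + 1 + 1 := by ring
    rw [e, Nat.count_succ, Nat.count_succ, Nat.count_succ]
    have h0 : Visited u k T (2 * h) → Expanded u k T h := Visited.expanded hh (i := 0) (by omega)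
    have h1 : Visited u k T (2 * h + 1) → Expanded u k T h := Visited.expanded hh (by omega)
    by_cases hx : Expanded u k T h
    · rw [if_pos hx]
      split_ifs <;> omega
    · rw [if_neg hx, if_neg (fun h => hx (h0 h)), if_neg (fun h => hx (h1 h))]
      omega

/-- At depth `d` there are at most `2 ^ d` nodes, and at most `x` expanded ones. -/
lemma count_expanded_le {x : ℕ} (hx : ∀ d m, ((Finset.range m).filter fun v =>
      (∀ j < k, IsNode u (T j) d v) ∧ ∃ j < k, ¬ IsFull u (T j) d v).card ≤ x) (l : ℕ) :
    Nat.count (Expanded u k T) (2 ^ l) ≤ ∑ d ∈ Finset.range l, min (2 ^ d) x := by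
  induction l with
  | zero => change Nat.count _ (0 + 1) ≤ _; rw [Nat.count_succ]; simp
  | succ l ih =>
    rw [Finset.sum_range_succ, pow_succ, mul_two, Nat.count_add]
    refine Nat.add_le_add ih (le_min (Nat.count_le _) ?_)
    refine le_trans (le_of_eq ?_) (hx l (2 ^ l))
    rw [Nat.count_eq_card_filter_range]
    congr 1
    refine Finset.filter_congr fun v hv => ?_
    have hv := Finset.mem_range.1 hv
    have hl : Nat.log 2 (2 ^ l + v) = l := by
      rw [Nat.log_eq_iff (.inr ⟨one_lt_two, by omega⟩), pow_succ]; omega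
    unfold Expanded HNode HFull
    rw [hl, Nat.add_sub_cancel_left]
    exact ⟨fun h => h.2, fun h => ⟨by omega, h⟩⟩

/-- The terms with `d < lg x` form a geometric series with a sum of at most `x`. -/
lemma sum_min_le {x : ℕ} (hx : 1 ≤ x) (l : ℕ) :
    ∑ d ∈ Finset.range l, min (2 ^ d) x ≤ x * (1 + (l - Nat.log 2 x)) := by
  have h2 := Nat.pow_log_le_self 2 (x := x) (by omega)
  have key : ∑ d ∈ Finset.range l, min (2 ^ d) x
      ≤ 2 ^ (min l (Nat.log 2 x)) + x * (l - Nat.log 2 x) := by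
    induction l with
    | zero => simp
    | succ l ih =>
      rw [Finset.sum_range_succ]
      by_cases hl : l < Nat.log 2 x
      · rw [min_eq_left (by omega : l ≤ _), Nat.sub_eq_zero_of_le hl.le] at ih
        rw [min_eq_left (by omega : l + 1 ≤ _), Nat.sub_eq_zero_of_le hl, pow_succ]
        have := min_le_left (2 ^ l) x
        omega
      · rw [min_eq_right (by omega : Nat.log 2 x ≤ l)] at ih
        rw [min_eq_right (by omega : Nat.log 2 x ≤ l + 1)]
        rw [Nat.sub_add_comm (by omega), mul_add]
        have := min_le_right (2 ^ l) x
        omega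
  have : 2 ^ (min l (Nat.log 2 x)) ≤ x :=
    (Nat.pow_le_pow_right (by omega) (min_le_right _ _)).trans h2
  rw [mul_add]
  omega

end visited

lemma height_le_logb {u : ℕ} (hu : 1 ≤ u) : (height u : ℝ) ≤ Real.logb 2 u + 1 := by
  have h0 : (0 : ℝ) < u := by exact_mod_cast hu
  have h1 : (2 : ℝ) ^ height u ≤ 2 * u := by exact_mod_cast (pow_height_lt hu).le
  have h2 := Real.logb_le_logb_of_le one_lt_two (by positivity) h1
  rw [Real.logb_pow, Real.logb_self_eq_one one_lt_two, Real.logb_mul (by norm_num) h0.ne',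
    Real.logb_self_eq_one one_lt_two] at h2
  linarith

lemma height_add_one_le {u x : ℕ} (hu : 1 ≤ u) (hx : 1 ≤ x) (hxu : x ≤ u) :
    ((height u : ℝ) + 1) ≤ 3 * (x * (1 + Real.logb 2 ((u : ℝ) / x))) := by
  have h0 : (0 : ℝ) < u := by exact_mod_cast hu
  have hx0 : (1 : ℝ) ≤ x := by exact_mod_cast hx
  have hxu' : (x : ℝ) ≤ u := by exact_mod_cast hxu
  have hd : Real.logb 2 ((u : ℝ) / x) = Real.logb 2 u - Real.logb 2 x :=
    Real.logb_div h0.ne' (by positivity)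
  have hl : 0 ≤ Real.logb 2 ((u : ℝ) / x) :=
    Real.logb_nonneg one_lt_two ((one_le_div (by positivity)).2 hxu')
  have hlx : Real.logb 2 x ≤ x := by
    rw [Real.logb_le_iff_le_rpow one_lt_two (by positivity), Real.rpow_natCast]
    exact_mod_cast Nat.lt_two_pow_self.le
  have := height_le_logb hu
  nlinarith

lemma level_sum_le {u x : ℕ} (hu : 1 ≤ u) (hx : 1 ≤ x) (hxu : x ≤ u) :
    ((1 + 2 * (x * (1 + (height u - Nat.log 2 x))) : ℕ) : ℝ)
      ≤ 7 * (x * (1 + Real.logb 2 ((u : ℝ) / x))) := by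
  have h0 : (0 : ℝ) < u := by exact_mod_cast hu
  have hx0 : (1 : ℝ) ≤ x := by exact_mod_cast hx
  have hxu' : (x : ℝ) ≤ u := by exact_mod_cast hxu
  have hd : Real.logb 2 ((u : ℝ) / x) = Real.logb 2 u - Real.logb 2 x :=
    Real.logb_div h0.ne' (by positivity)
  have hl : 0 ≤ Real.logb 2 ((u : ℝ) / x) :=
    Real.logb_nonneg one_lt_two ((one_le_div (by positivity)).2 hxu')
  have hle : Nat.log 2 x ≤ height u :=
    (Nat.log_mono_right hxu).trans (Nat.log_le_clog 2 u)
  have hlx : Real.logb 2 x ≤ Nat.log 2 x + 1 := by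
    rw [Real.logb_le_iff_le_rpow one_lt_two (by positivity)]
    have : x ≤ 2 ^ (Nat.log 2 x + 1) := (Nat.lt_pow_succ_log_self one_lt_two x).le
    exact_mod_cast this
  have := height_le_logb hu
  push_cast [Nat.cast_sub hle]
  nlinarith

/-! ### Reading the representations -/

prefix:max "𝐯" => Expr.var

/-- The variable that holds `u`. -/
@[simp] abbrev rU : ℕ := 0
/-- The variable that holds the word size. -/
@[simp] abbrev rW : ℕ := 1
/-- The variable that holds the number of sets. -/
@[simp] abbrev rK : ℕ := 2
/-- The variable that holds the address of the query. -/
@[simp] abbrev rD : ℕ := 3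
/-- The address of the parameters of the representations, eight words for each set. -/
@[simp] abbrev rPar : ℕ := 4
/-- The address of the queue of visited nodes. -/
@[simp] abbrev rQue : ℕ := 5
/-- The number of words of a record of the queue. -/
@[simp] abbrev rStr : ℕ := 6
/-- The number `2 ^ ℓ`. -/
@[simp] abbrev rPow : ℕ := 7
/-- Whether all the sets are nonempty. -/
@[simp] abbrev rNe : ℕ := 8
/-- The address of the output. -/
@[simp] abbrev rOut : ℕ := 9
/-- The number of output bits. -/
@[simp] abbrev rLen : ℕ := 10
/-- The index of the current record of the queue. -/
@[simp] abbrev rHead : ℕ := 11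
/-- The number of records of the queue. -/
@[simp] abbrev rTail : ℕ := 12
/-- The heap number of the current node. -/
@[simp] abbrev rH : ℕ := 13
/-- The flag or the code of the current node. -/
@[simp] abbrev rFlag : ℕ := 14
/-- The index of a child's record. -/
@[simp] abbrev rKid : ℕ := 15
/-- The index of a set. -/
@[simp] abbrev rJ : ℕ := 20
/-- Whether all the tries examined so far have the child. -/
@[simp] abbrev rOk : ℕ := 21
/-- Whether all the subtrees examined so far are full. -/
@[simp] abbrev rFull : ℕ := 22
/-- The address of a representation. -/
@[simp] abbrev rA : ℕ := 30
/-- The block size of a representation. -/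
@[simp] abbrev rB : ℕ := 31
/-- The width of the narrow fields of a representation. -/
@[simp] abbrev rNar : ℕ := 32
/-- The length of the code in a representation. -/
@[simp] abbrev rN : ℕ := 33
/-- The position of the table in a representation. -/
@[simp] abbrev rTab : ℕ := 34
/-- The position of the superblock ranks in a representation. -/
@[simp] abbrev rSup : ℕ := 35
/-- The position of the block ranks in a representation. -/
@[simp] abbrev rBlk : ℕ := 36
/-- The position of the code in a representation. -/
@[simp] abbrev rCod : ℕ := 37
/-- A pointer. -/
@[simp] abbrev rX : ℕ := 38
/-- The two bits of a node. -/
@[simp] abbrev rY : ℕ := 39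
/-- The position of a field. -/
@[simp] abbrev rPos : ℕ := 40
/-- The width of a field. -/
@[simp] abbrev rWid : ℕ := 41
/-- Auxiliary variable. -/
@[simp] abbrev r1 : ℕ := 42
/-- Auxiliary variable. -/
@[simp] abbrev r2 : ℕ := 43
/-- Auxiliary variable. -/
@[simp] abbrev r3 : ℕ := 44

/-- The bit string `bs` is stored in the memory cells from `a` on, all of them below `hi`. -/
def BitsAt (w : ℕ) (m : ℕ → ℕ) (a hi : ℕ) (bs : List Bool) : Prop :=
  ∀ (j : ℕ) (hj : j < bs.length), a + j / w < hi ∧ (m (a + j / w)).testBit (j % w) = bs[j]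

lemma BitsAt.congr {w a hi : ℕ} {m m' : ℕ → ℕ} {bs : List Bool} (h : BitsAt w m a hi bs)
    (hm : ∀ x < hi, m' x = m x) : BitsAt w m' a hi bs :=
  fun j hj => ⟨(h j hj).1, by rw [hm _ (h j hj).1]; exact (h j hj).2⟩

lemma BitsAt.addr_lt {w a hi p : ℕ} {m : ℕ → ℕ} {bs : List Bool} (hw : 1 ≤ w)
    (h : BitsAt w m a hi bs) (hbs : bs ≠ []) (hp : p ≤ bs.length) : a + p / w < hi + 1 := by
  have hl := List.length_pos_iff.2 hbs
  have h1 := (h (bs.length - 1) (by omega)).1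
  have h2 : p / w ≤ (bs.length - 1) / w + 1 := by
    rw [← Nat.add_div_right _ (by omega : 0 < w)]
    exact Nat.div_le_div_right (by omega)
  omega

/-- The value of a field that may extend over two words.  If it starts at the beginning of a word,
then the second word is shifted by `w` places and contributes nothing.  A field may be wider than a
word if its value is a word. -/
lemma read_value {w a hi p wd x : ℕ} {m : ℕ → ℕ} {bs : List Bool} (hw : 1 ≤ w)
    (hm : ∀ a, m a < 2 ^ w) (hb : BitsAt w m a hi bs) (hf : HasField bs p wd x)
    (hx : x < 2 ^ w) :
    ((m (a + p / w) >>> (p % w)) ||| ((m (a + p / w + 1) <<< (w - p % w)) % 2 ^ w)) %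
      ((1 <<< wd) % 2 ^ w) = x := by
  have hr : p % w < w := Nat.mod_lt _ hw
  set y := (m (a + p / w) >>> (p % w)) ||| ((m (a + p / w + 1) <<< (w - p % w)) % 2 ^ w) with hy
  have hbit : ∀ i < wd, i < w → y.testBit i = x.testBit i := by
    intro i hi hiw
    have h1 := hf.2 i hi
    obtain ⟨hlt, h1⟩ := List.getElem?_eq_some_iff.1 h1
    rw [← h1, hy, Nat.testBit_or, Nat.testBit_shiftRight, Nat.testBit_mod_two_pow,
      Nat.testBit_shiftLeft, ← (hb _ hlt).2]
    by_cases hc : p % w + i < w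
    · have e1 : (p + i) / w = p / w := by
        conv_lhs => rw [← Nat.div_add_mod p w, add_assoc, Nat.mul_add_div (by omega),
          Nat.div_eq_of_lt hc, add_zero]
      have e2 : (p + i) % w = p % w + i := by
        conv_lhs => rw [← Nat.div_add_mod p w, add_assoc, Nat.mul_add_mod, Nat.mod_eq_of_lt hc]
      have : ¬ (w - p % w ≤ i) := by omega
      simp [e1, e2, this]
    · have e0 : p + i = w * (p / w + 1) + (p % w + i - w) := by
        have := Nat.div_add_mod p w
        rw [mul_add]; omega
      have e1 : (p + i) / w = p / w + 1 := by
        rw [e0, Nat.mul_add_div (by omega), Nat.div_eq_of_lt (show p % w + i - w < w by omega),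
          add_zero]
      have e2 : (p + i) % w = p % w + i - w := by
        rw [e0, Nat.mul_add_mod, Nat.mod_eq_of_lt (by omega)]
      have h3 : w - p % w ≤ i := by omega
      have h4 : (m (a + p / w)).testBit (p % w + i) = false :=
        Nat.testBit_lt_two_pow ((hm _).trans_le (Nat.pow_le_pow_right (by omega) (by omega)))
      have h5 : i - (w - p % w) = p % w + i - w := by omega
      simp [e1, e2, h3, h4, h5, hiw, add_assoc]
  have hyw : y < 2 ^ w := by
    refine Nat.or_lt_two_pow ?_ (Nat.mod_lt _ (Nat.two_pow_pos w))
    rw [Nat.shiftRight_eq_div_pow]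
    exact (Nat.div_le_self _ _).trans_lt (hm _)
  rw [Nat.one_shiftLeft]
  by_cases hwd : wd < w
  · rw [Nat.mod_eq_of_lt (Nat.pow_lt_pow_right (by omega) hwd)]
    refine Nat.eq_of_testBit_eq fun i => ?_
    rw [Nat.testBit_mod_two_pow]
    by_cases hi : i < wd
    · simp [hi, hbit i hi (by omega)]
    · have : x.testBit i = false := Nat.testBit_lt_two_pow
        (hf.1.trans_le (Nat.pow_le_pow_right (by omega) (by omega)))
      simp [hi, this]
  · -- The mask is `0`, and the remainder modulo `0` is the whole word.
    have h0 : 2 ^ wd % 2 ^ w = 0 :=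
      Nat.mod_eq_zero_of_dvd (Nat.pow_dvd_pow 2 (not_lt.1 hwd))
    rw [h0, Nat.mod_zero]
    refine Nat.eq_of_testBit_eq fun i => ?_
    by_cases hi : i < w
    · exact hbit i (by omega) hi
    · have hle : 2 ^ w ≤ 2 ^ i := Nat.pow_le_pow_right (by omega) (by omega)
      rw [Nat.testBit_lt_two_pow (hx.trans_le hle), Nat.testBit_lt_two_pow (hyw.trans_le hle)]

/-- The field at the position and of the width given by two variables, composed from two
consecutive words. -/
def readExpr : Expr :=
  ((.cell (𝐯 rA + 𝐯 rPos / 𝐯 rW) >>> (𝐯 rPos % 𝐯 rW)) |||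
    (.cell (𝐯 rA + 𝐯 rPos / 𝐯 rW + 1) <<< (𝐯 rW - 𝐯 rPos % 𝐯 rW))) % ((1 : Expr) <<< 𝐯 rWid)

/-- Read a field of the current representation into the variable `r`. -/
def readField (r : ℕ) (pos wid : Expr) : Prog := rPos ::= pos ;; rWid ::= wid ;; r ::= readExpr

lemma WP.readField {w : ℕ} {σ : Store} {Q : Store → Prop} {r hi p wd x : ℕ} {pos wid : Expr}
    {bs : List Bool} (hw : 1 ≤ w) (hW : σ.v rW = w) (hb : BitsAt w σ.m (σ.v rA) hi bs)
    (hbs : bs ≠ []) (hhi : hi + 1 < 2 ^ w) (hp : p ≤ bs.length) (hf : HasField bs p wd x)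
    (hx : x < 2 ^ w) (hps : pos.small) (hws : wid.small) (hpok : pos.ok w σ)
    (hpv : pos.val w σ = p) (hwok : wid.ok w (σ.asg rPos p)) (hwv : wid.val w (σ.asg rPos p) = wd)
    (h : Q (((σ.asg rPos p).asg rWid wd).asg r x)) : WP w (readField r pos wid) Q σ := by
  refine WP.of_bounded fun hbd => ?_
  have h1 := hb.addr_lt hw hbs hp
  have hr : p % w < w := Nat.mod_lt _ hw
  refine .seq (.assign hw _ hps p hpok hpv (.seq (.assign hw _ hws wd hwok hwv
    (.assign hw _ (by decide) x ?_ ?_ h))))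
  · simp [readExpr, hW] at h1 hr ⊢
    omega
  · have := read_value hw hbd.2 hb hf hx
    simpa [readExpr, hW] using this

/-- The variables hold the parameters of a representation with address `a` and code length `n`. -/
structure Params (f : ℕ → ℕ) (a n : ℕ) : Prop where
  addr : f 0 = a
  block : f 1 = bsz n
  narrow : f 2 = narrow n
  length : f 3 = n
  table : f 4 = posTable n
  super : f 5 = posSuper n
  blocks : f 6 = posBlock n
  code : f 7 = posCode n

/-- Compute the rank of the position `2 * X` in the current representation. -/
def rankProg : Prog :=
  r3 ::= 2 * 𝐯 rX ;;
  readField r1 (𝐯 rCod + 𝐯 r3 / 𝐯 rB * 𝐯 rB) (𝐯 r3 % 𝐯 rB) ;;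
  readField r1 (𝐯 rTab + 𝐯 r1 * 𝐯 rNar) (𝐯 rNar) ;;
  readField r2 (𝐯 rBlk + 𝐯 r3 / 𝐯 rB * 𝐯 rNar) (𝐯 rNar) ;;
  r1 ::= 𝐯 r1 + 𝐯 r2 ;;
  readField r2 (𝐯 rSup + 𝐯 r3 / (𝐯 rB * 𝐯 rB) * (4 * 𝐯 rB)) (4 * 𝐯 rB) ;;
  r1 ::= 𝐯 r1 + 𝐯 r2

lemma HasField.lt_length {bs : List Bool} {p wd x : ℕ} (h : HasField bs p wd x) (hw : 1 ≤ wd) :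
    p + wd ≤ bs.length := by
  by_contra hc
  have := h.2 (wd - 1) (by omega)
  rw [List.getElem?_eq_none (by omega)] at this
  cases this

lemma sq_le_two_pow (b : ℕ) : b * b ≤ 2 ^ b + 1 := by
  rcases lt_or_ge b 4 with h | h
  · interval_cases b <;> simp
  · induction b, h using Nat.le_induction with
    | base => simp
    | succ b hb ih => rw [pow_succ]; nlinarith

/-- Lower bounds for `posCode`, which show that no overflow occurs in computations with the
parameters. -/
lemma posCode_ge (n : ℕ) :
    2 ^ bsz n + 8 * bsz n + 2 ≤ posCode n ∧ bsz n * bsz n ≤ posCode n := by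
  have h1 : 2 ^ bsz n * 1 ≤ 2 ^ bsz n * RunTrie.narrow n :=
    Nat.mul_le_mul_left _ (by unfold RunTrie.narrow; omega)
  have h2 : 1 * wide n ≤ (n / (bsz n * bsz n) + 1) * wide n :=
    Nat.mul_le_mul_right _ (Nat.le_add_left 1 _)
  have h3 := sq_le_two_pow (bsz n)
  have h4 : wide n = 4 * bsz n := rfl
  have h5 : posCode n ≥ posBlock n := Nat.le_add_right _ _
  unfold posBlock posSuper posTable at h5
  omega

lemma WP.rankProg {w : ℕ} {σ : Store} {hi a p : ℕ} {flag : Bool} {c : List Bool}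
    (hw : 3 ≤ w) (hW : σ.v rW = w) (hpar : Params (fun i => σ.v (rA + i)) a c.length)
    (hb : BitsAt w σ.m a hi (directory flag c ++ c)) (hhi : hi + 1 < 2 ^ w)
    (hcap : posCode c.length + c.length < 2 ^ w) (hX : σ.v rX = p) (hp : 2 * p ≤ c.length) :
    WP w rankProg (fun σ' => σ'.v r1 = rank c (2 * p) ∧ (∀ r < 40, σ'.v r = σ.v r) ∧ σ'.m = σ.m ∧
      σ'.clk ≤ σ.clk + 1500) σ := by
  have hw1 : 1 ≤ w := by omega
  have h8 : 2 ^ 3 ≤ 2 ^ w := Nat.pow_le_pow_right (by omega) hw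
  have hne : directory flag c ++ c ≠ [] := by simp [directory]
  have hlen : (directory flag c ++ c).length = posCode c.length + c.length := by
    rw [List.length_append, length_directory]
  obtain ⟨pa, pb, pn, pl, pt, ps, pk, pc⟩ := hpar
  simp only [rA] at pa pb pn pl pt ps pk pc
  norm_num at pa pb pn pl pt ps pk pc
  set n := c.length with hn
  set q := 2 * p with hq
  have hB := bsz_pos n
  have hBB : 0 < bsz n * bsz n := Nat.mul_pos hB hB
  have hdm := Nat.div_add_mod' q (bsz n)
  -- the bits of the position's block before the position
  obtain ⟨x, hx, hxl⟩ := exists_hasField c (q / bsz n * bsz n) (q % bsz n) (by omega)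
  have hrk := rank_eq c hB hxl hx.1
  have hxB : x < 2 ^ bsz n :=
    hx.1.trans_le (Nat.pow_le_pow_right (by omega) (Nat.mod_lt _ hB).le)
  have f1 := directory_code flag c hx
  have f2 := directory_table flag c c hxB
  have f3 := directory_block flag c c (i := q / bsz n)
    (Nat.lt_succ_of_le (Nat.div_le_div_right hp))
  have f4 := directory_super flag c c (i := q / (bsz n * bsz n))
    (Nat.lt_succ_of_le (Nat.div_le_div_right hp))
  rw [← hn] at f1 f2 f3 f4
  have g2 := f2.lt_length (by unfold RunTrie.narrow; omega)
  have g3 := f3.lt_length (by unfold RunTrie.narrow; omega)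
  have g4 := f4.lt_length (by unfold wide; omega)
  have hrn := rank_le_length c q
  have hx1 : x * 1 ≤ x * RunTrie.narrow n := Nat.mul_le_mul_left _ (by unfold RunTrie.narrow; omega)
  have hcap2 := posCode_ge n
  have hcode : posCode n ≥ posBlock n := Nat.le_add_right _ _
  refine .seq (.assign hw1 _ (by decide) q ?_ ?_ ?_)
  · simp [hX]; omega
  · simp [hX, hq]
  refine .seq (.readField (bs := directory flag c ++ c) (hi := hi) hw1 ?_ ?_ hne hhi ?_ f1 ?_
    (by decide) (by decide) ?_ ?_ ?_ ?_ ?_)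
  · simp [hW]
  · simpa [pa] using hb
  · omega
  · omega
  · simp [pc, pb]; omega
  · simp [pc, pb]
  · simp
  · simp [pb]
  refine .seq (.readField (bs := directory flag c ++ c) (hi := hi) hw1 ?_ ?_ hne hhi ?_ f2 ?_
    (by decide) (by decide) ?_ ?_ ?_ ?_ ?_)
  · simp [hW]
  · simpa [pa] using hb
  · omega
  · have := popcount_le (bsz n) x; omega
  · simp [pt, pn]; omega
  · simp [pt, pn]
  · simp
  · simp [pn]
  refine .seq (.readField (bs := directory flag c ++ c) (hi := hi) hw1 ?_ ?_ hne hhi ?_ f3 ?_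
    (by decide) (by decide) ?_ ?_ ?_ ?_ ?_)
  · simp [hW]
  · simpa [pa] using hb
  · omega
  · omega
  · simp [pk, pn, pb]; omega
  · simp [pk, pn, pb]
  · simp
  · simp [pn]
  refine .seq (.assign hw1 _ (by decide) (popcount (bsz n) x + (rank c (q / bsz n * bsz n)
      - rank c (q / bsz n / bsz n * (bsz n * bsz n)))) ?_ ?_ ?_)
  · simp; omega
  · simp
  refine .seq (.readField (bs := directory flag c ++ c) (hi := hi) hw1 ?_ ?_ hne hhi ?_ f4 ?_
    (by decide) (by decide) ?_ ?_ ?_ ?_ ?_)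
  · simp [hW]
  · simpa [pa] using hb
  · omega
  · omega
  · unfold wide at g4; simp [ps, pb]; omega
  · simp [ps, pb, wide]
  · simp [pb]; omega
  · simp [pb, wide]
  refine .assign hw1 _ (by decide) (rank c q) ?_ ?_ ⟨?_, ?_, ?_, ?_⟩
  · simp; omega
  · simp; omega
  · simp
  · intro r hr
    simp
    repeat rw [if_neg (by omega)]
  · rfl
  · simp

/-! ### The simultaneous traversal of the pruned tries -/

/-- The general assumptions.  The factor `2000` in the bound for the word size leaves room for the
queue and the output, and for the length of the representations, which is `O(u)`. -/
structure Setting (w u k D : ℕ) (T : ℕ → Finset ℕ) : Prop where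
  one_le_u : 1 ≤ u
  one_le_k : 1 ≤ k
  subset : ∀ j < k, T j ⊆ Finset.range u
  cap : D + 2000 * (k * u) ≤ 2 ^ w

/-- The variables with the same values during the whole computation. -/
structure Globals (w u k D : ℕ) (f : ℕ → ℕ) : Prop where
  eq_u : f 0 = u
  eq_w : f 1 = w
  eq_k : f 2 = k
  eq_d : f 3 = D
  eq_par : f 4 = D + k
  eq_que : f 5 = D + 9 * k
  eq_str : f 6 = k + 2
  eq_pow : f 7 = 2 ^ height u

lemma Globals.congr {w u k D : ℕ} {f g : ℕ → ℕ} (h : Globals w u k D f)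
    (hfg : ∀ r < 8, g r = f r) : Globals w u k D g :=
  ⟨(hfg 0 (by omega)).trans h.eq_u, (hfg 1 (by omega)).trans h.eq_w, (hfg 2 (by omega)).trans h.eq_k,
    (hfg 3 (by omega)).trans h.eq_d, (hfg 4 (by omega)).trans h.eq_par,
    (hfg 5 (by omega)).trans h.eq_que,
    (hfg 6 (by omega)).trans h.eq_str, (hfg 7 (by omega)).trans h.eq_pow⟩

/-- The parameters of the representation of `S` are in the memory cells from `par` on. -/
def SetAt (w u D : ℕ) (m : ℕ → ℕ) (par : ℕ) (S : Finset ℕ) : Prop :=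
  ∃ a, Params (fun i => m (par + i)) a (trieCode u S).length ∧
    BitsAt w m a D (prefixBits u S ++ trieCode u S)

/-- The parameters of all the representations are available. -/
def SetsAt (w u k D : ℕ) (T : ℕ → Finset ℕ) (m : ℕ → ℕ) : Prop :=
  ∀ j < k, SetAt w u D m (D + k + 8 * j) (T j)

lemma SetAt.congr {w u D par : ℕ} {S : Finset ℕ} {m m' : ℕ → ℕ} (h : SetAt w u D m par S)
    (hm : ∀ x, x < D ∨ par ≤ x ∧ x < par + 8 → m' x = m x) : SetAt w u D m' par S := by
  obtain ⟨a, hp, hb⟩ := h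
  have e : ∀ i < 8, m' (par + i) = m (par + i) := fun i hi => hm _ (by omega)
  exact ⟨a, ⟨(e 0 (by omega)).trans hp.1, (e 1 (by omega)).trans hp.2, (e 2 (by omega)).trans hp.3,
    (e 3 (by omega)).trans hp.4, (e 4 (by omega)).trans hp.5, (e 5 (by omega)).trans hp.6,
    (e 6 (by omega)).trans hp.7, (e 7 (by omega)).trans hp.8⟩, hb.congr fun x hx => hm x (by omega)⟩

lemma SetsAt.congr {w u k D : ℕ} {T : ℕ → Finset ℕ} {m m' : ℕ → ℕ} (h : SetsAt w u k D T m)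
    (hm : ∀ x < D + 9 * k, m' x = m x) : SetsAt w u k D T m' :=
  fun j hj => (h j hj).congr fun x _ => hm x (by omega)

section
variable {w u k D : ℕ} {T : ℕ → Finset ℕ}

lemma Setting.bounds (hS : Setting w u k D T) :
    1 ≤ k * u ∧ k ≤ k * u ∧ u ≤ k * u ∧ D + 2000 * (k * u) ≤ 2 ^ w :=
  ⟨Nat.mul_pos hS.2 hS.1, Nat.le_mul_of_pos_right _ hS.1, Nat.le_mul_of_pos_left _ hS.2, hS.cap⟩

lemma Setting.three_le (hS : Setting w u k D T) : 3 ≤ w := by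
  obtain ⟨h1, -, -, h2⟩ := hS.bounds
  by_contra hc
  have : 2 ^ w ≤ 2 ^ 3 := Nat.pow_le_pow_right (by omega) (by omega)
  omega

lemma Setting.slot_le (hS : Setting w u k D T) {s j : ℕ} (hs : s < 4 * u) (hj : j < k + 2) :
    s * (k + 2) + j < 12 * (k * u) := by
  obtain ⟨h1, h2, h3, -⟩ := hS.bounds
  have h4 : (s + 1) * (k + 2) ≤ (4 * u) * (k + 2) := Nat.mul_le_mul_right _ hs
  have h5 : (4 * u) * (k + 2) = 4 * (k * u) + 8 * u := by ring
  rw [add_mul, one_mul] at h4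
  omega

lemma Setting.code_le (hS : Setting w u k D T) (S : Finset ℕ) :
    posCode (trieCode u S).length + (trieCode u S).length + D < 2 ^ w := by
  obtain ⟨h1, h2, h3, h4⟩ := hS.bounds
  have h5 := length_trieCode_le_universe hS.1 S
  have h6 := posCode_le (trieCode u S).length
  omega

/-- Load the parameters of the representation of the set with index `J`. -/
def loadParams : Prog :=
  rA ::= .cell (𝐯 rPar + 8 * 𝐯 rJ) ;;
  rB ::= .cell (𝐯 rPar + 8 * 𝐯 rJ + 1) ;;
  rNar ::= .cell (𝐯 rPar + 8 * 𝐯 rJ + 2) ;;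
  rN ::= .cell (𝐯 rPar + 8 * 𝐯 rJ + 3) ;;
  rTab ::= .cell (𝐯 rPar + 8 * 𝐯 rJ + 4) ;;
  rSup ::= .cell (𝐯 rPar + 8 * 𝐯 rJ + 5) ;;
  rBlk ::= .cell (𝐯 rPar + 8 * 𝐯 rJ + 6) ;;
  rCod ::= .cell (𝐯 rPar + 8 * 𝐯 rJ + 7)

lemma WP.loadParams {σ : Store} {j a n : ℕ} (hS : Setting w u k D T)
    (hG : Globals w u k D σ.v) (hJ : σ.v rJ = j) (hj : j < k)
    (hp : Params (fun i => σ.m (D + k + 8 * j + i)) a n) :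
    WP w loadParams (fun σ' => Params (fun i => σ'.v (rA + i)) a n ∧ (∀ r < 30, σ'.v r = σ.v r) ∧
      σ'.m = σ.m ∧ σ'.clk ≤ σ.clk + 800) σ := by
  obtain ⟨h1, h2, h3, h4⟩ := hS.bounds
  have hw : 1 ≤ w := by have := hS.three_le; omega
  have h0 := hp.1
  rw [add_zero] at h0
  rw [rJ] at hJ
  refine .seq (.assign hw _ (by decide) a ?_ ?_ ?_)
  · simp [hG.eq_par, hJ]; omega
  · simpa [hG.eq_par, hJ] using h0
  refine .seq (.assign hw _ (by decide) _ ?_ (?_ : _ = bsz n) ?_)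
  · simp [hG.eq_par, hJ]; omega
  · simpa [hG.eq_par, hJ] using hp.2
  refine .seq (.assign hw _ (by decide) _ ?_ (?_ : _ = RunTrie.narrow n) ?_)
  · simp [hG.eq_par, hJ]; omega
  · simpa [hG.eq_par, hJ] using hp.3
  refine .seq (.assign hw _ (by decide) _ ?_ (?_ : _ = n) ?_)
  · simp [hG.eq_par, hJ]; omega
  · simpa [hG.eq_par, hJ] using hp.4
  refine .seq (.assign hw _ (by decide) _ ?_ (?_ : _ = posTable n) ?_)
  · simp [hG.eq_par, hJ]; omega
  · simpa [hG.eq_par, hJ] using hp.5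
  refine .seq (.assign hw _ (by decide) _ ?_ (?_ : _ = posSuper n) ?_)
  · simp [hG.eq_par, hJ]; omega
  · simpa [hG.eq_par, hJ] using hp.6
  refine .seq (.assign hw _ (by decide) _ ?_ (?_ : _ = posBlock n) ?_)
  · simp [hG.eq_par, hJ]; omega
  · simpa [hG.eq_par, hJ] using hp.7
  refine .assign hw _ (by decide) (posCode n) ?_ ?_ ⟨⟨?_, ?_, ?_, ?_, ?_, ?_, ?_, ?_⟩, ?_, ?_, ?_⟩
  · simp [hG.eq_par, hJ]; omega
  · simpa [hG.eq_par, hJ] using hp.8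
  any_goals simp
  intro r hr
  repeat rw [if_neg (by omega)]

/-- Read the two bits of the node with index `X`; the leaves at depth `ℓ` have none. -/
def lookProg : Prog :=
  branch (.lt (𝐯 rX) (𝐯 rN / 2)) (readField rY (𝐯 rCod + 2 * 𝐯 rX) 2) (rY ::= 0)

lemma WP.lookProg {σ : Store} {a p : ℕ} {S : Finset ℕ} (hS : Setting w u k D T)
    (hW : σ.v rW = w) (hpar : Params (fun i => σ.v (rA + i)) a (trieCode u S).length)
    (hb : BitsAt w σ.m a D (prefixBits u S ++ trieCode u S)) (hX : σ.v rX = p) :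
    WP w lookProg (fun σ' => σ'.v rY = look (trieCode u S) p ∧ (∀ r < 39, σ'.v r = σ.v r) ∧
      σ'.m = σ.m ∧ σ'.clk ≤ σ.clk + 400) σ := by
  obtain ⟨h1, h2, h3, h4⟩ := hS.bounds
  have hw : 1 ≤ w := by have := hS.three_le; omega
  have hn := hpar.length
  have hc := hpar.code
  have ha := hpar.addr
  simp only [rA] at hn hc ha
  norm_num at hn hc ha
  have hcap := hS.code_le S
  rw [rX] at hX
  refine .branch hw (by decide) (by simp; omega) (fun h => ?_) fun h => ?_
  · simp [hX, hn] at h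
    have hl : 2 * p + 1 < (trieCode u S).length := by omega
    have hf := directory_code (decide S.Nonempty) _ (hasField_look hl)
    have h5 := hf.1
    refine .readField (hi := D) hw (by simpa using hW) (by simpa [ha] using hb)
      (by simp [directory]) (by omega) ?_ hf (by omega) (by decide) (by decide) ?_ ?_ ?_
      ?_ ⟨?_, ?_, ?_, ?_⟩
    · rw [List.length_append, length_directory]; omega
    · simp [hc, hX]; omega
    · simp [hc, hX]
    · simp; omega
    · simp
    · simp
    · intro r hr
      simp
      repeat rw [if_neg (by omega)]
    · rfl
    · simp
  · simp [hX, hn] at h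
    refine .assign hw _ (by decide) 0 (by simp) (by simp) ⟨?_, ?_, ?_, ?_⟩
    · have := length_trieCode u S
      rw [look_of_length_le (by omega)]
      simp
    · intro r hr
      simp; omega
    · rfl
    · simp

/-- Replace the pointer `X`, to a node with the bits `Y`, by the pointer to its child number `i`,
and record in `Ok` and `Full` whether the child exists and whether the node is full. -/
def advance (i : ℕ) : Prog :=
  branch (𝐯 rY)
    (rFull ::= 0 ;;
     rOk ::= 𝐯 rOk * ((𝐯 rY >>> .lit i) % 2) ;;
     rankProg ;;
     rX ::= 1 + 𝐯 r1 + .lit i * (𝐯 rY % 2))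
    skip

lemma WP.advance {σ : Store} {a p h i : ℕ} {S : Finset ℕ} (hS : Setting w u k D T) (hi : i < 2)
    (hW : σ.v rW = w) (hpar : Params (fun i => σ.v (rA + i)) a (trieCode u S).length)
    (hb : BitsAt w σ.m a D (prefixBits u S ++ trieCode u S)) (hX : σ.v rX = p)
    (hY : σ.v rY = look (trieCode u S) p) (hSu : S ⊆ Finset.range u) (hp : Pointer u S p h)
    (hh : 1 ≤ h) (hu : h < 2 ^ (height u + 1)) (hOk : σ.v rOk ≤ 1) :
    WP w (advance i) (fun σ' =>
      (HNode u S (2 * h + i) → h < 2 ^ height u → Pointer u S (σ'.v rX) (2 * h + i)) ∧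
      σ'.v rOk = (if HFull u S h ∨ HNode u S (2 * h + i) then σ.v rOk else 0) ∧
      σ'.v rFull = (if HFull u S h then σ.v rFull else 0) ∧
      (∀ r < 30, r ≠ rOk → r ≠ rFull → σ'.v r = σ.v r) ∧
      σ'.m = σ.m ∧ σ'.clk ≤ σ.clk + 2000) σ := by
  obtain ⟨h1, h2, h3, h4⟩ := hS.bounds
  have hw : 1 ≤ w := by have := hS.three_le; omega
  have hcap := hS.code_le S
  have hz := hp.look_eq_zero hh hu
  rw [rX] at hX
  rw [rY] at hY
  rw [rOk] at hOk
  refine .branch hw (by decide) (by simp) (fun hf => ?_) fun hf => ?_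
  · simp [hY, hz] at hf
    have hlt := lt_of_not_full hu hp.1 hf
    have hpl : 2 * p ≤ (trieCode u S).length := by
      by_contra hc
      exact hf (hz.1 (look_of_length_le (by omega)))
    have hbit : (look (trieCode u S) p >>> i) % 2 = if HNode u S (2 * h + i) then 1 else 0 := by
      rw [hp.look_eq hh hu, if_neg hf]
      interval_cases i
      · by_cases c1 : HNode u S (2 * h) <;> simp [c1, Nat.add_mod]
      · by_cases c1 : HNode u S (2 * h) <;> by_cases c2 : HNode u S (2 * h + 1) <;> simp [c1, c2]
    have hmul : σ.v 21 * (if HNode u S (2 * h + i) then 1 else 0) =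
        if HNode u S (2 * h + i) then σ.v 21 else 0 := by split_ifs <;> simp
    have hrl := rank_le_length (trieCode u S) (2 * p)
    have hpc := posCode_ge (trieCode u S).length
    have h2p := Nat.two_pow_pos (bsz (trieCode u S).length)
    have hil : i * (look (trieCode u S) p % 2) ≤ 1 := by
      have : look (trieCode u S) p % 2 < 2 := Nat.mod_lt _ (by omega)
      interval_cases i <;> omega
    refine .seq (.assign hw _ (by decide) 0 (by simp) (by simp) ?_)
    refine .seq (.assign hw _ (by interval_cases i <;> decide)
      (if HNode u S (2 * h + i) then σ.v 21 else 0) ?_ ?_ ?_)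
    · simp [hY, hbit, hmul]
      split_ifs <;> omega
    · simp [hY, hbit]
    refine .seq ((WP.rankProg (hi := D) (flag := decide S.Nonempty) (p := p) hS.three_le
      (by simpa using hW) (hpar := ?_) (hb := by simpa using hb) (by omega) (by omega)
      (by simpa using hX) hpl).mono fun σ' ⟨q1, q2, q3, q4⟩ => ?_)
    · obtain ⟨e0, e1, e2, e3, e4, e5, e6, e7⟩ := hpar
      exact ⟨by simpa using e0, by simpa using e1, by simpa using e2, by simpa using e3,
        by simpa using e4, by simpa using e5, by simpa using e6, by simpa using e7⟩
    have y1 : σ'.v 39 = look (trieCode u S) p := by rw [q2 39 (by omega)]; simpa using hY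
    have y2 : σ'.v 21 = if HNode u S (2 * h + i) then σ.v 21 else 0 := by
      rw [q2 21 (by omega)]; simp
    have y3 : σ'.v 22 = 0 := by rw [q2 22 (by omega)]; simp
    rw [r1] at q1
    refine .assign hw _ (by interval_cases i <;> decide)
      (1 + rank (trieCode u S) (2 * p) + i * (look (trieCode u S) p % 2)) ?_ ?_
      ⟨?_, ?_, ?_, ?_, ?_, ?_⟩
    · simp [q1, y1]; omega
    · simp [q1, y1]
    · intro hn _
      simpa using hp.child hSu hh hu hf hi hn
    · simp [y2, hf]
    · simp [y3, hf]
    · intro r hr h21 h22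
      simp at h21 h22
      have h38 : r ≠ 38 := by omega
      simp [h38, q2 r (by omega), h21, h22]
    · simp [q3]
    · simp at q4 ⊢; omega
  · simp [hY, hz] at hf
    refine .skip ⟨?_, ?_, ?_, ?_, ?_, ?_⟩
    · intro _ hlt
      simpa [hX] using hp.child_of_full hh hlt hf hi
    · simp [hf]
    · simp [hf]
    · simp
    · rfl
    · simp

end

section
variable {w u k D : ℕ} {T : ℕ → Finset ℕ}

/-- The address of the record with index `e` of the queue.  A record consists of `k` pointers, a
heap number, and a flag. -/
abbrev slot (k D e : ℕ) : ℕ := D + 9 * k + e * (k + 2)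

lemma slot_succ (k D e : ℕ) : slot k D (e + 1) = slot k D e + (k + 2) := by
  unfold slot; ring

lemma slot_mono (k D : ℕ) {e e' : ℕ} (h : e ≤ e') : slot k D e ≤ slot k D e' := by
  unfold slot; gcongr

lemma slot_add_le (k D : ℕ) {e e' : ℕ} (h : e < e') : slot k D e + (k + 2) ≤ slot k D e' := by
  rw [← slot_succ]; exact slot_mono k D h

/-- Write the pointer of the set with index `J` to the child number `i` of the current node into
the first free record. -/
def childStep (i : ℕ) : Prog :=
  loadParams ;;
  rX ::= .cell (𝐯 rQue + 𝐯 rHead * 𝐯 rStr + 𝐯 rJ) ;;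
  lookProg ;;
  advance i ;;
  write (𝐯 rQue + 𝐯 rTail * 𝐯 rStr + 𝐯 rJ) (𝐯 rX) ;;
  rJ ::= 𝐯 rJ + 1

lemma WP.childStep {σ : Store} {j e t h i : ℕ} (hS : Setting w u k D T) (hi : i < 2)
    (hG : Globals w u k D σ.v) (hT : SetsAt w u k D T σ.m) (hJ : σ.v rJ = j) (hj : j < k)
    (he : σ.v rHead = e) (he' : e < 4 * u) (ht : σ.v rTail = t) (ht' : t < 4 * u)
    (hp : Pointer u (T j) (σ.m (slot k D e + j)) h) (hh : 1 ≤ h) (hu : h < 2 ^ (height u + 1))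
    (hOk : σ.v rOk ≤ 1) :
    WP w (childStep i) (fun σ' => σ'.v rJ = j + 1 ∧
      σ'.v rOk = (if HFull u (T j) h ∨ HNode u (T j) (2 * h + i) then σ.v rOk else 0) ∧
      σ'.v rFull = (if HFull u (T j) h then σ.v rFull else 0) ∧
      (∀ r < 30, r ≠ rJ → r ≠ rOk → r ≠ rFull → σ'.v r = σ.v r) ∧
      (∀ x, x ≠ slot k D t + j → σ'.m x = σ.m x) ∧
      (HNode u (T j) (2 * h + i) → h < 2 ^ height u →
        Pointer u (T j) (σ'.m (slot k D t + j)) (2 * h + i)) ∧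
      σ'.clk ≤ σ.clk + 3500) σ := by
  obtain ⟨h1, h2, h3, h4⟩ := hS.bounds
  have hw : 1 ≤ w := by have := hS.three_le; omega
  obtain ⟨a, hpar, hb⟩ := hT j hj
  have se := hS.slot_le he' (show j < k + 2 by omega)
  have st := hS.slot_le ht' (show j < k + 2 by omega)
  refine .seq ((WP.loadParams hS hG hJ hj hpar).mono fun σ1 ⟨a1, a2, a3, a4⟩ => ?_)
  have hG1 := hG.congr fun r hr => a2 r (by omega)
  have hJ1 : σ1.v 20 = j := (a2 20 (by omega)).trans hJ
  have he1 : σ1.v 11 = e := (a2 11 (by omega)).trans he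
  refine .seq (.assign hw _ (by decide) (σ.m (slot k D e + j)) ?_ ?_ ?_)
  · simp [hG1.eq_que, hG1.eq_str, hJ1, he1]; omega
  · simp [hG1.eq_que, hG1.eq_str, hJ1, he1, a3]
  refine .seq ((WP.lookProg (a := a) (S := T j) (p := σ.m (slot k D e + j)) hS
    (by simpa using hG1.eq_w) (hpar := ?_) (by simpa [a3] using hb) (by simp)).mono
    fun σ2 ⟨b1, b2, b3, b4⟩ => ?_)
  · obtain ⟨e0, e1, e2, e3, e4, e5, e6, e7⟩ := a1
    exact ⟨by simpa using e0, by simpa using e1, by simpa using e2, by simpa using e3,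
      by simpa using e4, by simpa using e5, by simpa using e6, by simpa using e7⟩
  have f2 : ∀ r < 30, σ2.v r = σ.v r := fun r hr => by
    rw [b2 r (by omega), ← a2 r hr]; simp; omega
  have hG2 := hG.congr fun r hr => f2 r (by omega)
  refine .seq ((WP.advance (a := a) (S := T j) (p := σ.m (slot k D e + j)) (h := h) hS hi
    hG2.eq_w (hpar := ?_) (by rw [b3]; simpa [a3] using hb) ?_ b1 (hS.subset j hj) hp hh hu
    (by rw [f2 21 (by omega)]; exact hOk)).mono fun σ3 ⟨c1, c2, c3, c4, c5, c6⟩ => ?_)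
  · obtain ⟨e0, e1, e2, e3, e4, e5, e6, e7⟩ := a1
    have g : ∀ i < 8, σ2.v (rA + i) = σ1.v (rA + i) := fun i hi => by
      rw [rA, b2 _ (by omega)]; simp; omega
    exact ⟨(g 0 (by omega)).trans e0, (g 1 (by omega)).trans e1, (g 2 (by omega)).trans e2,
      (g 3 (by omega)).trans e3, (g 4 (by omega)).trans e4, (g 5 (by omega)).trans e5,
      (g 6 (by omega)).trans e6, (g 7 (by omega)).trans e7⟩
  · rw [b2 _ (by decide)]; simp
  have f3 : ∀ r < 30, r ≠ 21 → r ≠ 22 → σ3.v r = σ.v r := fun r hr n1 n2 => by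
    rw [c4 r hr n1 n2, f2 r hr]
  have hG3 := hG.congr fun r hr => f3 r (by omega) (by omega) (by omega)
  have hJ3 : σ3.v 20 = j := (f3 20 (by omega) (by omega) (by omega)).trans hJ
  have ht3 : σ3.v 12 = t := (f3 12 (by omega) (by omega) (by omega)).trans ht
  have m3 : σ3.m = σ.m := by rw [c5, b3]; simp [a3]
  refine .seq (.write hw (by decide) (by decide) (by decide) (slot k D t + j) (σ3.v rX) ?_ ?_ ?_ ?_
    ?_)
  · simp [hG3.eq_que, hG3.eq_str, hJ3, ht3]; omega
  · simp
  · simp [hG3.eq_que, hG3.eq_str, hJ3, ht3]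
  · simp
  refine .assign hw _ (by decide) (j + 1) ?_ ?_ ⟨?_, ?_, ?_, ?_, ?_, ?_, ?_⟩
  · simp [hJ3]; omega
  · simp [hJ3]
  · simp
  · have := f2 21 (by omega)
    simp at c2 ⊢; rw [c2, this]
  · have := f2 22 (by omega)
    simp at c3 ⊢; rw [c3, this]
  · intro r hr n1 n2 n3
    simp at n1 n2 n3
    simp [n1, f3 r hr n2 n3]
  · intro x hx
    simp only [Store.asg_m, Store.sto_m, m3, if_neg hx]
  · intro n1 n2
    simpa using c1 n1 n2
  · simp at a4 b4 c6 ⊢; omega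

/-- The records of the visited nodes with heap numbers less than `b` are in the queue: the record of
`h` has as its index the number of visited nodes before `h`. -/
def QueueAt (u k D : ℕ) (T : ℕ → Finset ℕ) (m : ℕ → ℕ) (b : ℕ) : Prop :=
  ∀ h < b, Visited u k T h → m (slot k D (Nat.count (Visited u k T) h) + k) = h ∧
    ∀ j < k, Pointer u (T j) (m (slot k D (Nat.count (Visited u k T) h) + j)) h

/-- The number of visited nodes. -/
abbrev total (u k : ℕ) (T : ℕ → Finset ℕ) : ℕ := Nat.count (Visited u k T) (2 ^ (height u + 1))

lemma count_visited_le_total (h : ℕ) : Nat.count (Visited u k T) h ≤ total u k T := by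
  rcases le_total h (2 ^ (height u + 1)) with hc | hc
  · exact Nat.count_monotone _ hc
  · unfold total
    obtain ⟨d, rfl⟩ := Nat.exists_eq_add_of_le hc
    rw [Nat.count_add, Nat.add_eq_left.2]
    rw [Nat.count_iff_forall_not]
    intro n _ hv
    have := hv.2.1
    omega

lemma Setting.total_lt (hS : Setting w u k D T) : total u k T < 4 * u := by
  have h1 := pow_height_lt hS.1
  have h2 : total u k T < 2 ^ (height u + 1) := by
    have h3 := Nat.two_pow_pos (height u + 1)
    have key : ∀ p, Nat.count (Visited u k T) (p + 1) ≤ p := fun p => by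
      rw [Nat.count_succ', if_neg not_visited_zero]
      exact Nat.count_le _
    obtain ⟨p, hp⟩ : ∃ p, 2 ^ (height u + 1) = p + 1 := ⟨2 ^ (height u + 1) - 1, by omega⟩
    have := key p
    rw [← hp] at this
    unfold total
    omega
  rw [pow_succ] at h2
  omega

/-- Examine the child number `i` of the current node: append its record to the queue if the child
is visited. -/
def pass (i : ℕ) : Prog :=
  rJ ::= 0 ;; rOk ::= 1 ;; rFull ::= 1 ;;
  loopWhile (.lt (𝐯 rJ) (𝐯 rK)) (childStep i) ;;
  branch (𝐯 rOk * (1 - 𝐯 rFull))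
    (write (𝐯 rQue + 𝐯 rTail * 𝐯 rStr + 𝐯 rK) (2 * 𝐯 rH + .lit i) ;;
     rTail ::= 𝐯 rTail + 1 ;;
     rFlag ::= 𝐯 rFlag + .lit (i + 1))
    skip

lemma WP.pass {σ : Store} {h i f : ℕ} (hS : Setting w u k D T) (hi : i < 2)
    (hG : Globals w u k D σ.v) (hT : SetsAt w u k D T σ.m) (hv : Visited u k T h)
    (he : σ.v rHead = Nat.count (Visited u k T) h) (hH : σ.v rH = h)
    (ht : σ.v rTail = Nat.count (Visited u k T) (2 * h + i)) (hf : σ.v rFlag = f) (hf4 : f < 4)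
    (hQ : QueueAt u k D T σ.m (2 * h + i)) :
    WP w (pass i) (fun σ' => QueueAt u k D T σ'.m (2 * h + i + 1) ∧
      σ'.v rTail = Nat.count (Visited u k T) (2 * h + i + 1) ∧
      σ'.v rFlag = f + (if Visited u k T (2 * h + i) then i + 1 else 0) ∧
      σ'.v rFull = (if ∀ j < k, HFull u (T j) h then 1 else 0) ∧
      (∀ r < 12, σ'.v r = σ.v r) ∧ σ'.v rH = h ∧
      (∀ x < slot k D (σ.v rTail), σ'.m x = σ.m x) ∧
      σ'.clk ≤ σ.clk + 4400 * k) σ := by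
  obtain ⟨h1, h2, h3, h4⟩ := hS.bounds
  have hw : 1 ≤ w := by have := hS.three_le; omega
  have htot := hS.total_lt
  have hle : Nat.count (Visited u k T) h < Nat.count (Visited u k T) (2 * h + i) :=
    Nat.count_strict_mono hv (by have := hv.1; omega)
  have htl := count_visited_le_total (u := u) (k := k) (T := T) (2 * h + i)
  have hv₀ := hv
  obtain ⟨hh, hu, hnode, -⟩ := hv
  set e := Nat.count (Visited u k T) h with hedef
  set t := Nat.count (Visited u k T) (2 * h + i) with htdef
  have hst := slot_add_le k D hle
  have hk1 := hS.one_le_k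
  refine .seq (.assign hw _ (by decide) 0 (by simp) (by simp) ?_)
  refine .seq (.assign hw _ (by decide) 1 (by simp; omega) (by simp) ?_)
  refine .seq (.assign hw _ (by decide) 1 (by simp; omega) (by simp) ?_)
  refine .seq (.loopWhile hw (by decide) (fun n σ' => ∃ j, j + n = k ∧ σ'.v rJ = j ∧
    σ'.v rOk = (if ∀ j' < j, HFull u (T j') h ∨ HNode u (T j') (2 * h + i) then 1 else 0) ∧
    σ'.v rFull = (if ∀ j' < j, HFull u (T j') h then 1 else 0) ∧
    (∀ r < 20, σ'.v r = σ.v r) ∧ (∀ x < slot k D t, σ'.m x = σ.m x) ∧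
    (∀ j' < j, HNode u (T j') (2 * h + i) → h < 2 ^ height u →
      Pointer u (T j') (σ'.m (slot k D t + j')) (2 * h + i)) ∧
    σ'.clk ≤ σ.clk + 300 + 3600 * j) k ?_ ?_ ?_ ?_)
  · refine ⟨0, by simp, by simp, by simp, by simp, ?_, by simp, by simp, by simp⟩
    intro r hr
    simp
    repeat rw [if_neg (by omega)]
  · intro n σ' _; simp
  · rintro n σ' ⟨j, hjn, i1, i2, i3, i4, i5, i6, i7⟩ hval
    have hG' := hG.congr fun r hr => i4 r (by omega)
    have hj : j < k := by
      rw [Ne, Expr.val_lt_eq_zero, Expr.val_var, Expr.val_var, i1, rK, hG'.eq_k] at hval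
      omega
    refine ⟨n - 1, by omega, ?_⟩
    have hptr := (hQ h (by omega) hv₀).2 j hj
    refine (WP.childStep (σ := σ'.tick) (h := h) (e := e) (t := t) (j := j) hS hi (by simpa using hG')
      (hT.congr fun x hx => i5 x (by unfold slot; omega)) i1 hj ((i4 11 (by omega)).trans he)
      (by omega) ((i4 12 (by omega)).trans ht) (by omega) ?_ hh hu ?_).mono ?_
    · rw [Store.tick_m, i5 _ (by omega)]; exact hptr
    · rw [Store.tick_v, i2]; split_ifs <;> simp
    · rintro σ'' ⟨c1, c2, c3, c4, c5, c6, c7⟩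
      refine ⟨j + 1, by omega, c1, ?_, ?_, ?_, ?_, ?_, ?_⟩
      · rw [c2, Store.tick_v, i2]
        simp only [Nat.forall_lt_succ_right]
        split_ifs <;> simp_all
      · rw [c3, Store.tick_v, i3]
        simp only [Nat.forall_lt_succ_right]
        split_ifs <;> simp_all
      · intro r hr
        rw [c4 r (by omega) (by simp; omega) (by simp; omega) (by simp; omega), Store.tick_v,
          i4 r hr]
      · intro x hx
        rw [c5 x (by omega), Store.tick_m, i5 x hx]
      · intro j' hj' n1 n2
        rcases Nat.lt_succ_iff_lt_or_eq.1 hj' with hlt | rfl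
        · rw [c5 _ (by omega), Store.tick_m]
          exact i6 j' hlt n1 n2
        · exact c6 n1 n2
      · rw [Store.tick_clk] at c7
        linarith
  · rintro n σ' ⟨j, hjn, i1, i2, i3, i4, i5, i6, i7⟩ hval
    have hG' := hG.congr fun r hr => i4 r (by omega)
    obtain rfl : j = k := by
      rw [Expr.val_lt_eq_zero, Expr.val_var, Expr.val_var, i1, rK, hG'.eq_k] at hval
      omega
    have st := hS.slot_le (s := t) (j := j) (by omega) (by omega)
    have hT' : σ'.v 12 = t := (i4 12 (by omega)).trans ht
    have hH' : σ'.v 13 = h := (i4 13 (by omega)).trans hH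
    have hF' : σ'.v 14 = f := (i4 14 (by omega)).trans hf
    have hu2 := pow_height_lt hS.1
    have hu4 : h < 4 * u := by rw [pow_succ] at hu; omega
    have hfull : σ'.v rFull ≤ 1 := by rw [i3]; split_ifs <;> simp
    -- the child is visited if and only if its record is kept
    have hiff : σ'.v rOk * (1 - σ'.v rFull) ≠ 0 ↔ Visited u j T (2 * h + i) := by
      rw [i2, i3]
      by_cases hall : ∀ j' < j, HFull u (T j') h
      · rw [if_pos hall]
        simp only [Nat.sub_self, mul_zero, ne_eq, not_true_eq_false, false_iff]
        intro hv'
        obtain ⟨-, -, j', hj', hnf⟩ := hv'.expanded hh hi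
        exact hnf (hall j' hj')
      · rw [if_neg hall]
        push Not at hall
        obtain ⟨j₀, hj₀, hnf⟩ := hall
        have hlt := lt_of_not_full hu (hnode j₀ hj₀) hnf
        rw [visited_child hh hlt hi]
        have : (∀ j' < j, HFull u (T j') h ∨ HNode u (T j') (2 * h + i)) ↔
            ∀ j' < j, HNode u (T j') (2 * h + i) :=
          forall₂_congr fun j' hj' =>
            ⟨fun o => o.elim (fun o => (hFull_child hh hlt o hi).node) id, .inr⟩
        rw [if_congr this rfl rfl]
        constructor
        · intro hne
          refine ⟨?_, j₀, hj₀, hnf⟩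
          by_contra hc
          rw [if_neg hc] at hne
          simp at hne
        · rintro ⟨hc, -⟩
          rw [if_pos hc]
          simp
    have hcount : Nat.count (Visited u j T) (2 * h + i + 1) =
        t + if Visited u j T (2 * h + i) then 1 else 0 := Nat.count_succ _ _
    have hold : ∀ m' : ℕ → ℕ, (∀ x < slot j D t, m' x = σ.m x) →
        QueueAt u j D T m' (2 * h + i) := by
      intro m' hm' h' hh' hv'
      have hlt' : Nat.count (Visited u j T) h' < t := Nat.count_strict_mono hv' hh'
      have hs' := slot_add_le j D hlt'
      obtain ⟨o1, o2⟩ := hQ h' hh' hv'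
      refine ⟨by rw [hm' _ (by omega)]; exact o1, fun j' hj' => ?_⟩
      rw [hm' _ (by omega)]
      exact o2 j' hj'
    refine .branch hw (by decide) ?_ (fun hne => ?_) fun hz => ?_
    · rw [rOk] at i2
      rw [rFull] at hfull
      simp
      have : σ'.v 21 ≤ 1 := by rw [i2]; split_ifs <;> simp
      have := Nat.mul_le_mul this (Nat.sub_le 1 (σ'.v 22))
      omega
    · simp only [Expr.val_mul, Expr.val_var, Expr.val_sub, Expr.val_one, Store.tick_v] at hne
      have hvis := hiff.1 hne
      have hlt : h < 2 ^ height u := by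
        have := hvis.2.1; rw [pow_succ] at this; omega
      refine .seq (.write hw (by interval_cases i <;> decide) (by decide) (by interval_cases i <;> decide)
        (slot j D t + j) (2 * h + i) ?_ ?_ ?_ ?_ ?_)
      · simp [hG'.eq_que, hG'.eq_str, hG'.eq_k, hT']; omega
      · simp [hH']; omega
      · simp [hG'.eq_que, hG'.eq_str, hG'.eq_k, hT']
      · simp [hH']
      refine .seq (.assign hw _ (by decide) (t + 1) ?_ ?_ ?_)
      · simp [hT']; omega
      · simp [hT']
      refine .assign hw _ (by interval_cases i <;> decide) (f + (i + 1)) ?_ ?_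
        ⟨?_, ?_, ?_, ?_, ?_, ?_, ?_, ?_⟩
      · simp [hF']; omega
      · simp [hF']
      · intro h' hh' hv'
        rcases Nat.lt_succ_iff_lt_or_eq.1 hh' with hlt' | rfl
        · refine hold _ (fun x hx => ?_) h' hlt' hv'
          simp only [Store.asg_m, Store.sto_m, Store.tick_m]
          rw [if_neg (by omega), i5 x hx]
        · rw [← htdef]
          refine ⟨by simp, fun j' hj' => ?_⟩
          simp only [Store.asg_m, Store.sto_m, Store.tick_m]
          rw [if_neg (by omega)]
          exact i6 j' hj' (hvis.2.2.1 j' hj') hlt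
      · rw [hcount, if_pos hvis]; simp
      · rw [if_pos hvis]; simp
      · simp at i3 ⊢; exact i3
      · intro r hr
        rw [← i4 r (by omega)]
        simp
        repeat rw [if_neg (by omega)]
      · simpa using hH'
      · intro x hx
        rw [ht] at hx
        simp only [Store.asg_m, Store.sto_m, Store.tick_m]
        rw [if_neg (by omega), i5 x hx]
      · simp; omega
    · simp only [Expr.val_mul, Expr.val_var, Expr.val_sub, Expr.val_one, Store.tick_v] at hz
      have hvis : ¬ Visited u j T (2 * h + i) := fun o => hiff.2 o hz
      refine .skip ⟨?_, ?_, ?_, ?_, ?_, ?_, ?_, ?_⟩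
      · intro h' hh' hv'
        rcases Nat.lt_succ_iff_lt_or_eq.1 hh' with hlt' | rfl
        · exact hold _ (fun x hx => by simpa using i5 x hx) h' hlt' hv'
        · exact (hvis hv').elim
      · rw [hcount, if_neg hvis]; simpa using hT'
      · rw [if_neg hvis]; simpa using hF'
      · simpa using i3
      · intro r hr
        simpa using i4 r (by omega)
      · simpa using hH'
      · intro x hx
        rw [ht] at hx
        simpa using i5 x hx
      · simp; omega

end

/-! ### The queue in level order -/

lemma exists_next {p : ℕ → Prop} [DecidablePred p] {a b : ℕ} (h : Nat.count p a < Nat.count p b) :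
    ∃ c, a ≤ c ∧ p c ∧ Nat.count p c = Nat.count p a := by
  induction b with
  | zero => simp at h
  | succ b ih =>
    by_cases hb : Nat.count p a < Nat.count p b
    · exact ih hb
    · rw [Nat.count_succ] at h
      have hab : a ≤ b := by
        by_contra hc
        have := Nat.count_monotone p (show b + 1 ≤ a by omega)
        rw [Nat.count_succ] at this
        omega
      have := Nat.count_monotone p hab
      split_ifs at h with hp
      · exact ⟨b, hab, hp, by omega⟩
      · omega

lemma exists_prev {p : ℕ → Prop} [DecidablePred p] {b : ℕ} (h : 0 < Nat.count p b) :
    ∃ c < b, p c ∧ Nat.count p (c + 1) = Nat.count p b := by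
  induction b with
  | zero => simp at h
  | succ b ih =>
    by_cases hp : p b
    · exact ⟨b, by omega, hp, rfl⟩
    · rw [Nat.count_succ, if_neg hp, add_zero] at h ⊢
      obtain ⟨c, h1, h2, h3⟩ := ih h
      exact ⟨c, by omega, h2, h3⟩

lemma lt_of_count_eq {p : ℕ → Prop} [DecidablePred p] {a b x : ℕ}
    (h : Nat.count p a = Nat.count p b) (hp : p x) (hx : x < b) : x < a := by
  by_contra hc
  have h1 := Nat.count_strict_mono hp hx
  have h2 := Nat.count_monotone p (not_lt.1 hc)
  omega

lemma count_eq_of_forall_lt {p : ℕ → Prop} [DecidablePred p] {a b : ℕ} (hab : a ≤ b)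
    (h : ∀ x, p x → x < b → x < a) : Nat.count p a = Nat.count p b := by
  induction b, hab using Nat.le_induction with
  | base => rfl
  | succ b hab ih =>
    rw [Nat.count_succ, if_neg (fun hp => absurd (h b hp (by omega)) (by omega)), add_zero]
    exact ih fun x hx hxb => h x hx (by omega)

section
variable {w u k D : ℕ} {T : ℕ → Finset ℕ}

lemma lt_two_mul_of_visited {a b x : ℕ} (ha : 1 ≤ a)
    (h : Nat.count (Visited u k T) a = Nat.count (Visited u k T) b)
    (hv : Visited u k T x) (hx : x < 2 * b) : x < 2 * a := by
  rcases Nat.lt_or_ge x 2 with h2 | h2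
  · omega
  · have hv' := hv
    rw [← Nat.div_add_mod x 2] at hv'
    have := lt_of_count_eq h (hv'.parent (by omega) (Nat.mod_lt _ (by omega))) (by omega)
    omega

/-- The children of visited nodes are in the queue in the order of their parents: nothing is
appended for numbers that are not visited. -/
lemma count_two_mul_eq {a b : ℕ} (ha : 1 ≤ a) (hab : a ≤ b)
    (h : Nat.count (Visited u k T) a = Nat.count (Visited u k T) b) :
    Nat.count (Visited u k T) (2 * a) = Nat.count (Visited u k T) (2 * b) :=
  count_eq_of_forall_lt (by omega) fun _ hv hx => lt_two_mul_of_visited ha h hv hx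

/-- The traversal ends when no children are left in the queue. -/
lemma visited_lt_of_count_eq {b x : ℕ} (hb : 1 ≤ b)
    (h : Nat.count (Visited u k T) b = Nat.count (Visited u k T) (2 * b))
    (hv : Visited u k T x) : x < b := by
  induction x using Nat.strong_induction_on with
  | _ x ih =>
  rcases Nat.lt_or_ge x (2 * b) with h2 | h2
  · exact lt_of_count_eq h hv h2
  · have hv' := hv
    rw [← Nat.div_add_mod x 2] at hv'
    have := ih (x / 2) (by omega) (hv'.parent (by omega) (Nat.mod_lt _ (by omega)))
    omega

lemma count_eq_total {b : ℕ} (h : ∀ x, Visited u k T x → x < b) :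
    Nat.count (Visited u k T) b = total u k T := by
  rcases le_total b (2 ^ (height u + 1)) with hb | hb
  · exact count_eq_of_forall_lt hb fun x hx _ => h x hx
  · exact le_antisymm (count_visited_le_total b) (Nat.count_monotone _ hb)

/-- The flag of a visited node: `4` if all its subtrees are full, otherwise it tells which of the
children are visited. -/
def flagOf (u k : ℕ) (T : ℕ → Finset ℕ) (h : ℕ) : ℕ :=
  if ∀ j < k, HFull u (T j) h then 4
  else (if Visited u k T (2 * h) then 1 else 0) + (if Visited u k T (2 * h + 1) then 2 else 0)

/-- The records in the queue have the right heap numbers. -/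
def NumbersAt (u k D : ℕ) (T : ℕ → Finset ℕ) (m : ℕ → ℕ) : Prop :=
  ∀ h, Visited u k T h → m (slot k D (Nat.count (Visited u k T) h) + k) = h

/-- The node after the first `e` visited ones is expanded: its visited children are appended to the
queue. -/
def traverseStep : Prog :=
  rH ::= .cell (𝐯 rQue + 𝐯 rHead * 𝐯 rStr + 𝐯 rK) ;;
  rFlag ::= 0 ;;
  pass 0 ;;
  pass 1 ;;
  write (𝐯 rQue + 𝐯 rHead * 𝐯 rStr + 𝐯 rK + 1) (𝐯 rFlag + 4 * 𝐯 rFull) ;;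
  rHead ::= 𝐯 rHead + 1

lemma WP.traverseStep {σ : Store} {h : ℕ} (hS : Setting w u k D T)
    (hG : Globals w u k D σ.v) (hT : SetsAt w u k D T σ.m) (hv : Visited u k T h)
    (he : σ.v rHead = Nat.count (Visited u k T) h)
    (ht : σ.v rTail = Nat.count (Visited u k T) (2 * h)) (hQ : QueueAt u k D T σ.m (2 * h)) :
    WP w traverseStep (fun σ' => QueueAt u k D T σ'.m (2 * (h + 1)) ∧
      σ'.v rHead = Nat.count (Visited u k T) (h + 1) ∧
      σ'.v rTail = Nat.count (Visited u k T) (2 * (h + 1)) ∧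
      σ'.m (slot k D (Nat.count (Visited u k T) h) + (k + 1)) = flagOf u k T h ∧
      (∀ r < 11, σ'.v r = σ.v r) ∧
      (∀ x < slot k D (σ.v rTail), x ≠ slot k D (Nat.count (Visited u k T) h) + (k + 1) →
        σ'.m x = σ.m x) ∧
      σ'.clk ≤ σ.clk + 9200 * k) σ := by
  obtain ⟨h1, h2, h3, h4⟩ := hS.bounds
  have hw : 1 ≤ w := by have := hS.three_le; omega
  have htot := hS.total_lt
  have hh := hv.1
  have hlt : Nat.count (Visited u k T) h < Nat.count (Visited u k T) (2 * h) :=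
    Nat.count_strict_mono hv (by omega)
  have hle := count_visited_le_total (u := u) (k := k) (T := T) (2 * h)
  have hsucc : Nat.count (Visited u k T) (h + 1) = Nat.count (Visited u k T) h + 1 := by
    rw [Nat.count_succ, if_pos hv]
  have hnum := (hQ h (by omega) hv).1
  have hk1 := hS.one_le_k
  have hsl := slot_add_le k D hlt
  have hs := hS.slot_le (s := Nat.count (Visited u k T) h) (j := k + 1) (by omega) (by omega)
  rw [rHead] at he
  refine .seq (.assign hw _ (by decide) h ?_ ?_ ?_)
  · simp [hG.eq_que, hG.eq_str, hG.eq_k, he]; omega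
  · simpa [hG.eq_que, hG.eq_str, hG.eq_k, he] using hnum
  refine .seq (.assign hw _ (by decide) 0 (by simp) (by simp) ?_)
  refine .seq ((WP.pass (i := 0) (h := h) (f := 0) hS (by omega) (hG.congr ?_) (by simpa using hT) hv
    (by simpa using he) (by simp) (by simpa using ht) (by simp) (by omega)
    (by simpa using hQ)).mono fun σ1 ⟨a1, a2, a3, a4, a5, a6, a7, a8⟩ => ?_)
  · intro r hr
    simp
    repeat rw [if_neg (by omega)]
  have g1 : ∀ r < 12, σ1.v r = σ.v r := fun r hr => by
    rw [a5 r hr]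
    simp
    repeat rw [if_neg (by omega)]
  have m1 : ∀ x < slot k D (σ.v rTail), σ1.m x = σ.m x := fun x hx => by
    simpa using a7 x (by simpa using hx)
  have ht1 : σ.v rTail ≤ σ1.v rTail := by
    rw [ht, a2]; exact Nat.count_monotone _ (by omega)
  refine .seq ((WP.pass (i := 1) (h := h) (f := if Visited u k T (2 * h) then 1 else 0) hS
    (by omega) (hG.congr fun r hr => g1 r (by omega))
    (hT.congr fun x hx => m1 x (by unfold slot; omega)) hv
    ((g1 11 (by omega)).trans he) a6 a2 (by simpa using a3) (by split_ifs <;> omega)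
    a1).mono fun σ2 ⟨b1, b2, b3, b4, b5, b6, b7, b8⟩ => ?_)
  have g2 : ∀ r < 12, σ2.v r = σ.v r := fun r hr => (b5 r hr).trans (g1 r hr)
  have hG2 := hG.congr fun r hr => g2 r (by omega)
  have m2 : ∀ x < slot k D (σ.v rTail), σ2.m x = σ.m x := fun x hx =>
    (b7 x (hx.trans_le (slot_mono k D ht1))).trans (m1 x hx)
  have he2 : σ2.v 11 = Nat.count (Visited u k T) h := (g2 11 (by omega)).trans he
  have hflag : σ2.v 14 + 4 * σ2.v 22 = flagOf u k T h := by
    rw [rFlag] at b3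
    rw [rFull] at b4
    rw [b3, b4, flagOf]
    by_cases hall : ∀ j < k, HFull u (T j) h
    · have n0 : ∀ i < 2, ¬ Visited u k T (2 * h + i) := fun i hi hv' => by
        obtain ⟨-, -, j, hj, hn⟩ := hv'.expanded hh hi
        exact hn (hall j hj)
      have n00 := n0 0 (by omega)
      rw [add_zero] at n00
      rw [if_pos hall, if_pos hall, if_neg n00, if_neg (n0 1 (by omega))]
    · rw [if_neg hall, if_neg hall, mul_zero, add_zero]
  have hfl : flagOf u k T h ≤ 4 := by unfold flagOf; split_ifs <;> omega
  refine .seq (.write hw (by decide) (by decide) (by decide)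
    (slot k D (Nat.count (Visited u k T) h) + (k + 1)) (flagOf u k T h) ?_ ?_ ?_ ?_ ?_)
  · simp [hG2.eq_que, hG2.eq_str, hG2.eq_k, he2]; omega
  · simp; omega
  · simp [hG2.eq_que, hG2.eq_str, hG2.eq_k, he2]; ring
  · simpa using hflag
  refine .assign hw _ (by decide) (Nat.count (Visited u k T) h + 1) ?_ ?_
    ⟨?_, ?_, ?_, ?_, ?_, ?_, ?_⟩
  · simp [he2]; omega
  · simp [he2]
  · intro x hx hvx
    obtain ⟨o1, o2⟩ := b1 x (by omega) hvx
    have hne : ∀ j ≤ k, slot k D (Nat.count (Visited u k T) x) + j ≠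
        slot k D (Nat.count (Visited u k T) h) + (k + 1) := by
      intro j hj
      rcases lt_trichotomy (Nat.count (Visited u k T) x) (Nat.count (Visited u k T) h)
        with hc | hc | hc
      · have := slot_add_le k D hc; omega
      · rw [hc]; omega
      · have := slot_add_le k D hc; omega
    refine ⟨?_, fun j hj => ?_⟩
    · rw [Store.asg_m, Store.sto_m, if_neg (hne k le_rfl)]; exact o1
    · rw [Store.asg_m, Store.sto_m, if_neg (hne j hj.le)]; exact o2 j hj
  · simp [hsucc]
  · rw [Store.asg_v, if_neg (by decide), Store.sto_v]; exact b2
  · simp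
  · intro r hr
    rw [← g2 r (by omega)]
    simp; omega
  · intro x hx hne
    rw [Store.asg_m, Store.sto_m, if_neg hne]
    exact m2 x hx
  · simp at a8 b8 ⊢; omega

/-- The simultaneous traversal of the tries in level order. -/
def traverse : Prog := loopWhile (.lt (𝐯 rHead) (𝐯 rTail)) traverseStep

lemma WP.traverse {σ : Store} (hS : Setting w u k D T) (hG : Globals w u k D σ.v)
    (hT : SetsAt w u k D T σ.m) (he : σ.v rHead = 0) (ht : σ.v rTail = 1)
    (hv : Visited u k T 1) (hQ : QueueAt u k D T σ.m 2) :
    WP w traverse (fun σ' => σ'.v rTail = total u k T ∧ NumbersAt u k D T σ'.m ∧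
      (∀ h, Visited u k T h →
        σ'.m (slot k D (Nat.count (Visited u k T) h) + (k + 1)) = flagOf u k T h) ∧
      (∀ r < 11, σ'.v r = σ.v r) ∧ (∀ x < D + 9 * k, σ'.m x = σ.m x) ∧
      σ'.clk ≤ σ.clk + 100 + 9300 * k * total u k T) σ := by
  have hw : 1 ≤ w := by have := hS.three_le; omega
  have hk1 := hS.one_le_k
  have c1 : Nat.count (Visited u k T) 1 = 0 := by
    rw [Nat.count_succ, if_neg not_visited_zero, Nat.count_zero]
  have c2 : Nat.count (Visited u k T) 2 = 1 := by rw [Nat.count_succ, c1, if_pos hv]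
  refine .loopWhile hw (by decide) (fun n σ' => ∃ h, 1 ≤ h ∧
    Nat.count (Visited u k T) h + n = total u k T ∧
    σ'.v rHead = Nat.count (Visited u k T) h ∧
    σ'.v rTail = Nat.count (Visited u k T) (2 * h) ∧ QueueAt u k D T σ'.m (2 * h) ∧
    (∀ x < h, Visited u k T x →
      σ'.m (slot k D (Nat.count (Visited u k T) x) + (k + 1)) = flagOf u k T x) ∧
    (∀ r < 11, σ'.v r = σ.v r) ∧ (∀ x < D + 9 * k, σ'.m x = σ.m x) ∧
    σ'.clk ≤ σ.clk + 9300 * k * Nat.count (Visited u k T) h) (total u k T) ?_ ?_ ?_ ?_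
  · refine ⟨1, le_rfl, by rw [c1, zero_add], by rw [c1, he], ht.trans c2.symm, hQ, ?_, fun _ _ => rfl,
      fun _ _ => rfl, by simp⟩
    intro x hx hv
    obtain rfl : x = 0 := by omega
    exact (not_visited_zero hv).elim
  · intro n σ' _; simp
  · rintro n σ' ⟨h, i1, i2, i3, i4, i5, i6, i7, i8, i9⟩ hval
    rw [Ne, Expr.val_lt_eq_zero, Expr.val_var, Expr.val_var, i3, i4, not_le] at hval
    obtain ⟨h', hle, hv', hc⟩ := exists_next hval
    have hsucc : Nat.count (Visited u k T) (h' + 1) = Nat.count (Visited u k T) h' + 1 := by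
      rw [Nat.count_succ, if_pos hv']
    have htot := count_visited_le_total (u := u) (k := k) (T := T) (h' + 1)
    have h2 := count_two_mul_eq i1 hle hc.symm
    refine ⟨n - 1, by omega, (WP.traverseStep (σ := σ'.tick) (h := h') hS
      (hG.congr fun r hr => i7 r (by omega)) (hT.congr i8) hv' (i3.trans hc.symm) (i4.trans h2)
      ?_).mono ?_⟩
    · intro x hx hvx
      exact i5 x (lt_two_mul_of_visited i1 hc.symm hvx hx) hvx
    · rintro σ'' ⟨a1, a2, a3, a4, a5, a6, a7⟩
      rw [Store.tick_v, Store.tick_m, i4] at a6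
      refine ⟨h' + 1, by omega, by omega, a2, a3, a1, ?_, ?_, ?_, ?_⟩
      · intro x hx hvx
        rcases Nat.lt_succ_iff_lt_or_eq.1 hx with hlt | rfl
        · have h5 : Nat.count (Visited u k T) x < Nat.count (Visited u k T) h' :=
            Nat.count_strict_mono hvx hlt
          have h6 := slot_add_le k D h5
          have h7 := slot_mono k D (e := Nat.count (Visited u k T) h')
            (e' := Nat.count (Visited u k T) (2 * h)) (by omega)
          rw [a6 _ (by omega) (by omega)]
          exact i6 x (lt_of_count_eq hc.symm hvx hlt) hvx
        · exact a4
      · intro r hr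
        rw [a5 r hr]; exact i7 r hr
      · intro x hx
        rw [a6 x (by unfold slot; omega) (by unfold slot; omega)]
        exact i8 x hx
      · rw [Store.tick_clk] at a7
        rw [hsucc, hc, mul_add]
        omega
  · rintro n σ' ⟨h, i1, i2, i3, i4, i5, i6, i7, i8, i9⟩ hval
    rw [Expr.val_lt_eq_zero, Expr.val_var, Expr.val_var, i3, i4] at hval
    have hc : Nat.count (Visited u k T) h = Nat.count (Visited u k T) (2 * h) :=
      le_antisymm (Nat.count_monotone _ (by omega)) hval
    have hlt : ∀ x, Visited u k T x → x < h := fun x hx => visited_lt_of_count_eq i1 hc hx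
    have htot := count_eq_total hlt
    refine ⟨?_, ?_, ?_, i7, i8, ?_⟩
    · rw [Store.tick_v, i4, ← hc, htot]
    · intro x hvx
      exact (i5 x (by have := hlt x hvx; omega) hvx).1
    · intro x hvx
      exact i6 x (hlt x hvx) hvx
    · rw [htot] at i9
      rw [Store.tick_clk]; omega

end

/-! ### The pruned trie of the intersection -/

section
variable {w u k D : ℕ} {T : ℕ → Finset ℕ} {I : Finset ℕ}

lemma hFull_inter_iff (hI : ∀ x, x ∈ I ↔ ∀ j < k, x ∈ T j) (h : ℕ) :
    HFull u I h ↔ ∀ j < k, HFull u (T j) h :=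
  ⟨fun hf j hj x hx => (hI x).1 (hf hx) j hj, fun hf x hx => (hI x).2 fun j hj => hf j hj hx⟩

lemma hNode_of_inter (hI : ∀ x, x ∈ I ↔ ∀ j < k, x ∈ T j) {h : ℕ} (hn : HNode u I h) {j : ℕ}
    (hj : j < k) : HNode u (T j) h :=
  HNode.mono (fun x hx => (hI x).1 hx j hj) hn

/-- The nodes of the pruned trie of the intersection are the visited nodes below which the
intersection has elements. -/
lemma hKept_inter_iff (hI : ∀ x, x ∈ I ↔ ∀ j < k, x ∈ T j) (h : ℕ) :
    HKept u I h ↔ Visited u k T h ∧ HNode u I h := by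
  have hf : ¬ HFull u I (h / 2) ↔ ∃ j < k, ¬ HFull u (T j) (h / 2) := by
    rw [hFull_inter_iff hI]; push Not; rfl
  unfold HKept Visited
  rw [hf]
  constructor
  · rintro ⟨h1, h2, h3, h4⟩
    exact ⟨⟨h1, h2, fun j hj => hNode_of_inter hI h3 hj, h4⟩, h3⟩
  · rintro ⟨⟨h1, h2, h3, h4⟩, h5⟩
    exact ⟨h1, h2, h5, h4⟩

lemma Visited.lt_of_not_full {h : ℕ} (hv : Visited u k T h) (hI : ∀ x, x ∈ I ↔ ∀ j < k, x ∈ T j)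
    (hf : ¬ HFull u I h) : h < 2 ^ height u := by
  rw [hFull_inter_iff hI] at hf
  push Not at hf
  obtain ⟨j, hj, hf⟩ := hf
  exact RunTrie.lt_of_not_full hv.2.1 (hv.2.2.1 j hj) hf

/-- The code of a visited node: its two bits in the code of the pruned trie of the intersection,
plus `4` if the node belongs to this trie. -/
def codeOf (u : ℕ) (I : Finset ℕ) (h : ℕ) : ℕ :=
  if HFull u I h then 4
  else (decide (HNode u I (2 * h))).toNat + 2 * (decide (HNode u I (2 * h + 1))).toNat +
    4 * ((decide (HNode u I (2 * h))).toNat ||| (decide (HNode u I (2 * h + 1))).toNat)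

lemma codeOf_le (h : ℕ) : codeOf u I h ≤ 7 := by
  unfold codeOf
  split_ifs
  · omega
  · cases decide (HNode u I (2 * h)) <;> cases decide (HNode u I (2 * h + 1)) <;> simp

lemma codeOf_div {h : ℕ} (hv : Visited u k T h) (hI : ∀ x, x ∈ I ↔ ∀ j < k, x ∈ T j) :
    codeOf u I h / 4 = (decide (HNode u I h)).toNat := by
  unfold codeOf
  split_ifs with hf
  · simp [HFull.node hf]
  · have := hNode_iff (S := I) hv.1 (hv.lt_of_not_full hI hf)
    rw [show decide (HNode u I h) = decide (_ ∨ _) from decide_eq_decide.2 this]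
    by_cases h1 : HNode u I (2 * h) <;> by_cases h2 : HNode u I (2 * h + 1) <;> simp [h1, h2]

lemma hCode_eq_codeOf (h : ℕ) :
    hCode u I h = [decide (codeOf u I h % 2 = 1), decide (codeOf u I h / 2 % 2 = 1)] := by
  unfold hCode codeOf
  split_ifs
  · simp
  · by_cases h1 : HNode u I (2 * h) <;> by_cases h2 : HNode u I (2 * h + 1) <;> simp [h1, h2]

/-- If the test holds, go back by one record and let `r` tell whether the node of this record has
elements of the intersection below it; otherwise let `r` be `0`. -/
def pull (r : ℕ) (test : Expr) : Prog :=
  r ::= 0 ;;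
  branch test
    (rKid ::= 𝐯 rKid - 1 ;; r ::= .cell (𝐯 rQue + 𝐯 rKid * 𝐯 rStr + 𝐯 rK + 1) / 4)
    skip

lemma WP.pull {σ : Store} {r c : ℕ} {test : Expr} (hS : Setting w u k D T)
    (hI : ∀ x, x ∈ I ↔ ∀ j < k, x ∈ T j) (hr : 30 ≤ r) (hG : Globals w u k D σ.v)
    (hs : test.small) (hok : test.ok w (σ.asg r 0))
    (ht : test.val w (σ.asg r 0) ≠ 0 ↔ Visited u k T c)
    (hK : σ.v rKid = Nat.count (Visited u k T) (c + 1))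
    (hC : Visited u k T c →
      σ.m (slot k D (Nat.count (Visited u k T) c) + (k + 1)) = codeOf u I c) :
    WP w (pull r test) (fun σ' => σ'.v rKid = Nat.count (Visited u k T) c ∧
      σ'.v r = (decide (Visited u k T c ∧ HNode u I c)).toNat ∧
      (∀ r', r' ≠ rKid → r' ≠ r → σ'.v r' = σ.v r') ∧ σ'.m = σ.m ∧ σ'.clk ≤ σ.clk + 400) σ := by
  obtain ⟨h1, h2, h3, h4⟩ := hS.bounds
  have hw : 1 ≤ w := by have := hS.three_le; omega
  have htot := hS.total_lt
  have hct := count_visited_le_total (u := u) (k := k) (T := T) c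
  rw [Nat.count_succ] at hK
  have hs' := hS.slot_le (s := Nat.count (Visited u k T) c) (j := k + 1) (by omega) (by omega)
  have n2 : 2 ≠ r := by omega
  have n5 : 5 ≠ r := by omega
  have n6 : 6 ≠ r := by omega
  have n15 : 15 ≠ r := by omega
  have n15' : r ≠ 15 := by omega
  refine .seq (.assign hw _ (by decide) 0 (by simp) (by simp) ?_)
  refine .branch hw hs hok (fun hv => ?_) fun hv => ?_
  · rw [ht] at hv
    have hC := hC hv
    rw [if_pos hv, rKid] at hK
    refine .seq (.assign hw _ (by decide) (Nat.count (Visited u k T) c) ?_ ?_ ?_)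
    · simp [n15, hK]; omega
    · simp [n15, hK]
    refine .assign hw _ (by decide) (decide (HNode u I c)).toNat ?_ ?_ ⟨?_, ?_, ?_, ?_, ?_⟩
    · simp [n2, n5, n6, hG.eq_que, hG.eq_str, hG.eq_k]; omega
    · simp [n2, n5, n6, hG.eq_que, hG.eq_str, hG.eq_k]
      rw [add_assoc (D + 9 * k + _), hC]
      exact codeOf_div hv hI
    · simp [n15]
    · rw [Store.asg_v, if_pos rfl, decide_eq_decide.2 (and_iff_right hv)]
    · intro r' h15 hr'
      simp at h15
      simp [h15, hr']
    · rfl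
    · simp
  · have hv : ¬ Visited u k T c := fun o => ht.2 o hv
    rw [if_neg hv, rKid] at hK
    refine .skip ⟨?_, ?_, ?_, ?_, ?_⟩
    · simp [n15, hK]
    · simp [hv]
    · intro r' h15 hr'
      simp [hr']
    · rfl
    · simp

/-- Replace the flag of the last node that has not yet been treated by its code. -/
def pruneStep : Prog :=
  rHead ::= 𝐯 rHead - 1 ;;
  rFlag ::= .cell (𝐯 rQue + 𝐯 rHead * 𝐯 rStr + 𝐯 rK + 1) ;;
  branch (.lt (𝐯 rFlag) 4)
    (pull rY (𝐯 rFlag / 2) ;;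
     pull rX (𝐯 rFlag % 2) ;;
     write (𝐯 rQue + 𝐯 rHead * 𝐯 rStr + 𝐯 rK + 1) (𝐯 rX + 2 * 𝐯 rY + 4 * (𝐯 rX ||| 𝐯 rY)))
    skip

lemma WP.pruneStep {σ : Store} {h : ℕ} (hS : Setting w u k D T)
    (hI : ∀ x, x ∈ I ↔ ∀ j < k, x ∈ T j) (hG : Globals w u k D σ.v) (hv : Visited u k T h)
    (he : σ.v rHead = Nat.count (Visited u k T) (h + 1))
    (hK : σ.v rKid = Nat.count (Visited u k T) (2 * (h + 1)))
    (hF : σ.m (slot k D (Nat.count (Visited u k T) h) + (k + 1)) = flagOf u k T h)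
    (hC : ∀ c, h < c → Visited u k T c →
      σ.m (slot k D (Nat.count (Visited u k T) c) + (k + 1)) = codeOf u I c) :
    WP w pruneStep (fun σ' => σ'.v rHead = Nat.count (Visited u k T) h ∧
      σ'.v rKid = Nat.count (Visited u k T) (2 * h) ∧
      σ'.m (slot k D (Nat.count (Visited u k T) h) + (k + 1)) = codeOf u I h ∧
      (∀ x, x ≠ slot k D (Nat.count (Visited u k T) h) + (k + 1) → σ'.m x = σ.m x) ∧
      (∀ r < 11, σ'.v r = σ.v r) ∧ σ'.v rTail = σ.v rTail ∧ σ'.clk ≤ σ.clk + 1200) σ := by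
  obtain ⟨h1, h2, h3, h4⟩ := hS.bounds
  have hw : 1 ≤ w := by have := hS.three_le; omega
  have htot := hS.total_lt
  have hct := count_visited_le_total (u := u) (k := k) (T := T) h
  have hs' := hS.slot_le (s := Nat.count (Visited u k T) h) (j := k + 1) (by omega) (by omega)
  have hh := hv.1
  rw [Nat.count_succ, if_pos hv, rHead] at he
  set e := Nat.count (Visited u k T) h with hedef
  refine .seq (.assign hw _ (by decide) e ?_ ?_ ?_)
  · simp [he]; omega
  · simp [he]
  refine .seq (.assign hw _ (by decide) (flagOf u k T h) ?_ ?_ ?_)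
  · simp [hG.eq_que, hG.eq_str, hG.eq_k]; omega
  · simp [hG.eq_que, hG.eq_str, hG.eq_k]
    rw [add_assoc (D + 9 * k + _), hF]
  have hflag : flagOf u k T h = if HFull u I h then 4 else
      (if Visited u k T (2 * h) then 1 else 0) + (if Visited u k T (2 * h + 1) then 2 else 0) := by
    unfold flagOf
    rw [if_congr (hFull_inter_iff hI h) rfl rfl]
  refine .branch hw (by decide) (by simp; omega) (fun hlt => ?_) fun hge => ?_
  · rw [Ne, Expr.val_lt_eq_zero] at hlt
    simp at hlt
    have hf : ¬ HFull u I h := fun hf => by rw [hflag, if_pos hf] at hlt; omega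
    rw [if_neg hf] at hflag
    have hlth := hv.lt_of_not_full hI hf
    have hdiv : flagOf u k T h / 2 ≠ 0 ↔ Visited u k T (2 * h + 1) := by
      rw [hflag]
      by_cases c : Visited u k T (2 * h + 1)
      · rw [if_pos c]; exact iff_of_true (by split_ifs <;> decide) c
      · rw [if_neg c]; exact iff_of_false (by split_ifs <;> decide) c
    have hmod : flagOf u k T h % 2 ≠ 0 ↔ Visited u k T (2 * h) := by
      rw [hflag]
      by_cases c : Visited u k T (2 * h)
      · rw [if_pos c]; exact iff_of_true (by split_ifs <;> decide) c
      · rw [if_neg c]; exact iff_of_false (by split_ifs <;> decide) c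
    have hchild : ∀ i < 2, (decide (Visited u k T (2 * h + i) ∧ HNode u I (2 * h + i))).toNat =
        (decide (HNode u I (2 * h + i))).toNat := by
      intro i hi
      congr 1
      rw [decide_eq_decide]
      refine ⟨fun o => o.2, fun o => ⟨(visited_child hh hlth hi).2
        ⟨fun j hj => hNode_of_inter hI o hj, ?_⟩, o⟩⟩
      rw [hFull_inter_iff hI] at hf
      push Not at hf
      exact hf
    refine .seq ((WP.pull (r := rY) (c := 2 * h + 1) (I := I) hS hI (by decide) (hG.congr ?_)
      (by decide) ?_ ?_ (by exact hK) ?_).mono fun σ1 ⟨a1, a2, a3, a4, a5⟩ => ?_)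
    · intro r hr
      simp
      repeat rw [if_neg (by omega)]
    · simp; omega
    · simpa using hdiv
    · intro hv'
      simpa using hC _ (by omega) hv'
    have f1 : σ1.v 14 = flagOf u k T h := by rw [a3 14 (by decide) (by decide)]; simp
    have g1 : ∀ r < 11, σ1.v r = σ.v r := fun r hr => by
      rw [a3 r (by simp; omega) (by simp; omega)]
      simp
      repeat rw [if_neg (by omega)]
    have e1 : σ1.v 11 = e := by rw [a3 11 (by decide) (by decide)]; simp
    have t1 : σ1.v 12 = σ.v 12 := by rw [a3 12 (by decide) (by decide)]; simp
    refine .seq ((WP.pull (r := rX) (c := 2 * h) (I := I) hS hI (by decide)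
      (hG.congr fun r hr => g1 r (by omega)) (by decide) ?_ ?_ a1 ?_).mono
      fun σ2 ⟨b1, b2, b3, b4, b5⟩ => ?_)
    · simp; omega
    · simpa [f1] using hmod
    · intro hv'
      rw [a4]
      simpa using hC _ (by omega) hv'
    have g2 : ∀ r < 11, σ2.v r = σ.v r := fun r hr => by
      rw [b3 r (by simp; omega) (by simp; omega), g1 r hr]
    have hG2 := hG.congr fun r hr => g2 r (by omega)
    have e2 : σ2.v 11 = e := by rw [b3 11 (by decide) (by decide)]; exact e1
    have t2 : σ2.v 12 = σ.v 12 := by rw [b3 12 (by decide) (by decide)]; exact t1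
    have x2 : σ2.v 38 = (decide (HNode u I (2 * h))).toNat := b2.trans (hchild 0 (by omega))
    have y2 : σ2.v 39 = (decide (HNode u I (2 * h + 1))).toNat := by
      rw [b3 39 (by decide) (by decide)]
      exact a2.trans (hchild 1 (by omega))
    have hcode : σ2.v 38 + 2 * σ2.v 39 + 4 * (σ2.v 38 ||| σ2.v 39) = codeOf u I h := by
      rw [codeOf, if_neg hf, x2, y2]
    have h7 := codeOf_le (u := u) (I := I) h
    refine .write hw (by decide) (by decide) (by decide) (slot k D e + (k + 1)) (codeOf u I h) ?_ ?_
      ?_ ?_ ⟨?_, ?_, ?_, ?_, ?_, ?_, ?_⟩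
    · simp [hG2.eq_que, hG2.eq_str, hG2.eq_k, e2]; omega
    · simp; omega
    · simp [hG2.eq_que, hG2.eq_str, hG2.eq_k, e2]; ring
    · simpa using hcode
    · simpa using e2
    · simpa using b1
    · simp
    · intro x hx
      simp [hx, b4, a4]
    · simpa using g2
    · simpa using t2
    · simp at a5 b5 ⊢; omega
  · rw [Expr.val_lt_eq_zero] at hge
    simp at hge
    have hf : HFull u I h := by
      by_contra hf
      rw [hflag, if_neg hf] at hge
      split_ifs at hge <;> omega
    refine .skip ⟨?_, ?_, ?_, ?_, ?_, ?_, ?_⟩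
    · simp
    · have n0 : ∀ i < 2, ¬ Visited u k T (2 * h + i) := fun i hi hv' => by
        obtain ⟨-, -, j, hj, hn⟩ := hv'.expanded hh hi
        exact hn ((hFull_inter_iff hI h).1 hf j hj)
      have n00 := n0 0 (by omega)
      rw [add_zero] at n00
      have e2 : 2 * (h + 1) = 2 * h + 1 + 1 := by ring
      rw [e2, Nat.count_succ, Nat.count_succ, if_neg n00, if_neg (n0 1 (by omega))] at hK
      simpa using hK
    · rw [codeOf, if_pos hf]
      rw [if_pos hf] at hflag
      simpa [hflag] using hF
    · intro x hx
      simp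
    · intro r hr
      simp
      repeat rw [if_neg (by omega)]
    · simp
    · simp

/-- Find the visited nodes below which the intersection has elements, from the last one back to the
root. -/
def prune : Prog := rKid ::= 𝐯 rTail ;; rHead ::= 𝐯 rTail ;; loopWhile (𝐯 rHead) pruneStep

lemma slot_ne {e e' j : ℕ} (h : e ≠ e') (hj : j ≤ k + 1) :
    slot k D e + j ≠ slot k D e' + (k + 1) := by
  rcases Nat.lt_or_gt_of_ne h with hc | hc
  · have := slot_add_le k D hc; omega
  · have := slot_add_le k D hc; omega

lemma count_visited_inj {h h' : ℕ} (hv : Visited u k T h) (hv' : Visited u k T h')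
    (hne : h ≠ h') : Nat.count (Visited u k T) h ≠ Nat.count (Visited u k T) h' := by
  rcases Nat.lt_or_gt_of_ne hne with hc | hc
  · exact (Nat.count_strict_mono hv hc).ne
  · exact (Nat.count_strict_mono hv' hc).ne'

lemma WP.prune {σ : Store} (hS : Setting w u k D T) (hI : ∀ x, x ∈ I ↔ ∀ j < k, x ∈ T j)
    (hG : Globals w u k D σ.v) (ht : σ.v rTail = total u k T) (hN : NumbersAt u k D T σ.m)
    (hF : ∀ h, Visited u k T h →
      σ.m (slot k D (Nat.count (Visited u k T) h) + (k + 1)) = flagOf u k T h) :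
    WP w prune (fun σ' => NumbersAt u k D T σ'.m ∧
      (∀ h, Visited u k T h →
        σ'.m (slot k D (Nat.count (Visited u k T) h) + (k + 1)) = codeOf u I h) ∧
      σ'.v rTail = total u k T ∧
      (∀ r < 11, σ'.v r = σ.v r) ∧ (∀ x < D + 9 * k, σ'.m x = σ.m x) ∧
      σ'.clk ≤ σ.clk + 300 + 1300 * total u k T) σ := by
  have hw : 1 ≤ w := by have := hS.three_le; omega
  have hlt : ∀ h, Visited u k T h → h < 2 ^ (height u + 1) := fun h hv => hv.2.1
  rw [rTail] at ht
  refine .seq (.assign hw _ (by decide) (total u k T) (by simp) (by simpa using ht) ?_)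
  refine .seq (.assign hw _ (by decide) (total u k T) (by simp) (by simpa using ht) ?_)
  refine .loopWhile hw (by decide) (fun n σ' => ∃ b, 1 ≤ b ∧
    Nat.count (Visited u k T) b = n ∧ n ≤ total u k T ∧ σ'.v rHead = n ∧
    σ'.v rKid = Nat.count (Visited u k T) (2 * b) ∧ NumbersAt u k D T σ'.m ∧
    (∀ h, b ≤ h → Visited u k T h →
      σ'.m (slot k D (Nat.count (Visited u k T) h) + (k + 1)) = codeOf u I h) ∧
    (∀ h < b, Visited u k T h →
      σ'.m (slot k D (Nat.count (Visited u k T) h) + (k + 1)) = flagOf u k T h) ∧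
    σ'.v rTail = total u k T ∧
    (∀ r < 11, σ'.v r = σ.v r) ∧ (∀ x < D + 9 * k, σ'.m x = σ.m x) ∧
    σ'.clk + 1300 * n ≤ σ.clk + 200 + 1300 * total u k T) (total u k T) ?_ ?_ ?_ ?_
  · refine ⟨2 ^ (height u + 1), Nat.one_le_two_pow, rfl, le_rfl, ?_, ?_, ?_, ?_, ?_, ?_, ?_, ?_, ?_⟩
    · simp
    · rw [count_eq_total fun x hx => by have := hlt x hx; omega]
      simp
    · simpa using hN
    · intro h hb hv
      have := hlt h hv
      omega
    · intro h _ hv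
      simpa using hF h hv
    · simpa using ht
    · intro r hr
      simp
      rw [if_neg (by omega), if_neg (by omega)]
    · intro x _; rfl
    · simp
  · intro n σ' _; simp
  · rintro n σ' ⟨b, hb, i1, i2, i3, i4, i5, i6, i7, i8, i9, i10, i11⟩ hval
    rw [Expr.val_var, i3] at hval
    obtain ⟨c, hcb, hv, hc⟩ := exists_prev (p := Visited u k T) (b := b) (by omega)
    have hc1 : Nat.count (Visited u k T) (c + 1) = Nat.count (Visited u k T) c + 1 := by
      rw [Nat.count_succ, if_pos hv]
    have hlast : ∀ x, c < x → Visited u k T x → b ≤ x := by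
      intro x hx hvx
      by_contra hxb
      have := lt_of_count_eq hc hvx (not_le.1 hxb)
      omega
    refine ⟨n - 1, by omega, (WP.pruneStep (σ := σ'.tick) (h := c) hS hI
      (hG.congr fun r hr => i9 r (by omega)) hv (by rw [Store.tick_v, i3, hc, i1]) ?_ ?_ ?_).mono ?_⟩
    · rw [Store.tick_v, i4]
      exact (count_two_mul_eq (by omega) hcb hc).symm
    · exact i7 c hcb hv
    · intro x hx hvx
      exact i6 x (hlast x hx hvx) hvx
    · rintro σ'' ⟨a1, a2, a3, a4, a5, a6, a7⟩
      rw [Store.tick_m] at a4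
      refine ⟨c, hv.1, by omega, by omega, by rw [a1]; omega, a2, ?_, ?_, ?_, ?_, ?_, ?_, ?_⟩
      · intro x hvx
        by_cases hxc : x = c
        · subst hxc
          rw [a4 _ (by omega)]
          exact i5 x hvx
        · rw [a4 _ (slot_ne (count_visited_inj hvx hv hxc) (by omega))]
          exact i5 x hvx
      · intro x hx hvx
        rcases hx.eq_or_lt with rfl | hx
        · exact a3
        · rw [a4 _ (slot_ne (count_visited_inj hvx hv hx.ne') le_rfl)]
          exact i6 x (hlast x hx hvx) hvx
      · intro x hx hvx
        rw [a4 _ (slot_ne (count_visited_inj hvx hv hx.ne) le_rfl)]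
        exact i7 x (by omega) hvx
      · rw [a6]; exact i8
      · intro r hr
        rw [a5 r hr]; exact i9 r hr
      · intro x hx
        rw [a4 x (by unfold slot; omega)]; exact i10 x hx
      · rw [Store.tick_clk] at a7; omega
  · rintro n σ' ⟨b, hb, i1, i2, i3, i4, i5, i6, i7, i8, i9, i10, i11⟩ hval
    rw [Expr.val_var, i3] at hval
    refine ⟨i5, fun h hv => ?_, i8, i9, i10, ?_⟩
    · by_cases hbh : b ≤ h
      · exact i6 h hbh hv
      · have := Nat.count_strict_mono hv (not_le.1 hbh)
        omega
    · rw [Store.tick_clk]; omega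

end

/-! ### Writing the output -/

/-- A bit is appended to a bit string by clearing the rest of the last word; a new word is cleared
completely, as the remainder modulo `2 ^ 0` is `0`. -/
lemma BitsAt.snoc {w a hi : ℕ} {m m' : ℕ → ℕ} {bs : List Bool}
    (h : BitsAt w m a hi bs) (b : Bool) (hhi : a + bs.length / w < hi)
    (hm : m' (a + bs.length / w) = m (a + bs.length / w) % 2 ^ (bs.length % w) |||
      b.toNat <<< (bs.length % w))
    (hne : ∀ x, x ≠ a + bs.length / w → m' x = m x) : BitsAt w m' a hi (bs ++ [b]) := by
  intro j hj
  rw [List.length_append, List.length_singleton] at hj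
  rcases Nat.lt_succ_iff_lt_or_eq.1 hj with hlt | rfl
  · obtain ⟨h1, h2⟩ := h j hlt
    refine ⟨h1, ?_⟩
    rw [List.getElem_append_left hlt, ← h2]
    by_cases he : j / w = bs.length / w
    · have hr : j % w < bs.length % w := by
        have e1 := Nat.div_add_mod j w
        have e2 := Nat.div_add_mod bs.length w
        rw [he] at e1
        omega
      rw [he, hm, Nat.testBit_or, Nat.testBit_mod_two_pow, Nat.testBit_shiftLeft]
      simp [hr]
    · rw [hne _ (by omega)]
  · refine ⟨hhi, ?_⟩
    rw [hm, Nat.testBit_or, Nat.testBit_mod_two_pow, Nat.testBit_shiftLeft]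
    cases b <;> simp

/-- Append a bit to the output. -/
def emitBit (e : Expr) : Prog :=
  rY ::= e ;;
  write (𝐯 rOut + 𝐯 rLen / 𝐯 rW)
    (.cell (𝐯 rOut + 𝐯 rLen / 𝐯 rW) % (1 <<< (𝐯 rLen % 𝐯 rW)) ||| (𝐯 rY <<< (𝐯 rLen % 𝐯 rW))) ;;
  rLen ::= 𝐯 rLen + 1

lemma WP.emitBit {w out : ℕ} {σ : Store} {e : Expr} {bs : List Bool} {b : Bool} (hw : 2 ≤ w)
    (hW : σ.v rW = w) (ho : σ.v rOut = out) (hl : σ.v rLen = bs.length)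
    (hb : BitsAt w σ.m out (2 ^ w) bs) (hroom : out + bs.length + 1 < 2 ^ w) (hs : e.small)
    (hok : e.ok w σ) (he : e.val w σ = b.toNat) :
    WP w (emitBit e) (fun σ' => σ'.v rLen = (bs ++ [b]).length ∧
      BitsAt w σ'.m out (2 ^ w) (bs ++ [b]) ∧ (∀ r, r ≠ rLen → r ≠ rY → σ'.v r = σ.v r) ∧
      (∀ x < out, σ'.m x = σ.m x) ∧ σ'.clk ≤ σ.clk + 300) σ := by
  have hr : bs.length % w < w := Nat.mod_lt _ (by omega)
  have hd := Nat.div_le_self bs.length w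
  have h2 : 2 ^ 2 ≤ 2 ^ w := Nat.pow_le_pow_right (by omega) hw
  have hlt : 2 ^ (bs.length % w) < 2 ^ w := Nat.pow_lt_pow_right (by omega) hr
  rw [rW] at hW
  rw [rOut] at ho
  rw [rLen] at hl
  have hsh : (b.toNat <<< (bs.length % w)) % 2 ^ w = b.toNat <<< (bs.length % w) := by
    apply Nat.mod_eq_of_lt
    rw [Nat.shiftLeft_eq]
    cases b
    · simp
    · simpa using hlt
  have hpos : out + bs.length / w < 2 ^ w := by
    have := Nat.add_le_add_left hd out
    omega
  refine .seq (.assign (by omega) _ hs b.toNat hok he ?_)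
  refine .seq (.write (by omega) (by decide) (by decide) (by decide) (out + bs.length / w)
    (σ.m (out + bs.length / w) % 2 ^ (bs.length % w) ||| b.toNat <<< (bs.length % w)) ?_ ?_ ?_ ?_ ?_)
  · simpa [hW, ho, hl] using hpos
  · simp [hW, ho, hl]
    omega
  · simp [hW, ho, hl]
  · simp [hW, ho, hl, hsh, Nat.one_shiftLeft, Nat.mod_eq_of_lt hlt]
  refine .assign (by omega) _ (by decide) (bs.length + 1) ?_ ?_ ⟨?_, ?_, ?_, ?_, ?_⟩
  · simp [hl]; omega
  · simp [hl]
  · simp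
  · exact hb.snoc b hpos (by simp) fun x hx => by simp [hx]
  · intro r hr hr'
    rw [rLen] at hr
    rw [rY] at hr'
    simp [hr, hr']
  · intro x hx
    have : x ≠ out + bs.length / w := (hx.trans_le (Nat.le_add_right _ _)).ne
    simp [this]
  · simp

section
variable {w u k D : ℕ} {T : ℕ → Finset ℕ} {I : Finset ℕ}

lemma codeUpto_eq {a b : ℕ} (hab : a ≤ b) (h : ∀ x, a ≤ x → x < b → ¬ HKept u I x) :
    codeUpto u I b = codeUpto u I a := by
  induction b, hab using Nat.le_induction with
  | base => rfl
  | succ b hab ih =>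
    rw [codeUpto, if_neg (h b hab (by omega)), List.append_nil]
    exact ih fun x hx hxb => h x hx (by omega)

/-- Append the two bits of the current node to the output, if it belongs to the pruned trie of the
intersection and has depth less than `ℓ`. -/
def emitStep : Prog :=
  rH ::= .cell (𝐯 rQue + 𝐯 rHead * 𝐯 rStr + 𝐯 rK) ;;
  rFlag ::= .cell (𝐯 rQue + 𝐯 rHead * 𝐯 rStr + 𝐯 rK + 1) ;;
  rHead ::= 𝐯 rHead + 1 ;;
  branch (.lt (𝐯 rH) (𝐯 rPow))
    (branch (𝐯 rFlag / 4) (emitBit (𝐯 rFlag % 2) ;; emitBit (𝐯 rFlag / 2 % 2)) skip)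
    skip

lemma length_codeUpto_le (hu : 1 ≤ u) {h : ℕ} (hh : h ≤ 2 ^ height u) :
    (codeUpto u I h).length ≤ 4 * u := by
  have := (codeUpto_prefix (S := I) (u := u) hh).length_le
  rw [← trieCode_eq_codeUpto] at this
  exact this.trans (length_trieCode_le_universe hu I)

/-- The address of the output. -/
abbrev outAddr (u k D : ℕ) : ℕ := D + 9 * k + 4 * u * (k + 2)

lemma slot_lt_outAddr {e j : ℕ} (he : e < 4 * u) (hj : j < k + 2) :
    slot k D e + j < outAddr u k D := by
  have := slot_add_le k D he
  unfold outAddr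
  unfold slot at *
  omega

lemma Setting.outAddr_le (hS : Setting w u k D T) : outAddr u k D + 10 * u < 2 ^ w := by
  obtain ⟨h1, h2, h3, h4⟩ := hS.bounds
  have : 4 * u * (k + 2) = 4 * (k * u) + 8 * u := by ring
  unfold outAddr
  omega

lemma WP.emitStep {σ : Store} {h : ℕ} (hS : Setting w u k D T)
    (hI : ∀ x, x ∈ I ↔ ∀ j < k, x ∈ T j) (hG : Globals w u k D σ.v) (hv : Visited u k T h)
    (ho : σ.v rOut = outAddr u k D) (he : σ.v rHead = Nat.count (Visited u k T) h)
    (hH : σ.m (slot k D (Nat.count (Visited u k T) h) + k) = h)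
    (hC : σ.m (slot k D (Nat.count (Visited u k T) h) + (k + 1)) = codeOf u I h)
    (hl : σ.v rLen = (codeUpto u I (min h (2 ^ height u))).length)
    (hb : BitsAt w σ.m (outAddr u k D) (2 ^ w) (codeUpto u I (min h (2 ^ height u)))) :
    WP w emitStep (fun σ' => σ'.v rHead = Nat.count (Visited u k T) (h + 1) ∧
      σ'.v rLen = (codeUpto u I (min (h + 1) (2 ^ height u))).length ∧
      BitsAt w σ'.m (outAddr u k D) (2 ^ w) (codeUpto u I (min (h + 1) (2 ^ height u))) ∧
      (∀ r < 10, σ'.v r = σ.v r) ∧ σ'.v rTail = σ.v rTail ∧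
      (∀ x < outAddr u k D, σ'.m x = σ.m x) ∧ σ'.clk ≤ σ.clk + 1100) σ := by
  obtain ⟨h1, h2, h3, h4⟩ := hS.bounds
  have hw : 3 ≤ w := hS.three_le
  have htot := hS.total_lt
  have hct := count_visited_le_total (u := u) (k := k) (T := T) h
  have hs' := hS.slot_le (s := Nat.count (Visited u k T) h) (j := k + 1) (by omega) (by omega)
  have hout := hS.outAddr_le
  have hsucc : Nat.count (Visited u k T) (h + 1) = Nat.count (Visited u k T) h + 1 := by
    rw [Nat.count_succ, if_pos hv]
  have hkept : HKept u I h ↔ HNode u I h :=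
    (hKept_inter_iff hI h).trans (and_iff_right hv)
  rw [hsucc]
  rw [rHead] at he
  rw [rOut] at ho
  rw [rLen] at hl
  set e := Nat.count (Visited u k T) h with hedef
  refine .seq (.assign (by omega) _ (by decide) h ?_ ?_ ?_)
  · simp [hG.eq_que, hG.eq_str, hG.eq_k, he]; omega
  · simpa [hG.eq_que, hG.eq_str, hG.eq_k, he] using hH
  refine .seq (.assign (by omega) _ (by decide) (codeOf u I h) ?_ ?_ ?_)
  · simp [hG.eq_que, hG.eq_str, hG.eq_k, he]; omega
  · simpa [hG.eq_que, hG.eq_str, hG.eq_k, he, add_assoc] using hC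
  refine .seq (.assign (by omega) _ (by decide) (e + 1) ?_ ?_ ?_)
  · simp [he]; omega
  · simp [he]
  refine .branch (by omega) (by decide) (by simp) (fun hlt => ?_) fun hge => ?_
  · rw [Ne, Expr.val_lt_eq_zero] at hlt
    simp [hG.eq_pow] at hlt
    have hroom := length_codeUpto_le (u := u) (I := I) hS.1 hlt.le
    rw [min_eq_left hlt.le] at hl hb
    rw [min_eq_left (Nat.succ_le_of_lt hlt), codeUpto]
    have hdiv := codeOf_div hv hI
    refine .branch (by omega) (by decide) (by simp; omega) (fun hn => ?_) fun hn => ?_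
    · simp only [Expr.val_div, Expr.val_var] at hn
      have hn' : HNode u I h := by
        by_contra hc
        apply hn
        simpa [hc] using hdiv
      rw [if_pos (hkept.2 hn'), hCode_eq_codeOf]
      refine .seq ((WP.emitBit (e := 𝐯 rFlag % 2) (bs := codeUpto u I h) (out := outAddr u k D)
        (b := decide (codeOf u I h % 2 = 1)) (by omega) ?_ ?_ ?_ (by exact hb) ?_ (by decide)
        ?_ ?_).mono fun σ1 ⟨a1, a2, a3, a4, a5⟩ => ?_)
      · simp [hG.eq_w]
      · simp [ho]
      · simp [hl]
      · omega
      · simp; omega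
      · rcases Nat.mod_two_eq_zero_or_one (codeOf u I h) with c | c <;> simp [c]
      refine (WP.emitBit (e := 𝐯 rFlag / 2 % 2) (bs := codeUpto u I h ++ [decide (codeOf u I h % 2 = 1)])
        (out := outAddr u k D) (b := decide (codeOf u I h / 2 % 2 = 1)) (by omega) ?_ ?_ a1 a2 ?_
        (by decide) ?_ ?_).mono fun σ2 ⟨b1, b2, b3, b4, b5⟩ => ?_
      · rw [a3 _ (by decide) (by decide)]; simp [hG.eq_w]
      · rw [a3 _ (by decide) (by decide)]; simp [ho]
      · simp; omega
      · simp; omega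
      · have : σ1.v 14 = codeOf u I h := by rw [a3 _ (by decide) (by decide)]; simp
        rcases Nat.mod_two_eq_zero_or_one (codeOf u I h / 2) with c | c <;> simp [c, this]
      rw [List.append_assoc, List.singleton_append] at b1 b2
      refine ⟨?_, b1, b2, ?_, ?_, ?_, ?_⟩
      · rw [b3 _ (by decide) (by decide), a3 _ (by decide) (by decide)]; simp
      · intro r hr
        rw [b3 _ (by simp; omega) (by simp; omega), a3 _ (by simp; omega) (by simp; omega)]
        simp
        repeat rw [if_neg (by omega)]
      · rw [b3 _ (by decide) (by decide), a3 _ (by decide) (by decide)]; simp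
      · intro x hx
        rw [b4 x hx, a4 x hx]; simp
      · simp at a5 ⊢; omega
    · simp only [Expr.val_div, Expr.val_var] at hn
      have hn' : ¬ HNode u I h := by
        intro hc
        simp [hc] at hdiv
        simp at hn
        omega
      rw [if_neg (mt hkept.1 hn'), List.append_nil]
      refine .skip ⟨?_, ?_, ?_, ?_, ?_, ?_, ?_⟩
      · simp
      · simpa using hl
      · simpa using hb
      · intro r hr
        simp
        repeat rw [if_neg (by omega)]
      · simp
      · intro x hx; simp
      · simp
  · rw [Expr.val_lt_eq_zero] at hge
    simp [hG.eq_pow] at hge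
    rw [min_eq_right hge] at hl hb
    rw [min_eq_right (by omega)]
    refine .skip ⟨?_, ?_, ?_, ?_, ?_, ?_, ?_⟩
    · simp
    · simpa using hl
    · simpa using hb
    · intro r hr
      simp
      repeat rw [if_neg (by omega)]
    · simp
    · intro x hx; simp
    · simp

/-- Write the code of the pruned trie of the intersection. -/
def emit : Prog :=
  rOut ::= 𝐯 rQue + 4 * 𝐯 rU * 𝐯 rStr ;;
  rLen ::= 0 ;;
  rHead ::= 0 ;;
  loopWhile (.lt (𝐯 rHead) (𝐯 rTail)) emitStep

lemma WP.emit {σ : Store} (hS : Setting w u k D T) (hI : ∀ x, x ∈ I ↔ ∀ j < k, x ∈ T j)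
    (hG : Globals w u k D σ.v) (ht : σ.v rTail = total u k T) (hN : NumbersAt u k D T σ.m)
    (hC : ∀ h, Visited u k T h →
      σ.m (slot k D (Nat.count (Visited u k T) h) + (k + 1)) = codeOf u I h) :
    WP w emit (fun σ' => σ'.v rOut = outAddr u k D ∧ σ'.v rLen = (trieCode u I).length ∧
      BitsAt w σ'.m (outAddr u k D) (2 ^ w) (trieCode u I) ∧ (∀ r < 9, σ'.v r = σ.v r) ∧
      (∀ x < outAddr u k D, σ'.m x = σ.m x) ∧
      σ'.clk ≤ σ.clk + 400 + 1200 * total u k T) σ := by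
  obtain ⟨h1, h2, h3, h4⟩ := hS.bounds
  have hw : 1 ≤ w := by have := hS.three_le; omega
  have htot := hS.total_lt
  have hout := hS.outAddr_le
  have hslot : ∀ {h j}, Visited u k T h → j < k + 2 →
      slot k D (Nat.count (Visited u k T) h) + j < outAddr u k D := fun {h j} _ hj =>
    slot_lt_outAddr (by have := count_visited_le_total (u := u) (k := k) (T := T) h; omega) hj
  have e4 : 4 * u * (k + 2) = 4 * (k * u) + 8 * u := by ring
  rw [rTail] at ht
  refine .seq (.assign hw _ (by decide) (outAddr u k D) ?_ ?_ ?_)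
  · simp [hG.eq_que, hG.eq_str, hG.eq_u]
    unfold outAddr at hout
    omega
  · simp [hG.eq_que, hG.eq_str, hG.eq_u]
  refine .seq (.assign hw _ (by decide) 0 (by simp) (by simp) ?_)
  refine .seq (.assign hw _ (by decide) 0 (by simp) (by simp) ?_)
  have hG' : ∀ σ' : Store, (∀ r < 9, σ'.v r = σ.v r) → Globals w u k D σ'.v := fun σ' hσ =>
    hG.congr fun r hr => hσ r (by omega)
  refine .loopWhile hw (by decide) (fun n σ' => ∃ h,
    Nat.count (Visited u k T) h + n = total u k T ∧
    σ'.v rHead = Nat.count (Visited u k T) h ∧ σ'.v rTail = total u k T ∧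
    σ'.v rOut = outAddr u k D ∧
    σ'.v rLen = (codeUpto u I (min h (2 ^ height u))).length ∧
    BitsAt w σ'.m (outAddr u k D) (2 ^ w) (codeUpto u I (min h (2 ^ height u))) ∧
    (∀ r < 9, σ'.v r = σ.v r) ∧ (∀ x < outAddr u k D, σ'.m x = σ.m x) ∧
    σ'.clk ≤ σ.clk + 300 + 1200 * Nat.count (Visited u k T) h) (total u k T) ?_ ?_ ?_ ?_
  · refine ⟨0, by simp, by simp, by simpa using ht, by simp, by simp [codeUpto], ?_, ?_,
      fun _ _ => rfl, by simp⟩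
    · intro j hj
      simp [codeUpto] at hj
    · intro r hr
      simp
      repeat rw [if_neg (by omega)]
  · intro n σ' _; simp
  · rintro n σ' ⟨h, i1, i2, i3, i4, i5, i6, i7, i8, i9⟩ hval
    rw [Ne, Expr.val_lt_eq_zero, Expr.val_var, Expr.val_var, i2, i3, not_le] at hval
    obtain ⟨c, hle, hv, hc⟩ := exists_next hval
    have hsucc : Nat.count (Visited u k T) (c + 1) = Nat.count (Visited u k T) c + 1 := by
      rw [Nat.count_succ, if_pos hv]
    have hcode : codeUpto u I (min h (2 ^ height u)) = codeUpto u I (min c (2 ^ height u)) := by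
      refine (codeUpto_eq (by omega) fun x hx hxc hk => ?_).symm
      have := lt_of_count_eq hc.symm ((hKept_inter_iff hI x).1 hk).1 (by omega)
      omega
    rw [hcode] at i5 i6
    refine ⟨n - 1, by omega, (WP.emitStep (σ := σ'.tick) hS hI (hG' _ i7) hv i4
      (by rw [Store.tick_v, i2, hc]) ?_ ?_ i5 i6).mono ?_⟩
    · rw [Store.tick_m, i8 _ (hslot hv (by omega))]
      exact hN c hv
    · rw [Store.tick_m, i8 _ (hslot hv (by omega))]
      exact hC c hv
    · rintro σ'' ⟨a1, a2, a3, a4, a5, a6, a7⟩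
      refine ⟨c + 1, by omega, a1, a5.trans i3, (a4 9 (by omega)).trans i4, a2, a3,
        fun r hr => (a4 r (by omega)).trans (i7 r hr), fun x hx => (a6 x hx).trans (i8 x hx), ?_⟩
      rw [Store.tick_clk] at a7; omega
  · rintro n σ' ⟨h, i1, i2, i3, i4, i5, i6, i7, i8, i9⟩ hval
    rw [Expr.val_lt_eq_zero, Expr.val_var, Expr.val_var, i2, i3] at hval
    have hcode : codeUpto u I (min h (2 ^ height u)) = trieCode u I := by
      rw [trieCode_eq_codeUpto]
      refine (codeUpto_eq (by omega) fun x hx hxc hk => ?_).symm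
      have hv := ((hKept_inter_iff hI x).1 hk).1
      have hlt : x < 2 ^ (height u + 1) := hv.2.1
      have : _ < total u k T := Nat.count_strict_mono hv hlt
      have := Nat.count_monotone (Visited u k T) (show h ≤ x by omega)
      omega
    rw [hcode] at i5 i6
    refine ⟨i4, i5, i6, i7, i8, ?_⟩
    have := count_visited_le_total (u := u) (k := k) (T := T) h
    rw [Store.tick_clk]; omega

end

/-! ### Reading the headers of the representations -/

/-- Read the first bit of a representation, and the unary code of the logarithm of the block
size. -/
def readHeader : Prog :=
  readField r1 0 1 ;;
  rNe ::= 𝐯 rNe * 𝐯 r1 ;;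
  r2 ::= 0 ;;
  readField r1 1 1 ;;
  loopWhile (𝐯 r1) (r2 ::= 𝐯 r2 + 1 ;; readField r1 (𝐯 r2 + 1) 1)

lemma WP.readHeader {w hi : ℕ} {σ : Store} {flag : Bool} {c : List Bool} (hw : 3 ≤ w)
    (hW : σ.v rW = w) (hb : BitsAt w σ.m (σ.v rA) hi (directory flag c ++ c))
    (hhi : hi + 1 < 2 ^ w) (hcap : posCode c.length + c.length < 2 ^ w) (hNe : σ.v rNe ≤ 1) :
    WP w readHeader (fun σ' => σ'.v r2 = lvl c.length ∧ σ'.v rNe = σ.v rNe * flag.toNat ∧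
      (∀ r < 40, r ≠ rNe → σ'.v r = σ.v r) ∧ σ'.m = σ.m ∧
      σ'.clk ≤ σ.clk + 1000 + 600 * lvl c.length) σ := by
  have hw1 : 1 ≤ w := by omega
  have h8 : 2 ^ 3 ≤ 2 ^ w := Nat.pow_le_pow_right (by omega) hw
  have hne : directory flag c ++ c ≠ [] := by simp [directory]
  have hlen : (directory flag c ++ c).length = posCode c.length + c.length := by
    rw [List.length_append, length_directory]
  have hflag : flag.toNat ≤ 1 := Bool.toNat_le flag
  have f0 := directory_flag flag c c
  have fe := directory_unary_end flag c c
  have f1 : ∀ i ≤ lvl c.length, HasField (directory flag c ++ c) (i + 1) 1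
      (if i < lvl c.length then 1 else 0) := by
    intro i hi
    split_ifs with h
    · exact directory_unary flag c c h
    · rwa [le_antisymm hi (not_lt.1 h)]
  have ge := fe.lt_length le_rfl
  rw [rW] at hW
  rw [rA] at hb
  rw [rNe] at hNe
  refine .seq (.readField (bs := directory flag c ++ c) (hi := hi) hw1 hW hb hne hhi
    (Nat.zero_le _) f0 (by omega) (by decide) (by decide) ?_ ?_ ?_ ?_ ?_)
  · simp
  · simp
  · simp; omega
  · simp
  refine .seq (.assign hw1 _ (by decide) (σ.v 8 * flag.toNat) ?_ ?_ ?_)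
  · have := Nat.mul_le_mul hNe hflag
    simp; omega
  · simp
  refine .seq (.assign hw1 _ (by decide) 0 (by simp) (by simp) ?_)
  refine .seq (.readField (bs := directory flag c ++ c) (hi := hi) hw1 ?_ ?_ hne hhi
    (p := 0 + 1) (by omega) (f1 0 (Nat.zero_le _)) (by split_ifs <;> omega) (by decide) (by decide)
    ?_ ?_ ?_ ?_ ?_)
  · simpa using hW
  · simpa using hb
  · simp; omega
  · simp
  · simp; omega
  · simp
  refine .loopWhile hw1 (by decide) (fun n σ' => ∃ i, i + n = lvl c.length ∧ σ'.v r2 = i ∧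
    σ'.v r1 = (if i < lvl c.length then 1 else 0) ∧ σ'.v rNe = σ.v 8 * flag.toNat ∧
    (∀ r < 40, r ≠ rNe → σ'.v r = σ.v r) ∧ σ'.m = σ.m ∧ σ'.clk ≤ σ.clk + 800 + 600 * i)
    (lvl c.length) ?_ ?_ ?_ ?_
  · refine ⟨0, by simp, by simp, by simp, by simp, ?_, by simp, by simp⟩
    intro r hr h8
    rw [rNe] at h8
    simp [h8]
    repeat rw [if_neg (by omega)]
  · intro n σ' _; simp
  · rintro n σ' ⟨i, i1, i2, i3, i4, i5, i6, i7⟩ hval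
    rw [Expr.val_var, i3] at hval
    have hlt : i < lvl c.length := by
      by_contra hc
      rw [if_neg hc] at hval
      exact hval rfl
    have hf := f1 (i + 1) hlt
    have hf' := hf.lt_length le_rfl
    rw [r2] at i2
    rw [rNe] at i4
    refine ⟨n - 1, by omega, .seq (.assign hw1 _ (by decide) (i + 1) ?_ ?_ ?_)⟩
    · simp [i2]; omega
    · simp [i2]
    refine .readField (bs := directory flag c ++ c) (hi := hi) hw1 ?_ ?_ hne hhi
      (by omega) hf (by split_ifs <;> omega) (by decide) (by decide) ?_ ?_ ?_ ?_
      ⟨i + 1, by omega, ?_, ?_, ?_, ?_, ?_, ?_⟩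
    · simpa using (i5 1 (by decide) (by decide)).trans hW
    · rw [Store.asg_m, Store.tick_m, i6]
      simpa [i5 30 (by decide) (by decide)] using hb
    · simp; omega
    · simp
    · simp; omega
    · simp
    · simp
    · simp
    · simpa using i4
    · intro r hr h8
      rw [← i5 r hr h8]
      simp
      repeat rw [if_neg (by omega)]
    · simpa using i6
    · simp; omega
  · rintro n σ' ⟨i, i1, i2, i3, i4, i5, i6, i7⟩ hval
    rw [Expr.val_var, i3] at hval
    have hi : i = lvl c.length := by
      by_contra hc
      rw [if_pos (by omega)] at hval
      cases hval
    subst hi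
    exact ⟨i2, i4, i5, i6, by rw [Store.tick_clk]; omega⟩

/-- Compute the parameters of a representation. -/
def deriveParams : Prog :=
  rB ::= 1 <<< 𝐯 r2 ;;
  rNar ::= 2 * 𝐯 r2 + 1 ;;
  readField rN (𝐯 r2 + 2) (4 * 𝐯 rB) ;;
  rTab ::= 𝐯 r2 + 2 + 4 * 𝐯 rB ;;
  rSup ::= 𝐯 rTab + (1 <<< 𝐯 rB) * 𝐯 rNar ;;
  rBlk ::= 𝐯 rSup + (𝐯 rN / (𝐯 rB * 𝐯 rB) + 1) * (4 * 𝐯 rB) ;;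
  rCod ::= 𝐯 rBlk + (𝐯 rN / 𝐯 rB + 1) * 𝐯 rNar

lemma WP.deriveParams {w hi : ℕ} {σ : Store} {flag : Bool} {c : List Bool} (hw : 3 ≤ w)
    (hW : σ.v rW = w) (hb : BitsAt w σ.m (σ.v rA) hi (directory flag c ++ c))
    (hhi : hi + 1 < 2 ^ w) (hcap : posCode c.length + c.length < 2 ^ w)
    (hl : σ.v r2 = lvl c.length) :
    WP w deriveParams (fun σ' => Params (fun i => σ'.v (rA + i)) (σ.v rA) c.length ∧
      (∀ r < 30, σ'.v r = σ.v r) ∧ σ'.m = σ.m ∧ σ'.clk ≤ σ.clk + 900) σ := by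
  have hw1 : 1 ≤ w := by omega
  have h8 : 2 ^ 3 ≤ 2 ^ w := Nat.pow_le_pow_right (by omega) hw
  have hne : directory flag c ++ c ≠ [] := by simp [directory]
  have hlen : (directory flag c ++ c).length = posCode c.length + c.length := by
    rw [List.length_append, length_directory]
  have f := directory_length flag c c
  set n := c.length with hn
  have g := f.lt_length (by have := bsz_pos n; unfold wide; omega)
  rw [hlen] at g
  have hcap2 := posCode_ge n
  have c1 : posCode n = posBlock n + (n / bsz n + 1) * RunTrie.narrow n := rfl
  have c2 : posBlock n = posSuper n + (n / (bsz n * bsz n) + 1) * wide n := rfl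
  have c3 : posSuper n = posTable n + 2 ^ bsz n * RunTrie.narrow n := rfl
  have c4 : posTable n = lvl n + 2 + wide n := rfl
  have c5 : wide n = 4 * bsz n := rfl
  have c6 : RunTrie.narrow n = 2 * lvl n + 1 := rfl
  have c7 : bsz n = 2 ^ lvl n := rfl
  have m1 : n / (bsz n * bsz n) ≤ n := Nat.div_le_self _ _
  have m2 : n / bsz n ≤ n := Nat.div_le_self _ _
  have hlb : lvl n < bsz n := Nat.lt_two_pow_self
  have hB : bsz n % 2 ^ w = bsz n := Nat.mod_eq_of_lt (by omega)
  have hBB : 2 ^ bsz n % 2 ^ w = 2 ^ bsz n := Nat.mod_eq_of_lt (by omega)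
  rw [rW] at hW
  rw [r2] at hl
  refine .seq (.assign hw1 _ (by decide) (bsz n) ?_ ?_ ?_)
  · simp; omega
  · simp [hl, Nat.one_shiftLeft, ← c7, hB]
  refine .seq (.assign hw1 _ (by decide) (RunTrie.narrow n) ?_ ?_ ?_)
  · simp [hl]; omega
  · simp [hl, c6]
  refine .seq (.readField (bs := directory flag c ++ c) (hi := hi) hw1 ?_ ?_ hne hhi ?_ f ?_
    (by decide) (by decide) ?_ ?_ ?_ ?_ ?_)
  · simpa using hW
  · simpa using hb
  · omega
  · omega
  · simp [hl]; omega
  · simp [hl]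
  · simp; omega
  · simp [c5]
  refine .seq (.assign hw1 _ (by decide) (posTable n) ?_ ?_ ?_)
  · simp [hl]; omega
  · simp [hl, c4, c5]
  refine .seq (.assign hw1 _ (by decide) (posSuper n) ?_ ?_ ?_)
  · simp [Nat.one_shiftLeft, hBB]; omega
  · simp [Nat.one_shiftLeft, hBB, c3]
  refine .seq (.assign hw1 _ (by decide) (posBlock n) ?_ ?_ ?_)
  · simp [← c5]; omega
  · simp [c2, c5]
  refine .assign hw1 _ (by decide) (posCode n) ?_ ?_ ⟨⟨?_, ?_, ?_, ?_, ?_, ?_, ?_, ?_⟩, ?_, ?_, ?_⟩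
  · simp; omega
  · simp [c1]
  any_goals simp
  intro r hr
  repeat rw [if_neg (by omega)]

/-- Store the parameters of the representation of the set with index `J`. -/
def storeParams : Prog :=
  write (𝐯 rPar + 8 * 𝐯 rJ) (𝐯 rA) ;;
  write (𝐯 rPar + 8 * 𝐯 rJ + 1) (𝐯 rB) ;;
  write (𝐯 rPar + 8 * 𝐯 rJ + 2) (𝐯 rNar) ;;
  write (𝐯 rPar + 8 * 𝐯 rJ + 3) (𝐯 rN) ;;
  write (𝐯 rPar + 8 * 𝐯 rJ + 4) (𝐯 rTab) ;;
  write (𝐯 rPar + 8 * 𝐯 rJ + 5) (𝐯 rSup) ;;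
  write (𝐯 rPar + 8 * 𝐯 rJ + 6) (𝐯 rBlk) ;;
  write (𝐯 rPar + 8 * 𝐯 rJ + 7) (𝐯 rCod)

section
variable {w u k D : ℕ} {T : ℕ → Finset ℕ}

lemma WP.storeParams {σ : Store} {j a n : ℕ} (hS : Setting w u k D T)
    (hG : Globals w u k D σ.v) (hJ : σ.v rJ = j) (hj : j < k)
    (hp : Params (fun i => σ.v (rA + i)) a n) :
    WP w storeParams (fun σ' => Params (fun i => σ'.m (D + k + 8 * j + i)) a n ∧
      (∀ x, x < D + k + 8 * j ∨ D + k + 8 * j + 8 ≤ x → σ'.m x = σ.m x) ∧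
      σ'.v = σ.v ∧ σ'.clk ≤ σ.clk + 800) σ := by
  obtain ⟨h1, h2, h3, h4⟩ := hS.bounds
  have hw : 1 ≤ w := by have := hS.three_le; omega
  rw [rJ] at hJ
  obtain ⟨pa, pb, pn, pl, pt, ps, pk, pc⟩ := hp
  simp only [rA] at pa pb pn pl pt ps pk pc
  norm_num at pa pb pn pl pt ps pk pc
  have hpar := hG.eq_par
  refine .seq (.write hw (by decide) (by decide) (by decide) (D + k + 8 * j) a ?_ (by simp) ?_ ?_ ?_)
  · simp [hpar, hJ]; omega
  · simp [hpar, hJ]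
  · simpa using pa
  refine .seq (.write hw (by decide) (by decide) (by decide) (D + k + 8 * j + 1) _ ?_ (by simp) ?_
    pb ?_)
  · simp [hpar, hJ]; omega
  · simp [hpar, hJ]
  refine .seq (.write hw (by decide) (by decide) (by decide) (D + k + 8 * j + 2) _ ?_ (by simp) ?_
    pn ?_)
  · simp [hpar, hJ]; omega
  · simp [hpar, hJ]
  refine .seq (.write hw (by decide) (by decide) (by decide) (D + k + 8 * j + 3) _ ?_ (by simp) ?_
    pl ?_)
  · simp [hpar, hJ]; omega
  · simp [hpar, hJ]
  refine .seq (.write hw (by decide) (by decide) (by decide) (D + k + 8 * j + 4) _ ?_ (by simp) ?_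
    pt ?_)
  · simp [hpar, hJ]; omega
  · simp [hpar, hJ]
  refine .seq (.write hw (by decide) (by decide) (by decide) (D + k + 8 * j + 5) _ ?_ (by simp) ?_
    ps ?_)
  · simp [hpar, hJ]; omega
  · simp [hpar, hJ]
  refine .seq (.write hw (by decide) (by decide) (by decide) (D + k + 8 * j + 6) _ ?_ (by simp) ?_
    pk ?_)
  · simp [hpar, hJ]; omega
  · simp [hpar, hJ]
  refine .write hw (by decide) (by decide) (by decide) (D + k + 8 * j + 7) _ ?_ (by simp) ?_
    pc ⟨⟨?_, ?_, ?_, ?_, ?_, ?_, ?_, ?_⟩, ?_, ?_, ?_⟩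
  · simp [hpar, hJ]; omega
  · simp [hpar, hJ]
  any_goals simp
  intro x hx
  repeat rw [if_neg (by omega)]

/-- Read the header of the next representation, and let the first record of the queue point to the
root of the trie. -/
def setupStep : Prog :=
  rA ::= .cell (𝐯 rD + 𝐯 rJ) ;;
  readHeader ;;
  deriveParams ;;
  storeParams ;;
  write (𝐯 rQue + 𝐯 rJ) 0 ;;
  rJ ::= 𝐯 rJ + 1

/-- The unary part of a header is short enough to be read bit by bit. -/
lemma lvl_length_le (hu : 1 ≤ u) (S : Finset ℕ) : lvl (trieCode u S).length ≤ height u + 2 := by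
  set n := (trieCode u S).length
  have h1 : n ≤ 2 ^ (height u + 2) := by
    have := length_trieCode_le_universe hu S
    have := le_pow_height u
    rw [pow_add]
    omega
  have h2 : Nat.log 2 n ≤ height u + 2 := by
    have := Nat.log_mono_right (b := 2) h1
    rwa [Nat.log_pow one_lt_two] at this
  have h3 := bsz_le n
  have h4 : lvl n < bsz n := Nat.lt_two_pow_self
  omega

lemma WP.setupStep {σ : Store} {j : ℕ} (hS : Setting w u k D T) (hG : Globals w u k D σ.v)
    (hJ : σ.v rJ = j) (hj : j < k)
    (hb : BitsAt w σ.m (σ.m (D + j)) D (prefixBits u (T j) ++ trieCode u (T j)))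
    (hNe : σ.v rNe ≤ 1) :
    WP w setupStep (fun σ' => σ'.v rJ = j + 1 ∧
      σ'.v rNe = σ.v rNe * (decide (T j).Nonempty).toNat ∧
      SetAt w u D σ'.m (D + k + 8 * j) (T j) ∧ σ'.m (D + 9 * k + j) = 0 ∧
      (∀ r < 8, σ'.v r = σ.v r) ∧
      (∀ x, x < D + k + 8 * j ∨ D + k + 8 * j + 8 ≤ x → x ≠ D + 9 * k + j → σ'.m x = σ.m x) ∧
      σ'.clk ≤ σ.clk + 4200 + 600 * height u) σ := by
  obtain ⟨h1, h2, h3, h4⟩ := hS.bounds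
  have hw : 3 ≤ w := hS.three_le
  have hcl := hS.code_le (T j)
  have hlvl := lvl_length_le hS.one_le_u (T j)
  rw [rJ] at hJ
  rw [rNe] at hNe
  refine .seq (.assign (by omega) _ (by decide) (σ.m (D + j)) ?_ ?_ ?_)
  · simp [hG.eq_d, hJ]; omega
  · simp [hG.eq_d, hJ]
  refine .seq ((WP.readHeader (hi := D) (flag := decide (T j).Nonempty) (c := trieCode u (T j)) hw
    ?_ ?_ (by omega) (by omega) ?_).mono fun σ1 ⟨a1, a2, a3, a4, a5⟩ => ?_)
  · simpa using hG.eq_w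
  · simpa using hb
  · simpa using hNe
  have e30 : σ1.v 30 = σ.m (D + j) := by rw [a3 30 (by decide) (by decide)]; simp
  have g1 : ∀ r < 30, r ≠ 8 → σ1.v r = σ.v r := fun r hr h8 => by
    rw [a3 r (by omega) h8]
    simp
    omega
  have hG1 := hG.congr fun r hr => g1 r (by omega) (by omega)
  have hb1 : BitsAt w σ1.m (σ.m (D + j)) D (prefixBits u (T j) ++ trieCode u (T j)) := by
    rw [a4]; exact hb
  refine .seq ((WP.deriveParams (hi := D) (flag := decide (T j).Nonempty) (c := trieCode u (T j)) hw
    hG1.eq_w (by rw [e30]; exact hb1) (by omega) (by omega) a1).mono fun σ2 ⟨b1, b2, b3, b4⟩ => ?_)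
  have hG2 := hG1.congr fun r hr => b2 r (by omega)
  refine .seq ((WP.storeParams hS hG2 ?_ hj b1).mono fun σ3 ⟨c1, c2, c3, c4⟩ => ?_)
  · rw [b2 _ (by decide), g1 _ (by decide) (by decide)]; exact hJ
  have hG3 : Globals w u k D σ3.v := c3 ▸ hG2
  have j3 : σ3.v 20 = j := by rw [c3, b2 _ (by decide), g1 _ (by decide) (by decide)]; exact hJ
  refine .seq (.write (by omega) (by decide) (by decide) (by decide) (D + 9 * k + j) 0 ?_ (by simp)
    ?_ (by simp) ?_)
  · simp [hG3.eq_que, j3]; omega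
  · simp [hG3.eq_que, j3]
  refine .assign (by omega) _ (by decide) (j + 1) ?_ ?_ ⟨?_, ?_, ⟨σ.m (D + j), ?_, ?_⟩, ?_, ?_, ?_, ?_⟩
  · simp [j3]; omega
  · simp [j3]
  · simp
  · have : σ3.v 8 = σ.v 8 * (decide (T j).Nonempty).toNat := by
      rw [c3, b2 _ (by decide)]
      simpa using a2
    simpa using this
  · have e : ∀ i < 8, ((σ3.sto (D + 9 * k + j) 0).asg rJ (j + 1)).m (D + k + 8 * j + i) =
        σ3.m (D + k + 8 * j + i) := fun i hi => by
      rw [Store.asg_m, Store.sto_m, if_neg (by omega)]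
    rw [e30] at c1
    exact ⟨(e 0 (by omega)).trans c1.1, (e 1 (by omega)).trans c1.2, (e 2 (by omega)).trans c1.3,
      (e 3 (by omega)).trans c1.4, (e 4 (by omega)).trans c1.5, (e 5 (by omega)).trans c1.6,
      (e 6 (by omega)).trans c1.7, (e 7 (by omega)).trans c1.8⟩
  · refine hb1.congr fun x hx => ?_
    rw [Store.asg_m, Store.sto_m, if_neg (by omega), c2 x (by omega), b3]
  · simp
  · intro r hr
    simp
    rw [if_neg (by omega), c3, b2 r (by omega), g1 r (by omega) (by omega)]
  · intro x hx hx'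
    rw [Store.asg_m, Store.sto_m, if_neg hx', c2 x hx, b3, a4]
    rfl
  · simp at a5 ⊢
    omega

end

section
variable {w u k D : ℕ} {T : ℕ → Finset ℕ} {I : Finset ℕ}

/-- Compute the addresses and the number `2 ^ ℓ`. -/
def setupGlobals : Prog :=
  rPar ::= 𝐯 rD + 𝐯 rK ;;
  rQue ::= 𝐯 rPar + 8 * 𝐯 rK ;;
  rStr ::= 𝐯 rK + 2 ;;
  rPow ::= 1 ;;
  loopWhile (.lt (𝐯 rPow) (𝐯 rU)) (rPow ::= 2 * 𝐯 rPow)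

lemma WP.setupGlobals {σ : Store} (hS : Setting w u k D T) (hU : σ.v rU = u) (hW : σ.v rW = w)
    (hK : σ.v rK = k) (hD : σ.v rD = D) :
    WP w setupGlobals (fun σ' => Globals w u k D σ'.v ∧ σ'.m = σ.m ∧
      σ'.clk ≤ σ.clk + 500 + 200 * height u) σ := by
  obtain ⟨h1, h2, h3, h4⟩ := hS.bounds
  have hw : 1 ≤ w := by have := hS.three_le; omega
  have hpow := pow_height_lt hS.one_le_u
  rw [rU] at hU
  rw [rW] at hW
  rw [rK] at hK
  rw [rD] at hD
  refine .seq (.assign hw _ (by decide) (D + k) ?_ ?_ ?_)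
  · simp [hD, hK]; omega
  · simp [hD, hK]
  refine .seq (.assign hw _ (by decide) (D + 9 * k) ?_ ?_ ?_)
  · simp [hK]; omega
  · simp [hK]; ring
  refine .seq (.assign hw _ (by decide) (k + 2) ?_ ?_ ?_)
  · simp [hK]; omega
  · simp [hK]
  refine .seq (.assign hw _ (by decide) 1 (by simp; omega) (by simp) ?_)
  refine .loopWhile hw (by decide) (fun n σ' => ∃ i, i + n = height u ∧ σ'.v 7 = 2 ^ i ∧
    σ'.v 0 = u ∧ σ'.v 1 = w ∧ σ'.v 2 = k ∧ σ'.v 3 = D ∧ σ'.v 4 = D + k ∧ σ'.v 5 = D + 9 * k ∧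
    σ'.v 6 = k + 2 ∧ σ'.m = σ.m ∧ σ'.clk ≤ σ.clk + 400 + 200 * i) (height u) ?_ ?_ ?_ ?_
  · exact ⟨0, by simp [hU, hW, hK, hD]⟩
  · intro n σ' _; simp
  · rintro n σ' ⟨i, i1, i2, i3, i4, i5, i6, i7, i8, i9, i10, i11⟩ hval
    rw [Ne, Expr.val_lt_eq_zero, Expr.val_var, Expr.val_var, i2, i3, not_le] at hval
    have hi : i < height u := (Nat.lt_clog_iff_pow_lt one_lt_two).2 hval
    refine ⟨n - 1, by omega, .assign hw _ (by decide) (2 ^ (i + 1)) ?_ ?_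
      ⟨i + 1, by omega, by simp, by simp [i3], by simp [i4], by simp [i5], by simp [i6],
        by simp [i7], by simp [i8], by simp [i9], i10, ?_⟩⟩
    · simp [i2]; omega
    · simp [i2]; ring
    · simp; omega
  · rintro n σ' ⟨i, i1, i2, i3, i4, i5, i6, i7, i8, i9, i10, i11⟩ hval
    rw [Expr.val_lt_eq_zero, Expr.val_var, Expr.val_var, i2, i3] at hval
    have hi : height u ≤ i := Nat.clog_le_of_le_pow hval
    obtain rfl : i = height u := by omega
    exact ⟨⟨i3, i4, i5, i6, i7, i8, i9, i2⟩, i10, by rw [Store.tick_clk]; omega⟩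

/-- Read the headers of all the representations. -/
def setup : Prog :=
  rNe ::= 1 ;;
  rJ ::= 0 ;;
  loopWhile (.lt (𝐯 rJ) (𝐯 rK)) setupStep

lemma WP.setup {σ : Store} (hS : Setting w u k D T) (hG : Globals w u k D σ.v)
    (hb : ∀ j < k, BitsAt w σ.m (σ.m (D + j)) D (prefixBits u (T j) ++ trieCode u (T j))) :
    WP w setup (fun σ' => Globals w u k D σ'.v ∧ SetsAt w u k D T σ'.m ∧
      (∀ j < k, σ'.m (D + 9 * k + j) = 0) ∧ (σ'.v rNe ≠ 0 ↔ ∀ j < k, (T j).Nonempty) ∧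
      (∀ x < D, σ'.m x = σ.m x) ∧ σ'.clk ≤ σ.clk + 300 + k * (4300 + 600 * height u)) σ := by
  obtain ⟨h1, h2, h3, h4⟩ := hS.bounds
  have hw : 1 ≤ w := by have := hS.three_le; omega
  refine .seq (.assign hw _ (by decide) 1 (by simp; omega) (by simp) ?_)
  refine .seq (.assign hw _ (by decide) 0 (by simp) (by simp) ?_)
  refine .loopWhile hw (by decide) (fun n σ' => ∃ j, j + n = k ∧ σ'.v rJ = j ∧ σ'.v rNe ≤ 1 ∧
    (∀ i < j, SetAt w u D σ'.m (D + k + 8 * i) (T i)) ∧ (∀ i < j, σ'.m (D + 9 * k + i) = 0) ∧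
    (σ'.v rNe ≠ 0 ↔ ∀ i < j, (T i).Nonempty) ∧ (∀ r < 8, σ'.v r = σ.v r) ∧
    (∀ x < D + k, σ'.m x = σ.m x) ∧ σ'.clk ≤ σ.clk + 200 + j * (4300 + 600 * height u))
    k ?_ ?_ ?_ ?_
  · refine ⟨0, by simp, by simp, by simp, by simp, by simp, by simp, ?_, by simp, by simp⟩
    intro r hr
    simp
    repeat rw [if_neg (by omega)]
  · intro n σ' _; simp
  · rintro n σ' ⟨j, i1, i2, i3, i4, i5, i6, i7, i8, i9⟩ hval
    rw [Ne, Expr.val_lt_eq_zero, Expr.val_var, Expr.val_var, i2, i7 2 (by decide), hG.eq_k,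
      not_le] at hval
    refine ⟨n - 1, by omega, (WP.setupStep (σ := σ'.tick) hS
      (hG.congr fun r hr => i7 r (by omega)) i2 hval ?_ i3).mono ?_⟩
    · rw [Store.tick_m, i8 _ (by omega)]
      exact (hb j hval).congr fun x hx => i8 x (by omega)
    · rintro σ'' ⟨a1, a2, a3, a4, a5, a6, a7⟩
      rw [Store.tick_m] at a6
      rw [Store.tick_v] at a2 a5
      have hle : (decide (T j).Nonempty).toNat ≤ 1 := Bool.toNat_le _
      refine ⟨j + 1, by omega, a1, ?_, ?_, ?_, ?_, fun r hr => (a5 r hr).trans (i7 r hr), ?_, ?_⟩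
      · rw [a2]
        exact Nat.mul_le_mul i3 hle
      · intro i hi
        rcases Nat.lt_succ_iff_lt_or_eq.1 hi with hi | rfl
        · exact (i4 i hi).congr fun x hx => a6 x (by omega) (by omega)
        · exact a3
      · intro i hi
        rcases Nat.lt_succ_iff_lt_or_eq.1 hi with hi | rfl
        · rw [a6 _ (by omega) (by omega)]
          exact i5 i hi
        · exact a4
      · rw [a2, Nat.mul_ne_zero_iff, i6, Nat.forall_lt_succ_right]
        refine and_congr_right fun _ => ?_
        by_cases hT : (T j).Nonempty <;> simp [hT]
      · intro x hx
        rw [a6 x (by omega) (by omega)]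
        exact i8 x hx
      · rw [Store.tick_clk] at a7
        rw [add_mul, one_mul]
        omega
  · rintro n σ' ⟨j, i1, i2, i3, i4, i5, i6, i7, i8, i9⟩ hval
    rw [Expr.val_lt_eq_zero, Expr.val_var, Expr.val_var, i2, i7 2 (by decide), hG.eq_k] at hval
    obtain rfl : j = k := by omega
    exact ⟨hG.congr i7, i4, i5, i6, fun x hx => i8 x (by omega), by rw [Store.tick_clk]; omega⟩

/-! ### The whole program -/

/-- Compute the intersection of nonempty sets.  The queue starts with the root.  The results are
delivered in the registers `0`, `1`, `2`, which hold `u`, `w`, `k` until then. -/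
def intersect : Prog :=
  write (𝐯 rQue + 𝐯 rK) 1 ;;
  rHead ::= 0 ;;
  rTail ::= 1 ;;
  traverse ;;
  prune ;;
  emit ;;
  rU ::= .cell (𝐯 rQue + 𝐯 rK + 1) / 4 ;;
  rW ::= 𝐯 rOut ;;
  rK ::= 𝐯 rLen

lemma WP.intersect {σ : Store} (hS : Setting w u k D T) (hI : ∀ x, x ∈ I ↔ ∀ j < k, x ∈ T j)
    (hG : Globals w u k D σ.v) (hT : SetsAt w u k D T σ.m)
    (hz : ∀ j < k, σ.m (D + 9 * k + j) = 0) (hne : ∀ j < k, (T j).Nonempty) :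
    WP w intersect (fun σ' => σ'.v 0 = (decide I.Nonempty).toNat ∧
      BitsAt w σ'.m (σ'.v 1) (2 ^ w) (trieCode u I) ∧ σ'.v 2 = (trieCode u I).length ∧
      (∀ x < D, σ'.m x = σ.m x) ∧ σ'.clk ≤ σ.clk + 1500 + 11800 * (k * total u k T)) σ := by
  obtain ⟨h1, h2, h3, h4⟩ := hS.bounds
  have hk := hS.one_le_k
  have hw : 1 ≤ w := by have := hS.three_le; omega
  have hIu : I ⊆ Finset.range u := fun x hx => hS.subset 0 hk ((hI x).1 hx 0 hk)
  have hv : Visited u k T 1 :=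
    ⟨le_rfl, Nat.one_lt_two_pow (by omega), fun j hj => (hNode_one (hS.subset j hj)).2 (hne j hj),
      .inl rfl⟩
  have c1 : Nat.count (Visited u k T) 1 = 0 := by
    rw [Nat.count_succ, if_neg not_visited_zero, Nat.count_zero]
  have s0 : ∀ j, slot k D 0 + j = D + 9 * k + j := fun j => by simp [slot]
  refine .seq (.write hw (by decide) (by decide) (by decide) (D + 9 * k + k) 1 ?_ (by simp; omega)
    ?_ (by simp) ?_)
  · simp [hG.eq_que, hG.eq_k]; omega
  · simp [hG.eq_que, hG.eq_k]
  refine .seq (.assign hw _ (by decide) 0 (by simp) (by simp) ?_)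
  refine .seq (.assign hw _ (by decide) 1 (by simp; omega) (by simp) ?_)
  refine .seq ((WP.traverse hS (hG.congr ?_) (hT.congr ?_) (by simp) (by simp) hv ?_).mono
    fun σ1 ⟨a1, a2, a3, a4, a5, a6⟩ => ?_)
  · intro r hr
    simp
    repeat rw [if_neg (by omega)]
  · intro x hx
    simp
    omega
  · intro h hh hvh
    obtain rfl : h = 1 := by have := hvh.1; omega
    rw [c1]
    refine ⟨by rw [s0]; simp, fun j hj => ?_⟩
    have : (((σ.sto (D + 9 * k + k) 1).asg rHead 0).asg rTail 1).m (slot k D 0 + j) = 0 := by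
      rw [s0, Store.asg_m, Store.asg_m, Store.sto_m, if_neg (by omega), hz j hj]
    rw [this]
    exact Pointer.root (hS.subset j hj) (hne j hj)
  have hG1 : Globals w u k D σ1.v := hG.congr fun r hr => by
    rw [a4 r (by omega)]
    simp
    repeat rw [if_neg (by omega)]
  refine .seq ((WP.prune hS hI hG1 a1 a2 a3).mono fun σ2 ⟨b1, b2, b3, b4, b5, b6⟩ => ?_)
  have hG2 := hG1.congr fun r hr => b4 r (by omega)
  refine .seq ((WP.emit hS hI hG2 b3 b1 b2).mono fun σ3 ⟨e1, e2, e3, e4, e5, e6⟩ => ?_)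
  have hG3 := hG2.congr fun r hr => e4 r (by omega)
  have hroot : σ3.m (D + 9 * k + k + 1) = codeOf u I 1 := by
    have := b2 1 hv
    rw [c1, s0] at this
    rw [e5 _ (by rw [add_assoc, ← s0]; exact slot_lt_outAddr (by have := hS.one_le_u; omega) (by omega)),
      add_assoc]
    exact this
  have hcode := codeOf_div hv hI
  rw [show decide (HNode u I 1) = decide I.Nonempty from decide_eq_decide.2 (hNode_one hIu)] at hcode
  rw [rOut] at e1
  rw [rLen] at e2
  refine .seq (.assign hw _ (by decide) (decide I.Nonempty).toNat ?_ ?_ ?_)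
  · simp [hG3.eq_que, hG3.eq_k]; omega
  · simp [hG3.eq_que, hG3.eq_k, hroot, hcode]
  refine .seq (.assign hw _ (by decide) (outAddr u k D) (by simp) (by simpa using e1) ?_)
  refine .assign hw _ (by decide) (trieCode u I).length (by simp) (by simpa using e2)
    ⟨by simp, by simpa using e3, by simp, fun x hx => ?_, ?_⟩
  · simp only [Store.asg_m]
    rw [e5 x (by unfold outAddr; omega), b5 x (by omega), a5 x (by omega)]
    simp
    omega
  · have := Nat.le_mul_of_pos_left (total u k T) hk
    have e : 9300 * k * total u k T = 9300 * (k * total u k T) := by ring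
    rw [e] at a6
    simp at a6 e6 ⊢
    omega

/-- Compute the intersection of the queried sets; it is empty if one of them is. -/
def query : Prog :=
  setupGlobals ;;
  setup ;;
  branch (𝐯 rNe) intersect (rU ::= 0 ;; rW ::= 0 ;; rK ::= 0)

lemma trieCode_empty : trieCode u ∅ = [] := by
  rw [trieCode_eq_codeUpto]
  refine codeUpto_eq (Nat.zero_le _) fun x _ _ hk => ?_
  simpa [HNode, IsNode] using hk.2.2.1

lemma WP.query {σ : Store} (hS : Setting w u k D T) (hI : ∀ x, x ∈ I ↔ ∀ j < k, x ∈ T j)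
    (hU : σ.v rU = u) (hW : σ.v rW = w) (hK : σ.v rK = k) (hD : σ.v rD = D)
    (hb : ∀ j < k, BitsAt w σ.m (σ.m (D + j)) D (prefixBits u (T j) ++ trieCode u (T j))) :
    WP w query (fun σ' => σ'.v 0 = (decide I.Nonempty).toNat ∧
      BitsAt w σ'.m (σ'.v 1) (2 ^ w) (trieCode u I) ∧ σ'.v 2 = (trieCode u I).length ∧
      (∀ x < D, σ'.m x = σ.m x) ∧
      σ'.clk ≤ σ.clk + k * (6700 + 800 * height u + 11800 * total u k T)) σ := by
  have hw : 1 ≤ w := by have := hS.three_le; omega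
  have hk := hS.one_le_k
  have hkh := Nat.le_mul_of_pos_left (height u) hk
  have ek : ∀ n, k * (6700 + 800 * height u + n) = 4300 * k + k * (600 * height u) + 2400 * k +
      200 * (k * height u) + k * n := fun n => by ring
  refine .seq ((WP.setupGlobals hS hU hW hK hD).mono fun σ1 ⟨hG, a1, a2⟩ => ?_)
  refine .seq ((WP.setup hS hG (by rwa [a1])).mono fun σ2 ⟨hG2, b1, b2, b3, b4, b5⟩ => ?_)
  have e : k * (4300 + 600 * height u) = 4300 * k + k * (600 * height u) := by ring
  rw [e] at b5
  rw [ek]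
  refine .branch hw (by decide) (by simp) (fun hn => ?_) fun hn => ?_
  · refine (WP.intersect (σ := σ2.tick) hS hI hG2 b1 b2 (b3.1 hn)).mono
      fun σ3 ⟨c1, c2, c3, c4, c5⟩ => ⟨c1, c2, c3, fun x hx => ?_, ?_⟩
    · rw [c4 x hx, Store.tick_m, b4 x hx, a1]
    · have e' : k * (11800 * total u k T) = 11800 * (k * total u k T) := by ring
      rw [e']
      rw [Store.tick_clk] at c5
      omega
  · have hempty : I = ∅ := by
      rw [Expr.val_var] at hn
      have : ¬ ∀ j < k, (T j).Nonempty := fun o => b3.2 o hn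
      push Not at this
      obtain ⟨j, hj, hT⟩ := this
      rw [Finset.eq_empty_iff_forall_notMem]
      intro x hx
      have := (hI x).1 hx j hj
      rw [hT] at this
      simp at this
    subst hempty
    refine .seq (.assign hw _ (by decide) 0 (by simp) (by simp) ?_)
    refine .seq (.assign hw _ (by decide) 0 (by simp) (by simp) ?_)
    refine .assign hw _ (by decide) 0 (by simp) (by simp)
      ⟨by simp, ?_, by simp [trieCode_empty], ?_, ?_⟩
    · intro j hj
      simp [trieCode_empty] at hj
    · intro x hx
      simp [b4 x hx, a1]
    · simp
      omega

end

section
variable {w u k D : ℕ} {T : ℕ → Finset ℕ}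

/-- The number of steps in terms of a bound `x` for the number of nodes at the same depth where the
traversal goes on.  The constant covers `3 * 6700` for the headers and `7 * 11800` for the visited
nodes. -/
lemma steps_le {x : ℕ} (hu : 1 ≤ u) (h1 : 1 ≤ x) (hxu : x ≤ u)
    (hx : ∀ d m, ((Finset.range m).filter fun v =>
      (∀ j < k, IsNode u (T j) d v) ∧ ∃ j < k, ¬ IsFull u (T j) d v).card ≤ x) :
    ((6700 + 800 * height u + 11800 * total u k T : ℕ) : ℝ) ≤
      110000 * (x * (1 + Real.logb 2 ((u : ℝ) / x))) := by
  have e1 := count_visited_two_mul_le (u := u) (k := k) (T := T) (h := 2 ^ height u)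
    Nat.one_le_two_pow
  have e2 := (count_expanded_le hx (height u)).trans (sum_min_le h1 (height u))
  rw [← pow_succ'] at e1
  have e3 : ((total u k T : ℕ) : ℝ) ≤ ((1 + 2 * (x * (1 + (height u - Nat.log 2 x))) : ℕ) : ℝ) :=
    Nat.cast_le.2 (e1.trans (by omega))
  have e4 := e3.trans (level_sum_le hu h1 hxu)
  have e5 := height_add_one_le hu h1 hxu
  push_cast
  linarith [(Nat.cast_nonneg (height u) : (0 : ℝ) ≤ height u)]

/-- The sets of the query, in the order of their addresses. -/
def queried {N : ℕ} (S : Fin N → Finset ℕ) {Q : Finset (Fin N)} (e : Fin Q.card ≃ Q) (j : ℕ) :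
    Finset ℕ :=
  if h : j < Q.card then S (e ⟨j, h⟩) else ∅

lemma forall_queried {N : ℕ} (S : Fin N → Finset ℕ) {Q : Finset (Fin N)} (e : Fin Q.card ≃ Q)
    (p : Finset ℕ → Prop) : (∀ j < Q.card, p (queried S e j)) ↔ ∀ q ∈ Q, p (S q) := by
  constructor
  · intro h q hq
    have := h (e.symm ⟨q, hq⟩) (e.symm ⟨q, hq⟩).2
    simpa [queried] using this
  · intro h j hj
    rw [queried, dif_pos hj]
    exact h _ (e ⟨j, hj⟩).2

lemma query_correct {N : ℕ} {S : Fin N → Finset ℕ} {Q : Finset (Fin N)} (hu : 1 ≤ u)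
    (hS : ∀ i, S i ⊆ Finset.range u) (hQ : Q.Nonempty) {s : State w}
    (hcap : D + 2000 * (Q.card * u) ≤ 2 ^ w)
    (hs : IsInput (fun u T => prefixBits u T ++ trieCode u T ++ []) u S Q D s) :
    ∃ (t : ℕ) (s' : State w), Exec query s t s' ∧ IsOutput u (inter u S Q) s' ∧
      (∀ x < D, s'.mem x = s.mem x) ∧
      (t : ℝ) ≤ (110000 : ℕ) * (Q.card * (runAlternation u S Q *
        (1 + Real.logb 2 ((u : ℝ) / (runAlternation u S Q : ℝ))))) := by
  obtain ⟨addr, e, hst, hq, q0, q1, q2, q3⟩ := hs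
  have hset : Setting w u Q.card D (queried S e) :=
    ⟨hu, hQ.card_pos, (forall_queried S e (· ⊆ Finset.range u)).2 fun q _ => hS q, hcap⟩
  obtain ⟨h1, h2, h3, h4⟩ := hset.bounds
  have hw := hset.three_le
  have hI : ∀ x, x ∈ inter u S Q ↔ ∀ j < Q.card, x ∈ queried S e j := by
    intro x
    rw [forall_queried S e (x ∈ ·), inter, Finset.mem_filter, and_iff_right_iff_imp]
    obtain ⟨q, hq⟩ := hQ
    exact fun h => hS q (h q hq)
  have ofNat : ∀ n < 2 ^ w, (BitVec.ofNat w n).toNat = n := fun n hn => by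
    rw [BitVec.toNat_ofNat, Nat.mod_eq_of_lt hn]
  have hwlt : w < 2 ^ w := Nat.lt_two_pow_self
  set σ : Store := ⟨fun r => (s.reg r).toNat, fun a => (s.mem a).toNat, 0⟩ with hσ
  have hb : ∀ j < Q.card, BitsAt w σ.m (σ.m (D + j)) D
      (prefixBits u (queried S e j) ++ trieCode u (queried S e j)) := by
    intro j hj
    have hst := hst (e ⟨j, hj⟩)
    simp only [List.append_nil] at hst
    have haddr : addr (e ⟨j, hj⟩) < D := by
      have := (hst 0 (by simp [prefixBits, directory])).1
      rwa [Nat.zero_div, add_zero] at this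
    have hm : σ.m (D + j) = addr (e ⟨j, hj⟩) := by
      change (s.mem (D + j)).toNat = _
      rw [hq ⟨j, hj⟩, ofNat _ (by omega)]
    rw [hm, queried, dif_pos hj]
    exact hst
  obtain ⟨t, s', σ', hex, hclk, hrel, o1, o2, o3, o4, o5⟩ := WP.query hset hI
    (show σ.v 0 = u by rw [hσ]; simp only [q0]; exact ofNat _ (by omega))
    (show σ.v 1 = w by rw [hσ]; simp only [q1]; exact ofNat _ hwlt)
    (show σ.v 2 = Q.card by rw [hσ]; simp only [q2]; exact ofNat _ (by omega))
    (show σ.v 3 = D by rw [hσ]; simp only [q3]; exact ofNat _ (by omega)) hb s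
    ⟨fun _ _ => rfl, fun _ => rfl⟩
  refine ⟨t, s', hex, ⟨?_, ?_, ?_⟩, fun x hx => ?_, ?_⟩
  · apply BitVec.eq_of_toNat_eq
    rw [hrel.1 0 (by omega), o1]
    split_ifs with hne
    · rw [ofNat 1 (by omega), decide_eq_true hne]; rfl
    · rw [ofNat 0 (by omega), decide_eq_false hne]; rfl
  · rw [hrel.1 1 (by omega)]
    intro j hj
    obtain ⟨p1, p2⟩ := o2 j hj
    refine ⟨p1, ?_⟩
    rw [← p2, ← hrel.2]
    rfl
  · rw [hrel.1 2 (by omega), o3]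
  · apply BitVec.eq_of_toNat_eq
    rw [hrel.2, o4 x hx]
  · have hsteps := steps_le (u := u) (k := Q.card) (T := queried S e)
      (x := runAlternation u S Q) hu (one_le_runAlternation hu) (runAlternation_le u S Q)
      fun d m => by
        refine (Finset.card_le_card ?_).trans (card_expanded_le hS hQ d m)
        intro v hv
        rw [Finset.mem_filter] at hv ⊢
        refine ⟨hv.1, (forall_queried S e fun A => IsNode u A d v).1 hv.2.1, ?_⟩
        obtain ⟨j, hj, hf⟩ := hv.2.2
        by_contra hc
        push Not at hc
        exact hf ((forall_queried S e fun A => IsFull u A d v).2 hc j hj)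
    have ht : t ≤ Q.card *
        (6700 + 800 * height u + 11800 * total u Q.card (queried S e)) := by
      have h0 : σ.clk = 0 := rfl
      omega
    calc (t : ℝ) ≤ ((Q.card *
          (6700 + 800 * height u + 11800 * total u Q.card (queried S e)) : ℕ) : ℝ) :=
          Nat.cast_le.2 ht
      _ ≤ Q.card * (110000 * (runAlternation u S Q *
          (1 + Real.logb 2 ((u : ℝ) / runAlternation u S Q)))) := by
          rw [Nat.cast_mul]
          exact mul_le_mul_of_nonneg_left hsteps (Nat.cast_nonneg _)
      _ = _ := by push_cast; ring

end
end RunTrie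

theorem theorem3 :
    ∃ (pre post : ℕ → Finset ℕ → List Bool) (f : ℕ → ℕ) (P : RunTrie.Prog) (c C : ℕ),
      (fun n : ℕ => (f n : ℝ)) =o[Filter.atTop] (fun n : ℕ => (n : ℝ)) ∧
      (∀ (u : ℕ) (S : Finset ℕ), 1 ≤ u → S ⊆ Finset.range u →
        (pre u S ++ RunTrie.trieCode u S ++ post u S).length
          ≤ 2 * RunTrie.rTrie u S + f (RunTrie.rTrie u S)) ∧
      ∀ (N u : ℕ) (S : Fin N → Finset ℕ) (Q : Finset (Fin N)),
        1 ≤ u → (∀ i, S i ⊆ Finset.range u) → Q.Nonempty →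
        RunTrie.runAlternation u S Q ≤ RunTrie.alternation u S Q ∧
        ∀ (w D : ℕ) (s : RunTrie.State w),
          D + c * (Q.card * u) ≤ 2 ^ w →
          RunTrie.IsInput (fun u T => pre u T ++ RunTrie.trieCode u T ++ post u T) u S Q D s →
          ∃ (t : ℕ) (s' : RunTrie.State w),
            RunTrie.Exec P s t s' ∧
            RunTrie.IsOutput u (RunTrie.inter u S Q) s' ∧
            (∀ x < D, s'.mem x = s.mem x) ∧
            (t : ℝ) ≤ C * (Q.card * (RunTrie.runAlternation u S Q *
              (1 + Real.logb 2 ((u : ℝ) / (RunTrie.runAlternation u S Q : ℝ))))) := by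
  refine ⟨RunTrie.prefixBits, fun _ _ => [], RunTrie.redundancy, RunTrie.query, 2000, 110000,
    RunTrie.redundancy_isLittleO, fun u S _ _ => RunTrie.length_representation_le u S,
    fun N u S Q hu hS hQ => ⟨RunTrie.runAlternation_le_alternation u S Q,
      fun w D s hcap hs => RunTrie.query_correct hu hS hQ hcap hs⟩⟩
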